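/- **Definitions.** A *thick planar Lie group* is a topological group $\mathbb G$ with a continuous homomorphism $p:\mathbb G\to GL(2,\mathbb R)$ that is a covering of a union of connected components of $GL(2,\mathbb R)$ and for which $p^{-1}(GL^+(2,\mathbb R))$ is connected. Put $G_0=p^{-1}(\{\mathrm{diag}(1,\pm1)\})$, with its parity $G_0\to\{\pm1\}$, and let $\kappa\in\ker p$ be the endpoint of the lift, starting at $1$, of the loop of rotations by $2\pi t$, $t\in[0,1]$. The associated crossed simplicial group $\Delta G$ is the category with objects $[n]$, $n\ge 0$, in which a morphism $[m]\to[n]$ is a class of pairs $(F,x)$, where $x\in G_0$ has parity $\varepsilon$ and $F:\mathbb Z\to\mathbb Z$ is non-decreasing if $\varepsilon=1$, non-increasing if $\varepsilon=-1$, with $F(l+m+1)=F(l)+\varepsilon(n+1)$; the pairs $(F+j(n+1),x)$ and $(F,\kappa^jx)$, $j\in\mathbb Z$, are identified, and pairs are composed componentwise. It contains the simplex category $\Delta$ (extend monotone maps periodically, with $x=1$), and $F\mapsto F \bmod (n+1)$ gives a functor $[n]\mapsto\{0,\dots,n\}$ to sets. (These are the cyclic, dihedral, paracyclic, paradihedral,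 $N$-cyclic, $N$-dihedral and $N$-quaternionic categories.) A *$\Delta G$-structured set* is a set $I$ with $n+1$ elements, $n\ge0$, a right $\mathrm{Aut}_{\Delta G}([n])$-torsor $\mathcal O(I)$ (of *structured frames*) and a map from $\mathcal O(I)$ to the bijections $\{0,\dots,n\}\to I$, equivariant along $\mathrm{Aut}_{\Delta G}([n])\to S_{n+1}$. A morphism $\psi:I'\to I$ is a family of morphisms $\psi_{f,f'}:[n']\to[n]$ of $\Delta G$, $f\in\mathcal O(I)$, $f'\in\mathcal O(I')$, with $\psi_{fg,f'g'}=g^{-1}\psi_{f,f'}g'$; composition is $(\psi\psi')_{f,f''}=\psi_{f,f'}\psi'_{f',f''}$. A *graph* $\Gamma$ consists of sets $H$ (half-edges) and $V$ (vertices), an involution $\tau$ of $H$ without fixed points and a map $s:H\to V$; put $H(v)=s^{-1}(v)$. Its edges are the sets $\{h,\tau h\}$. Its *incidence category* $I(\Gamma)$ has the vertices and edges as objects, and one non-identity morphism $s(h)\to\{h,\tau h\}$ for each $h\in H$. Its *incidence diagram* $I_\Gamma:I(\Gamma)\to\mathrm{Set}$ sends $v$ to $H(v)$, $\{h,\tau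 h\}$ to $\{h,\tau h\}$, and the morphism of $h$ to the map that takes $h$ to $\tau h$ and every other element of $H(s(h))$ to $h$. A *$\Delta G$-structure* on $\Gamma$ is a lift of $I_\Gamma$ to a functor from $I(\Gamma)$ to $\Delta G$-structured sets. The realization $|\Gamma|$ is the geometric realization of $I(\Gamma)$; it has a segment from $s(h)$ to the midpoint of $\{h,\tau h\}$ for each $h\in H$. A *surface* $S$ is a connected $C^\infty$ surface, possibly with boundary. A *$\mathbb G$-structure* on $S$ is a principal $\mathbb G$-bundle $F\to S$ with a $p$-equivariant continuous map $\rho:F\to\mathrm{Fr}_S$ over $S$ to the bundle of frames of the tangent bundle. An *embedding* of $\Gamma$ in $S$ is an injective continuous map $\gamma:|\Gamma|\to S$ that sends the $1$-valent vertices to $\partial S$ and all other points to the interior, is a regular $C^\infty$ curve (nowhere vanishing velocity) on each segment, and for which the tangent directions of the segments leaving any given vertex or any given midpoint are distinct. **Statement.** Let $\mathbb G$ be a thick planar Lie group, $S$ a surface with a $\mathbb G$-structure, $\Gamma$ a graph all of whose vertices have finite nonzero valency, and $\gamma$ an embedding of $\Gamma$ in $S$. Then $\gamma$ induces a canonical $\Delta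 G$-structure on $\Gamma$. That is, there is a lift $\widetilde I_\Gamma$ of $I_\Gamma$ to $\Delta G$-structured sets with the following properties. 1. For a vertex or edge $X$ with half-edge set $I=I_\Gamma(X)$, viewed as a set of tangent directions at $\gamma(X)$, the set $\mathcal O(I)$ is identified with $\pi_0$ of the space of those $f\in F_{\gamma(X)}$ for which the first vector of the frame $\rho(f)$ has its direction in $I$. This direction is the element of $I$ numbered $0$ by $f$. The class of $(l\mapsto\varepsilon l,x)$, $x\in G_0$ of parity $\varepsilon$, acts by $f\mapsto fx$; the class of $(l\mapsto l+1,1)$ acts by turning $f$, in the sense from its first vector to its second one, until the first vector next has its direction in $I$. 2. Let $h\in H$, $v=s(h)$, $e=\{h,\tau h\}$, and let $f$ be a structured frame at $v$ whose first vector points along $h$. Transport $f$ along $\gamma$ from $v$ to the midpoint of $e$ so that its first vector points along the velocity, and then move its first vector at the midpoint to the direction of $\tau h$ without crossing the direction of $h$; let $f'$ be the resulting structured frame of $e$. Then the morphism $\psi=\widetilde I_\Gamma(v\to e)$ has $\psi_{f',f}$ equal to the morphism $[n]\to[1]$, $0\mapsto0$, $i\mapsto1$ $(i>0)$, of $\Delta$,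 where $n+1=|H(v)|$. Such a lift is unique up to a unique natural isomorphism that lies over the identity of $I_\Gamma$ and respects the identifications in 1. -/

import Mathlib

open CategoryTheory Topology
open scoped Manifold ContDiff

namespace PlanarGraph

noncomputable section

set_option linter.unusedSectionVars false
set_option linter.checkUnivs false

universe a b c d e

/-! ### Thick planar Lie groups -/

/-- A homomorphism of topological groups is a connective covering if it is a covering of a union of
connected components of the target (fibres over the other components are empty) and the preimage
of the identity component is connected. -/
structure IsConnectiveCovering {A : Type a} {B : Type b} [Group A] [TopologicalSpace A]
    [Group B] [TopologicalSpace B] (p : A →* B) : Prop where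
  isCoveringMap : IsCoveringMap p
  isConnected_preimage : IsConnected (p ⁻¹' connectedComponent (1 : B))

/-- The rotation by the angle `θ`. -/
def rotation (θ : ℝ) : GL (Fin 2) ℝ where
  val := !![Real.cos θ, -Real.sin θ; Real.sin θ, Real.cos θ]
  inv := !![Real.cos θ, Real.sin θ; -Real.sin θ, Real.cos θ]
  val_inv := by
    ext i j
    fin_cases i <;> fin_cases j <;> simp [Matrix.mul_apply, Fin.sum_univ_two] <;>
      nlinarith [Real.sin_sq_add_cos_sq θ]
  inv_val := by
    ext i j
    fin_cases i <;> fin_cases j <;> simp [Matrix.mul_apply, Fin.sum_univ_two] <;>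
      nlinarith [Real.sin_sq_add_cos_sq θ]

/-- The subgroup `O(1) = {diag(1, 1), diag(1, -1)}` of `GL(2, ℝ)`. -/
def reflection : ℤˣ →* GL (Fin 2) ℝ where
  toFun ε :=
    { val := !![1, 0; 0, ((ε : ℤ) : ℝ)]
      inv := !![1, 0; 0, ((ε : ℤ) : ℝ)]
      val_inv := by
        rcases Int.units_eq_one_or ε with rfl | rfl <;>
          (ext i j; fin_cases i <;> fin_cases j <;> simp [Matrix.mul_apply, Fin.sum_univ_two])
      inv_val := by
        rcases Int.units_eq_one_or ε with rfl | rfl <;>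
          (ext i j; fin_cases i <;> fin_cases j <;> simp [Matrix.mul_apply, Fin.sum_univ_two]) }
  map_one' := by
    ext i j; fin_cases i <;> fin_cases j <;> simp
  map_mul' x y := by
    ext i j; fin_cases i <;> fin_cases j <;> simp [Matrix.mul_apply, Fin.sum_univ_two]

theorem rotation_zero : rotation 0 = 1 := by
  ext i j; fin_cases i <;> fin_cases j <;> simp [rotation]

theorem rotation_add (x y : ℝ) : rotation (x + y) = rotation x * rotation y := by
  ext i j
  fin_cases i <;> fin_cases j <;>
    simp [rotation, Matrix.mul_apply, Fin.sum_univ_two, Real.cos_add, Real.sin_add] <;> ring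

theorem reflection_mul_rotation (ε : ℤˣ) (x : ℝ) :
    reflection ε * rotation x = rotation (((ε : ℤ) : ℝ) * x) * reflection ε := by
  rcases Int.units_eq_one_or ε with rfl | rfl <;>
    (ext i j
     fin_cases i <;> fin_cases j <;>
      simp [rotation, reflection, Matrix.mul_apply, Fin.sum_univ_two])

/-! ### The crossed simplicial group of a thick planar Lie group

For `p : 𝔾 → GL(2, ℝ)` put `G₀ = p⁻¹(O(1))`, with its parity `G₀ → O(1) = {±1}`. A morphism
`[m] → [n]` of `ΔG` is represented by a morphism `F : ℤ → ℤ` of the paradihedral category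
(a monotone or antitone map with `F(l + m + 1) = F(l) ± (n + 1)`) and an element of `G₀` of the
same parity. A full turn on `[n]` is identified with its image in `G₀`, namely the endpoint of the
lift to `𝔾` of the loop of rotations. For the coverings of `SO(2)` and `O(2)` one finds the
(`N`-)cyclic, paracyclic, (`N`-)dihedral, paradihedral and (`N`-)quaternionic categories, and
`Aut([n])` is the preimage of the dihedral group of order `2(n + 1)`. -/

section DeltaG

variable {𝔾 : Type a} [Group 𝔾] [TopologicalSpace 𝔾]

/-- Representatives of morphisms `[m] → [n]`. -/
@[ext]
structure PreHom (p : 𝔾 →* GL (Fin 2) ℝ) (m n : ℕ) where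
  /-- the parity -/
  sign : ℤˣ
  /-- the periodic map -/
  toFun : ℤ → ℤ
  monotone : Monotone fun l => (sign : ℤ) * toFun l
  periodic : ∀ l, toFun (l + (m + 1)) = toFun l + sign * (n + 1)
  /-- the element of `G₀` -/
  elt : 𝔾
  map_elt : p elt = reflection sign

namespace PreHom

variable {p : 𝔾 →* GL (Fin 2) ℝ} {m n k : ℕ}

theorem periodic_mul (u : PreHom p m n) (l j : ℤ) :
    u.toFun (l + j * (m + 1)) = u.toFun l + u.sign * j * (n + 1) := by
  induction j using Int.induction_on with
  | zero => simp
  | succ i ih =>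
    have h := u.periodic (l + i * (m + 1))
    rw [ih] at h
    rw [show l + ((i : ℤ) + 1) * (m + 1) = l + i * (m + 1) + (m + 1) by ring, h]; ring
  | pred i ih =>
    have h := u.periodic (l + (-(i : ℤ) - 1) * (m + 1))
    rw [show l + (-(i : ℤ) - 1) * (m + 1) + (m + 1) = l + -(i : ℤ) * (m + 1) by ring, ih] at h
    linear_combination -h

/-- The identity of `[n]`. -/
protected def id (p : 𝔾 →* GL (Fin 2) ℝ) (n : ℕ) : PreHom p n n where
  sign := 1
  toFun l := l
  monotone := by intro x y h; simpa using h
  periodic l := by simp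
  elt := 1
  map_elt := by simp

/-- `u.comp v` is `v` followed by `u`. -/
def comp (u : PreHom p n k) (v : PreHom p m n) : PreHom p m k where
  sign := u.sign * v.sign
  toFun l := u.toFun (v.toFun l)
  monotone := by
    intro x y h
    have h1 := v.monotone h
    have hu : ∀ s t : ℤ, s ≤ t → (u.sign : ℤ) * u.toFun s ≤ u.sign * u.toFun t :=
      fun s t hst => u.monotone hst
    rcases Int.units_eq_one_or v.sign with hv | hv
    · simp only [hv, Units.val_one, one_mul, mul_one] at h1 ⊢
      exact hu _ _ h1
    · simp only [hv, Units.val_neg, Units.val_one, mul_neg, mul_one, neg_mul, one_mul,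
        neg_le_neg_iff] at h1 ⊢
      exact hu _ _ h1
  periodic l := by
    rw [v.periodic, u.periodic_mul]; push_cast; ring
  elt := u.elt * v.elt
  map_elt := by rw [map_mul, u.map_elt, v.map_elt, map_mul]

/-- `(F + j (n + 1), γ)` is identified with `(F, γ')` if `γ'` is the endpoint of the lift, starting
at `γ`, of the path of `j` full turns. -/
def Rel (u u' : PreHom p m n) : Prop :=
  ∃ j : ℤ, (∀ l, u'.toFun l = u.toFun l + j * (n + 1)) ∧
    ∃ c : unitInterval → 𝔾, Continuous c ∧ c 0 = u'.elt ∧ c 1 = u.elt ∧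
      ∀ t, p (c t) = rotation (2 * Real.pi * j * t) * p u'.elt

theorem Rel.sign_eq {u u' : PreHom p m n} (h : Rel u u') : u.sign = u'.sign := by
  obtain ⟨j, hj, -⟩ := h
  have h1 := u.periodic 0
  have h2 := u'.periodic 0
  rw [hj, hj, h1] at h2
  have h3 : ((u.sign : ℤ) - u'.sign) * (n + 1) = 0 := by linear_combination h2
  rcases mul_eq_zero.mp h3 with h4 | h4
  · exact Units.ext (by omega)
  · omega

variable [IsTopologicalGroup 𝔾]

theorem Rel.refl (u : PreHom p m n) : Rel u u :=
  ⟨0, by simp, fun _ => u.elt, continuous_const, rfl, rfl, by simp [rotation_zero]⟩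

theorem Rel.symm {u u' : PreHom p m n} (h : Rel u u') : Rel u' u := by
  have hs := h.sign_eq
  obtain ⟨j, hj, c, hc, h0, h1, hp⟩ := h
  refine ⟨-j, fun l => by rw [hj]; ring, fun t => c (unitInterval.symm t),
    hc.comp unitInterval.continuous_symm, by simpa using h1, by simpa using h0, fun t => ?_⟩
  rw [hp, u.map_elt, u'.map_elt, hs]
  have h2 : p (c 1) = rotation (2 * Real.pi * j * (1 : unitInterval)) * p u'.elt := hp 1
  rw [h1, u.map_elt, u'.map_elt, hs] at h2
  have h3 : rotation (2 * Real.pi * j) = 1 := by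
    simpa using h2
  rw [unitInterval.coe_symm_eq,
    show 2 * Real.pi * j * (1 - (t : ℝ)) = 2 * Real.pi * ((-j : ℤ) : ℝ) * t + 2 * Real.pi * j by
      push_cast; ring, rotation_add, h3, mul_one]

theorem Rel.trans {u u' u'' : PreHom p m n} (h : Rel u u') (h' : Rel u' u'') : Rel u u'' := by
  have hs' := h'.sign_eq
  obtain ⟨j, hj, c, hc, h0, h1, hp⟩ := h
  obtain ⟨j', hj', c', hc', h0', h1', hp'⟩ := h'
  refine ⟨j + j', fun l => by rw [hj', hj]; ring, fun t => c t * (u'.elt)⁻¹ * c' t,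
    by fun_prop, by simp [h0, h0'], by simp [h1, h1'], fun t => ?_⟩
  simp only [map_mul, map_inv, hp, hp', mul_inv_cancel_right]
  rw [← mul_assoc, ← rotation_add]
  congr 2
  push_cast; ring

/-- Morphisms `[m] → [n]` are classes of representatives. -/
def setoid (p : 𝔾 →* GL (Fin 2) ℝ) (m n : ℕ) : Setoid (PreHom p m n) where
  r := Rel
  iseqv := ⟨Rel.refl, Rel.symm, Rel.trans⟩

theorem Rel.comp {u u' : PreHom p n k} {v v' : PreHom p m n} (h : Rel u u') (h' : Rel v v') :
    Rel (u.comp v) (u'.comp v') := by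
  obtain ⟨j, hj, c, hc, h0, h1, hp⟩ := h
  obtain ⟨j', hj', c', hc', h0', h1', hp'⟩ := h'
  refine ⟨j + u'.sign * j', fun l => ?_, fun t => c t * c' t, by fun_prop,
    by simp [h0, h0', PreHom.comp], by simp [h1, h1', PreHom.comp], fun t => ?_⟩
  · simp only [PreHom.comp]
    rw [hj', u'.periodic_mul, hj]; ring
  · simp only [PreHom.comp, map_mul, hp, hp', u'.map_elt]
    have h2 : 2 * Real.pi * ((j + u'.sign * j' : ℤ) : ℝ) * t =
        2 * Real.pi * j * t + ((u'.sign : ℤ) : ℝ) * (2 * Real.pi * j' * t) := by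
      push_cast; ring
    rw [h2, rotation_add]
    simp only [mul_assoc]
    rw [← mul_assoc (reflection _), reflection_mul_rotation]
    simp only [mul_assoc]

end PreHom

variable [IsTopologicalGroup 𝔾]

/-- The objects `[n]`, `n ≥ 0`, of the crossed simplicial group `ΔG`. -/
@[ext]
structure DeltaG (p : 𝔾 →* GL (Fin 2) ℝ) where
  /-- the number `n` in `[n]` -/
  len : ℕ

namespace DeltaG

variable {p : 𝔾 →* GL (Fin 2) ℝ}

instance : Category (DeltaG p) where
  Hom X Y := Quotient (PreHom.setoid p X.len Y.len)
  id X := Quotient.mk _ (PreHom.id p X.len)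
  comp v u := Quotient.map₂ (fun v u => PreHom.comp u v)
    (fun _ _ h _ _ h' => PreHom.Rel.comp h' h) v u
  id_comp u := by
    induction u using Quotient.inductionOn with
    | h u => simp [PreHom.comp, PreHom.id]
  comp_id u := by
    induction u using Quotient.inductionOn with
    | h u => simp [PreHom.comp, PreHom.id]
  assoc u v w := by
    induction u using Quotient.inductionOn
    induction v using Quotient.inductionOn
    induction w using Quotient.inductionOn
    simp [PreHom.comp, mul_assoc]

/-- The morphism with a given representative. -/
def homMk {X Y : DeltaG p} (u : PreHom p X.len Y.len) : X ⟶ Y :=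
  Quotient.mk (PreHom.setoid p X.len Y.len) u

/-- The vertex of `[n]` given by an integer modulo `n + 1`. -/
def vertex (n : ℕ) (l : ℤ) : Fin (n + 1) :=
  ⟨(l % (n + 1)).toNat, by
    have h1 := Int.emod_nonneg l (show ((n : ℤ) + 1) ≠ 0 by omega)
    have h2 := Int.emod_lt_of_pos l (show 0 < ((n : ℤ) + 1) by omega)
    omega⟩

theorem vertex_add_mul (n : ℕ) (l j : ℤ) : vertex n (l + j * (n + 1)) = vertex n l := by
  simp [vertex]

theorem vertex_coe (n : ℕ) (i : Fin (n + 1)) : vertex n (i : ℕ) = i := by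
  ext
  have h := i.isLt
  simp only [vertex]
  rw [Int.emod_eq_of_lt (by omega) (by omega)]
  simp

theorem toFun_vertex {m n : ℕ} (u : PreHom p m n) (l : ℤ) :
    vertex n (u.toFun (vertex m l : ℕ)) = vertex n (u.toFun l) := by
  have h1 := Int.emod_nonneg l (show ((m : ℤ) + 1) ≠ 0 by omega)
  have h2 : (((vertex m l : Fin (m + 1)) : ℕ) : ℤ) = l % (m + 1) := by
    simp only [vertex]; omega
  have h3 : l = l % (m + 1) + (l / (m + 1)) * (m + 1) := by
    have := Int.emod_add_mul_ediv l (m + 1)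
    linear_combination -this
  rw [h2]
  conv_rhs => rw [h3, u.periodic_mul, vertex_add_mul]

/-- The functor `λ : ΔG → Set`, `[n] ↦ {0, …, n}`, on morphisms. -/
def vertexMap {X Y : DeltaG p} (u : X ⟶ Y) (i : Fin (X.len + 1)) : Fin (Y.len + 1) :=
  Quotient.liftOn u (fun w => vertex Y.len (w.toFun (i : ℕ))) (by
    rintro w w' ⟨j, hj, -⟩
    simp only [hj, vertex_add_mul])

theorem vertexMap_id (X : DeltaG p) (i) : vertexMap (𝟙 X) i = i := vertex_coe _ _

theorem vertexMap_comp {X Y Z : DeltaG p} (u : X ⟶ Y) (w : Y ⟶ Z) (i) :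
    vertexMap (u ≫ w) i = vertexMap w (vertexMap u i) := by
  induction u using Quotient.inductionOn with | h u => ?_
  induction w using Quotient.inductionOn with | h w => ?_
  exact (toFun_vertex w _).symm

/-- The periodic extension of a monotone map `[m] → [n]`. -/
def ofMonotone (p : 𝔾 →* GL (Fin 2) ℝ) {m n : ℕ} (φ : Fin (m + 1) →o Fin (n + 1)) :
    PreHom p m n where
  sign := 1
  toFun l := (φ (vertex m l) : ℕ) + (l / (m + 1)) * (n + 1)
  monotone := by
    intro x y h
    simp only [Units.val_one, one_mul]
    have hm : (0 : ℤ) < m + 1 := by omega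
    have hx := (φ (vertex m x)).isLt
    rcases (Int.ediv_le_ediv hm h).eq_or_lt with hq | hq
    · have hv : vertex m x ≤ vertex m y := by
        have e1 := Int.emod_add_mul_ediv x (m + 1)
        have e2 := Int.emod_add_mul_ediv y (m + 1)
        rw [hq] at e1
        have : x % (m + 1) ≤ y % (m + 1) := by linarith
        rw [Fin.le_def]
        simp only [vertex]
        omega
      have h2 : ((φ (vertex m x) : ℕ) : ℤ) ≤ (φ (vertex m y) : ℕ) := by
        exact_mod_cast φ.monotone hv
      rw [hq]; linarith
    · have h3 : (x / (m + 1) + 1) * ((n : ℤ) + 1) ≤ y / (m + 1) * (n + 1) :=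
        mul_le_mul_of_nonneg_right hq (by omega)
      have h4 : (0 : ℤ) ≤ (φ (vertex m y) : ℕ) := by positivity
      have h5 : ((φ (vertex m x) : ℕ) : ℤ) < n + 1 := by exact_mod_cast hx
      linarith
  periodic l := by
    have h := vertex_add_mul m l 1
    rw [one_mul] at h
    have h2 : (l + (m + 1)) / ((m : ℤ) + 1) = l / (m + 1) + 1 :=
      Int.add_ediv_of_dvd_right (dvd_refl _) |>.trans (by rw [Int.ediv_self (by omega)])
    rw [h, h2]; push_cast; ring
  elt := 1
  map_elt := by simp

/-- The embedding `Δ → ΔG`. -/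
def simplexInclusion (p : 𝔾 →* GL (Fin 2) ℝ) : SimplexCategory ⥤ DeltaG p where
  obj X := ⟨X.len⟩
  map φ := homMk (ofMonotone p φ.toOrderHom)
  map_id X := by
    refine congrArg (Quotient.mk _) (PreHom.ext rfl ?_ rfl)
    funext l
    simp only [ofMonotone, PreHom.id]
    have h1 := Int.emod_nonneg l (show ((X.len : ℤ) + 1) ≠ 0 by omega)
    have h2 := Int.emod_add_mul_ediv l (X.len + 1)
    simp only [SimplexCategory.id_toOrderHom, OrderHom.id_coe, id_eq, vertex,
      Int.toNat_of_nonneg h1]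
    linarith
  map_comp {X Y Z} φ ψ := by
    refine congrArg (Quotient.mk _) (PreHom.ext (mul_one _).symm ?_ (mul_one _).symm)
    funext l
    simp only [ofMonotone, PreHom.comp]
    set i := φ.toOrderHom (vertex X.len l) with hi
    have hlt : ((i : ℕ) : ℤ) < Y.len + 1 := by exact_mod_cast i.isLt
    rw [vertex_add_mul, vertex_coe, Int.add_mul_ediv_right _ _ (by omega),
      Int.ediv_eq_zero_of_lt (by omega) hlt, zero_add]
    rfl

/-- The morphism `[m] → [n]` of `Δ` that fixes `0` and sends all other elements to `n`. -/
def collapse (p : 𝔾 →* GL (Fin 2) ℝ) (m n : ℕ) : (⟨m⟩ : DeltaG p) ⟶ ⟨n⟩ :=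
  (simplexInclusion p).map (X := SimplexCategory.mk m) (Y := SimplexCategory.mk n)
    (SimplexCategory.mkHom
    { toFun := fun i => if i = 0 then 0 else Fin.last n
      monotone' := by
        intro i j h
        by_cases hi : i = 0
        · simp [hi]
        · have hj : j ≠ 0 := fun hj => hi (le_antisymm (hj ▸ h) (Fin.zero_le _))
          simp [hi, hj] })

/-- The automorphism `l ↦ l + 1` of `[n]`. -/
def rotate (p : 𝔾 →* GL (Fin 2) ℝ) (n : ℕ) : (⟨n⟩ : DeltaG p) ≅ ⟨n⟩ where
  hom := homMk
    { PreHom.id p n with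
      toFun := fun l => l + 1
      monotone := by intro x y h; simpa [PreHom.id] using h
      periodic := by intro l; simp only [PreHom.id]; push_cast; ring }
  inv := homMk
    { PreHom.id p n with
      toFun := fun l => l - 1
      monotone := by intro x y h; simpa [PreHom.id] using h
      periodic := by intro l; simp only [PreHom.id]; push_cast; ring }
  hom_inv_id := congrArg (Quotient.mk _) (by simp [PreHom.comp, PreHom.id])
  inv_hom_id := congrArg (Quotient.mk _) (by simp [PreHom.comp, PreHom.id])

/-- The automorphism of `[n]` given by an element of `G₀ = p⁻¹(O(1))`, acting on `ℤ` by
`l ↦ ± l`. -/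
def reflect (n : ℕ) (ε : ℤˣ) (x : 𝔾) (hx : p x = reflection ε) : (⟨n⟩ : DeltaG p) ≅ ⟨n⟩ where
  hom := homMk
    { sign := ε
      toFun := fun l => ε * l
      monotone := by
        intro s t h
        simpa [← mul_assoc, ← Units.val_mul] using h
      periodic := by intro l; ring
      elt := x
      map_elt := hx }
  inv := homMk
    { sign := ε
      toFun := fun l => ε * l
      monotone := by
        intro s t h
        simpa [← mul_assoc, ← Units.val_mul] using h
      periodic := by intro l; ring
      elt := x⁻¹
      map_elt := by rw [map_inv, hx, ← map_inv, Int.units_inv_eq_self] }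
  hom_inv_id := congrArg (Quotient.mk _) (by
    simp [PreHom.comp, PreHom.id, ← mul_assoc, ← Units.val_mul])
  inv_hom_id := congrArg (Quotient.mk _) (by
    simp [PreHom.comp, PreHom.id, ← mul_assoc, ← Units.val_mul])

end DeltaG

/-! ### Structured sets -/

/-- A `ΔG`-structured set: a nonempty finite set `I` with `n + 1` elements, a right torsor `𝒪(I)`
over the group of automorphisms of `[n]` in `ΔG` and a map from `𝒪(I)` to the bijections
`{0, …, n} → I` that is equivariant along the homomorphism from that group to `S_{n+1}`. -/
structure StructuredSet (p : 𝔾 →* GL (Fin 2) ℝ) where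
  /-- the underlying set -/
  carrier : Type b
  /-- the number `n` -/
  len : ℕ
  /-- the set `𝒪(I)` of structured frames -/
  Frame : Type c
  frame_nonempty : Nonempty Frame
  /-- the right action -/
  act : Frame → ((⟨len⟩ : DeltaG p) ≅ ⟨len⟩) → Frame
  act_refl : ∀ o, act o (Iso.refl _) = o
  -- the product `x y` of the group is `x ∘ y`
  act_trans : ∀ o x y, act o (y ≪≫ x) = act (act o x) y
  existsUnique_act : ∀ o o', ∃! x, act o x = o'
  /-- the bijection of a structured frame -/
  label : Frame → Fin (len + 1) ≃ carrier
  label_act : ∀ o x i, label (act o x) i = label o (DeltaG.vertexMap x.hom i)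

namespace StructuredSet

variable {p : 𝔾 →* GL (Fin 2) ℝ}

/-- The standard object `[n]` isomorphic to a structured set. -/
abbrev std (X : StructuredSet.{a, b, c} p) : DeltaG p := ⟨X.len⟩

/-- A morphism `ψ : I' → I` is a family `ψ_{f, f'} : [n'] → [n]` with
`ψ_{f x, f' x'} = x⁻¹ ∘ ψ_{f, f'} ∘ x'`. -/
@[ext]
structure Hom (X' X : StructuredSet.{a, b, c} p) where
  /-- the family -/
  app : X.Frame → X'.Frame → (X'.std ⟶ X.std)
  app_act : ∀ f f' (x : X.std ≅ X.std) (x' : X'.std ≅ X'.std),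
    app (X.act f x) (X'.act f' x') = x'.hom ≫ app f f' ≫ x.inv

/-- The automorphism that takes one frame to another. -/
def diff (X : StructuredSet.{a, b, c} p) (o o' : X.Frame) : X.std ≅ X.std :=
  (X.existsUnique_act o o').choose

theorem act_diff (X : StructuredSet.{a, b, c} p) (o o' : X.Frame) : X.act o (X.diff o o') = o' :=
  (X.existsUnique_act o o').choose_spec.1

theorem eq_diff (X : StructuredSet.{a, b, c} p) {o o' : X.Frame} {x : X.std ≅ X.std}
    (h : X.act o x = o') : x = X.diff o o' :=
  (X.existsUnique_act o o').choose_spec.2 x h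

theorem Hom.app_act_left {X' X : StructuredSet.{a, b, c} p} (ψ : Hom X' X) (f f')
    (x : X.std ≅ X.std) : ψ.app (X.act f x) f' = ψ.app f f' ≫ x.inv := by
  have h := ψ.app_act f f' x (Iso.refl _)
  rwa [X'.act_refl, Iso.refl_hom, Category.id_comp] at h

theorem Hom.app_act_right {X' X : StructuredSet.{a, b, c} p} (ψ : Hom X' X) (f f')
    (x' : X'.std ≅ X'.std) : ψ.app f (X'.act f' x') = x'.hom ≫ ψ.app f f' := by
  have h := ψ.app_act f f' (Iso.refl _) x'
  rwa [X.act_refl, Iso.refl_inv, Category.comp_id] at h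

/-- The composite of the families does not depend on the intermediate frame. -/
theorem Hom.comp_indep {X'' X' X : StructuredSet.{a, b, c} p} (ψ' : Hom X'' X') (ψ : Hom X' X)
    (f'' f) (f₁ f₂ : X'.Frame) :
    ψ'.app f₁ f'' ≫ ψ.app f f₁ = ψ'.app f₂ f'' ≫ ψ.app f f₂ := by
  obtain ⟨x, rfl⟩ : ∃ x, X'.act f₁ x = f₂ := ⟨_, X'.act_diff f₁ f₂⟩
  rw [ψ'.app_act_left, ψ.app_act_right]
  simp

instance : Category (StructuredSet.{a, b, c} p) where
  Hom X' X := Hom X' X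
  id X :=
    { app := fun f f' => (X.diff f f').hom
      app_act := by
        intro f f' x x'
        have h : x' ≪≫ X.diff f f' ≪≫ x.symm = X.diff (X.act f x) (X.act f' x') := by
          apply X.eq_diff
          rw [← X.act_trans, Iso.trans_assoc, Iso.trans_assoc, Iso.symm_self_id, Iso.trans_refl,
            X.act_trans, X.act_diff]
        rw [← h]
        rfl }
  comp {X'' X' X} ψ' ψ :=
    { app := fun f f'' =>
        ψ'.app (Classical.choice X'.frame_nonempty) f'' ≫
          ψ.app f (Classical.choice X'.frame_nonempty)
      app_act := by
        intro f f'' x x''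
        rw [ψ'.app_act_right, ψ.app_act_left]
        simp }
  id_comp {X Y} ψ := by
    apply Hom.ext
    funext f f'
    refine (ψ.app_act_right _ _ _).symm.trans ?_
    rw [X.act_diff]
  comp_id {X Y} ψ := by
    apply Hom.ext
    funext f f'
    have h := ψ.app_act_left f f' (Y.diff f (Classical.choice Y.frame_nonempty))
    rw [Y.act_diff] at h
    change ψ.app _ f' ≫ (Y.diff f _).hom = _
    rw [h, Category.assoc, Iso.inv_hom_id, Category.comp_id]
  assoc ψ ψ' ψ'' := by
    apply Hom.ext
    funext f f'
    exact Category.assoc _ _ _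

/-- The family of a morphism. -/
def comps {X' X : StructuredSet.{a, b, c} p} (ψ : X' ⟶ X) :
    X.Frame → X'.Frame → (X'.std ⟶ X.std) := Hom.app ψ

theorem comps_id (X : StructuredSet.{a, b, c} p) (f f' : X.Frame) :
    comps (𝟙 X) f f' = (X.diff f f').hom := rfl

theorem comps_comp {X'' X' X : StructuredSet.{a, b, c} p} (ψ' : X'' ⟶ X') (ψ : X' ⟶ X)
    (f f' f'') : comps (ψ' ≫ ψ) f f'' = comps ψ' f' f'' ≫ comps ψ f f' :=
  Hom.comp_indep ψ' ψ f'' f _ _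

/-- The map of underlying sets, computed in a pair of frames. -/
def under {X' X : StructuredSet.{a, b, c} p} (ψ : X' ⟶ X) (f : X.Frame) (f' : X'.Frame)
    (i : X'.carrier) : X.carrier :=
  X.label f (DeltaG.vertexMap (comps ψ f f') ((X'.label f').symm i))

theorem under_indep {X' X : StructuredSet.{a, b, c} p} (ψ : X' ⟶ X) (f₁ f₂ : X.Frame)
    (f₁' f₂' : X'.Frame) (i : X'.carrier) : under ψ f₁ f₁' i = under ψ f₂ f₂' i := by
  obtain ⟨x, rfl⟩ : ∃ x, X.act f₁ x = f₂ := ⟨_, X.act_diff f₁ f₂⟩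
  obtain ⟨x', rfl⟩ : ∃ x, X'.act f₁' x = f₂' := ⟨_, X'.act_diff f₁' f₂'⟩
  obtain ⟨k, rfl⟩ := (X'.label (X'.act f₁' x')).surjective i
  have h : comps ψ (X.act f₁ x) (X'.act f₁' x') = x'.hom ≫ comps ψ f₁ f₁' ≫ x.inv :=
    Hom.app_act ψ _ _ _ _
  rw [under, under, Equiv.symm_apply_apply, X'.label_act, Equiv.symm_apply_apply, X.label_act, h,
    ← DeltaG.vertexMap_comp, ← DeltaG.vertexMap_comp]
  simp

/-- The forgetful functor to sets. -/
def forget (p : 𝔾 →* GL (Fin 2) ℝ) : StructuredSet.{a, b, c} p ⥤ Type b where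
  obj X := X.carrier
  map {X' X} ψ := TypeCat.ofHom
    (under ψ (Classical.choice X.frame_nonempty) (Classical.choice X'.frame_nonempty))
  map_id X := by
    ext i
    have h : X.diff (Classical.choice X.frame_nonempty) (Classical.choice X.frame_nonempty) =
        Iso.refl _ := (X.eq_diff (X.act_refl _)).symm
    change under (𝟙 X) _ _ i = i
    rw [under, comps_id, h, Iso.refl_hom, DeltaG.vertexMap_id, Equiv.apply_symm_apply]
  map_comp {X'' X' X} ψ' ψ := by
    ext i
    change under (ψ' ≫ ψ) _ _ i = under ψ _ _ (under ψ' _ _ i)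
    rw [under, under, under, comps_comp ψ' ψ _ (Classical.choice X'.frame_nonempty),
      DeltaG.vertexMap_comp, Equiv.symm_apply_apply]

end StructuredSet

end DeltaG

/-! ### Graphs -/

/-- A compact graph: half-edges, vertices, an involution without fixed points (every half-edge is
internal) and the map sending a half-edge to its vertex. -/
structure Graph where
  /-- half-edges -/
  H : Type d
  /-- vertices -/
  V : Type e
  /-- the involution -/
  τ : H → H
  τ_τ : ∀ h, τ (τ h) = h
  τ_ne : ∀ h, τ h ≠ h
  /-- the vertex of a half-edge -/
  src : H → V

namespace Graph

variable (Γ : Graph.{d, e})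

/-- Edges are the orbits `{h, τ h}`. -/
def Edge : Type d := {x : Sym2 Γ.H // ∃ h, x = s(h, Γ.τ h)}

/-- The edge of a half-edge. -/
def edgeOf (h : Γ.H) : Γ.Edge := ⟨s(h, Γ.τ h), h, rfl⟩

/-- The objects of the incidence category: vertices and edges. -/
inductive Cell : Type (max d e)
  | vert (v : Γ.V) : Cell
  | edge (x : Γ.Edge) : Cell

/-- The morphisms of the incidence category: identities and one morphism from `s(h)` to
`{h, τ h}` for each half-edge `h`. -/
inductive CellHom : Γ.Cell → Γ.Cell → Type (max d e)
  | id (X : Γ.Cell) : CellHom X X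
  | inc (h : Γ.H) : CellHom (Cell.vert (Γ.src h)) (Cell.edge (Γ.edgeOf h))

variable {Γ}

/-- Composition in the incidence category. -/
def CellHom.comp : ∀ {X Y Z : Γ.Cell}, Γ.CellHom X Y → Γ.CellHom Y Z → Γ.CellHom X Z
  | _, _, _, .id _, u => u
  | _, _, _, .inc h, .id _ => .inc h

instance : Category Γ.Cell where
  Hom := Γ.CellHom
  id := CellHom.id
  comp := CellHom.comp
  id_comp _ := rfl
  comp_id u := by cases u <;> rfl
  assoc u v w := by cases u <;> cases v <;> rfl

variable (Γ)

/-- The morphism `s(h) → {h, τ h}`. -/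
def inc (h : Γ.H) : (Cell.vert (Γ.src h) : Γ.Cell) ⟶ Cell.edge (Γ.edgeOf h) := CellHom.inc h

/-- The half-edges at a vertex, or of an edge. -/
def star : Γ.Cell → Type d
  | .vert v => {h : Γ.H // Γ.src h = v}
  | .edge x => {h : Γ.H // h ∈ x.1}

open Classical in
/-- The incidence map of `h`: it sends `h` to `τ h` and every other half-edge at `s(h)` to `h`. -/
def incidence (h : Γ.H) (x : {h' : Γ.H // Γ.src h' = Γ.src h}) :
    {h' : Γ.H // h' ∈ (Γ.edgeOf h).1} :=
  if x.1 = h then ⟨Γ.τ h, Sym2.mem_mk_right _ _⟩ else ⟨h, Sym2.mem_mk_left _ _⟩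

variable {Γ} in
/-- The incidence diagram on morphisms. -/
def CellHom.onStar : ∀ {X Y : Γ.Cell}, Γ.CellHom X Y → Γ.star X → Γ.star Y
  | _, _, .id _ => fun x => x
  | _, _, .inc h => Γ.incidence h

theorem CellHom.onStar_comp {Γ : Graph.{d, e}} {X Y Z : Γ.Cell} (u : Γ.CellHom X Y)
    (v : Γ.CellHom Y Z) (x : Γ.star X) : (u.comp v).onStar x = v.onStar (u.onStar x) := by
  cases u <;> cases v <;> rfl

/-- The incidence diagram. -/
def incidenceDiagram : Γ.Cell ⥤ Type d where
  obj := Γ.star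
  map u := TypeCat.ofHom (CellHom.onStar u)
  map_id _ := rfl
  map_comp u v := by
    ext x
    exact CellHom.onStar_comp u v x

/-- The cells glued to the realization: a point for each vertex and each edge of the graph, and an
interval for each half-edge. -/
abbrev PreRealization := (Σ _ : Γ.Cell, Unit) ⊕ (Σ _ : Γ.H, unitInterval)

/-- The interval of `h` is attached to `s(h)` at `0` and to the midpoint of `{h, τ h}` at `1`. -/
inductive Glue : Γ.PreRealization → Γ.PreRealization → Prop
  | start (h : Γ.H) : Glue (.inr ⟨h, 0⟩) (.inl ⟨.vert (Γ.src h), ()⟩)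
  | finish (h : Γ.H) : Glue (.inr ⟨h, 1⟩) (.inl ⟨.edge (Γ.edgeOf h), ()⟩)

/-- The geometric realization of (the nerve of) the incidence category, whose non-degenerate
simplices are the objects and the non-identity morphisms. It carries the quotient topology. -/
def Realization := Quot Γ.Glue

instance : TopologicalSpace Γ.Realization := inferInstanceAs (TopologicalSpace (Quot Γ.Glue))

/-- The `0`-cell of a vertex or an edge. -/
def point (X : Γ.Cell) : Γ.Realization := Quot.mk _ (.inl ⟨X, ()⟩)

/-- The `1`-cell of a half-edge. -/
def segment (h : Γ.H) (t : unitInterval) : Γ.Realization := Quot.mk _ (.inr ⟨h, t⟩)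

/-- The set of `1`-valent vertices. -/
def boundary : Set Γ.Realization :=
  {z | ∃ v, Nat.card {h : Γ.H // Γ.src h = v} = 1 ∧ z = Γ.point (.vert v)}

end Graph

/-- A `ΔG`-structure on a graph: a lift of the incidence diagram to `ΔG`-structured sets. -/
structure GraphStructure {𝔾 : Type a} [Group 𝔾] [TopologicalSpace 𝔾] [IsTopologicalGroup 𝔾]
    (p : 𝔾 →* GL (Fin 2) ℝ) (Γ : Graph.{d, e}) where
  /-- the lift -/
  lift : Γ.Cell ⥤ StructuredSet.{a, d, c} p
  lift_forget : lift ⋙ StructuredSet.forget p = Γ.incidenceDiagram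

theorem GraphStructure.carrier_eq {𝔾 : Type a} [Group 𝔾] [TopologicalSpace 𝔾]
    [IsTopologicalGroup 𝔾] {p : 𝔾 →* GL (Fin 2) ℝ} {Γ : Graph.{d, e}}
    (L : GraphStructure.{a, c, d, e} p Γ) (X : Γ.Cell) : (L.lift.obj X).carrier = Γ.star X :=
  Functor.congr_obj L.lift_forget X

/-! ### Structured surfaces -/

section Surface

variable {S : Type b} [TopologicalSpace S] [ChartedSpace (EuclideanHalfSpace 2) S]

/-- Two (nonzero) tangent vectors are at the same point and have the same direction. -/
def SameDirection (u w : TangentBundle (𝓡∂ 2) S) : Prop :=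
  ∃ r : ℝ, 0 < r ∧ u = ⟨w.proj, r • w.snd⟩

variable (S) in
/-- A frame of the tangent bundle of a surface. -/
@[ext]
structure Frame where
  /-- the point -/
  pt : S
  /-- the basis of the tangent space -/
  vec : Fin 2 → TangentSpace (𝓡∂ 2) pt
  linearIndependent : LinearIndependent ℝ vec

namespace Frame

/-- The first vector of a frame. -/
def first (x : Frame S) : TangentBundle (𝓡∂ 2) S := ⟨x.pt, x.vec 0⟩

/-- The second vector of a frame. -/
def second (x : Frame S) : TangentBundle (𝓡∂ 2) S := ⟨x.pt, x.vec 1⟩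

/-- The right action of `GL(2, ℝ)`: the `j`-th vector of `x A` is `∑ i, A i j • x i`. -/
def act (x : Frame S) (A : GL (Fin 2) ℝ) : Frame S where
  pt := x.pt
  vec j := ∑ i, (A : Matrix (Fin 2) (Fin 2) ℝ) i j • x.vec i
  linearIndependent := by
    rw [Fintype.linearIndependent_iff]
    intro g hg
    have h1 : ∑ i, ((A : Matrix (Fin 2) (Fin 2) ℝ).mulVec g) i • x.vec i = 0 := by
      rw [← hg]
      simp only [Matrix.mulVec, dotProduct, Finset.sum_smul, Finset.smul_sum, smul_smul]
      rw [Finset.sum_comm]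
      simp only [mul_comm]
    have h2 := (Fintype.linearIndependent_iff.mp x.linearIndependent) _ h1
    have h3 : (A : Matrix (Fin 2) (Fin 2) ℝ).mulVec g = 0 := funext h2
    have h4 : g = 0 := by
      have := congrArg ((A⁻¹ : GL (Fin 2) ℝ) : Matrix (Fin 2) (Fin 2) ℝ).mulVec h3
      rwa [Matrix.mulVec_mulVec, ← Units.val_mul, inv_mul_cancel, Units.val_one,
        Matrix.one_mulVec, Matrix.mulVec_zero] at this
    exact fun i => congrFun h4 i

end Frame

variable [IsManifold (𝓡∂ 2) ∞ S]

/-- The topology of the frame bundle, as a subspace of the square of the tangent bundle. -/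
instance : TopologicalSpace (Frame S) :=
  haveI : IsManifold (𝓡∂ 2) 1 S := .of_le (n := ∞) (by exact_mod_cast le_top)
  TopologicalSpace.induced (fun x => (x.first, x.second)) inferInstance

/-- A reduction `ρ : F → Fr_S` of the structure group of the frame bundle along `p`: a principal
bundle `F` with a `p`-equivariant map to the frame bundle. As `p` is a covering, so is `ρ`, and the
smooth structure of `F` is the one pulled back from `Fr_S`; it need not be specified. -/
structure GStructure {𝔾 : Type a} [Group 𝔾] [TopologicalSpace 𝔾] (p : 𝔾 →* GL (Fin 2) ℝ)
    (S : Type b) [TopologicalSpace S] [ChartedSpace (EuclideanHalfSpace 2) S]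
    [IsManifold (𝓡∂ 2) ∞ S] where
  /-- the total space -/
  F : Type c
  [topology : TopologicalSpace F]
  /-- the right action -/
  act : F → 𝔾 → F
  continuous_act : Continuous fun x : F × 𝔾 => act x.1 x.2
  act_one : ∀ f, act f 1 = f
  act_mul : ∀ f x y, act f (x * y) = act (act f x) y
  /-- the map to the frame bundle -/
  ρ : F → Frame S
  continuous_ρ : Continuous ρ
  ρ_act : ∀ f x, ρ (act f x) = (ρ f).act (p x)
  locally_trivial : ∀ x : S, ∃ U : Set S, IsOpen U ∧ x ∈ U ∧
    ∃ φ : U × 𝔾 ≃ₜ {f : F // (ρ f).pt ∈ U},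
      (∀ y g, (ρ (φ (y, g)).1).pt = y) ∧ ∀ y g g', (φ (y, g * g')).1 = act (φ (y, g)).1 g'

attribute [instance] GStructure.topology

/-! ### Embedded graphs -/

/-- The path in `S` given by a map `|Γ| → S` and a half-edge, from the vertex (at time `0`) to the
midpoint of the edge (at time `1`). -/
def halfEdgePath {Γ : Graph.{d, e}} (γ : Γ.Realization → S) (h : Γ.H) (t : ℝ) : S :=
  γ (Γ.segment h (Set.projIcc 0 1 zero_le_one t))

/-- Its velocity. -/
def velocity {Γ : Graph.{d, e}} (γ : Γ.Realization → S) (h : Γ.H) (t : ℝ) :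
    TangentBundle (𝓡∂ 2) S :=
  ⟨halfEdgePath γ h t,
    mfderivWithin 𝓘(ℝ, ℝ) (𝓡∂ 2) (halfEdgePath γ h) (Set.Icc 0 1) t (1 : ℝ)⟩

/-- The tangent vector of the germ of `h` leaving the midpoint of its edge. -/
def midpointGerm {Γ : Graph.{d, e}} (γ : Γ.Realization → S) (h : Γ.H) :
    TangentBundle (𝓡∂ 2) S :=
  ⟨(velocity γ h 1).proj, -(velocity γ h 1).snd⟩

/-- The tangent vectors of the germs of edges of `|Γ|` that leave a `0`-cell. -/
def germ {Γ : Graph.{d, e}} (γ : Γ.Realization → S) :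
    ∀ X : Γ.Cell, Γ.star X → TangentBundle (𝓡∂ 2) S
  | .vert _, h => velocity γ h.1 0
  | .edge _, h => midpointGerm γ h.1

/-- An embedding of a graph into a surface. -/
structure IsEmbedded {Γ : Graph.{d, e}} (γ : Γ.Realization → S) : Prop where
  continuous : Continuous γ
  injective : Function.Injective γ
  interior : ∀ z, z ∉ Γ.boundary → γ z ∈ (𝓡∂ 2).interior S
  boundary : ∀ z, z ∈ Γ.boundary → γ z ∈ (𝓡∂ 2).boundary S
  smooth : ∀ h, ContMDiffOn 𝓘(ℝ, ℝ) (𝓡∂ 2) ∞ (halfEdgePath γ h) (Set.Icc 0 1)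
  regular : ∀ h, ∀ t ∈ Set.Icc (0 : ℝ) 1, (velocity γ h t).snd ≠ 0
  distinct : ∀ (X : Γ.Cell) (i j : Γ.star X), SameDirection (germ γ X i) (germ γ X j) → i = j

/-! ### The structure induced on an embedded graph -/

variable {𝔾 : Type a} [Group 𝔾] [TopologicalSpace 𝔾] {p : 𝔾 →* GL (Fin 2) ℝ}

/-- The points `f` of `F` whose frame `ρ(f)` has a first vector pointing along one of the germs
leaving the `0`-cell `X`. -/
def MarkedFrame (Q : GStructure.{a, b, c} p S) {Γ : Graph.{d, e}} (γ : Γ.Realization → S)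
    (X : Γ.Cell) : Type c :=
  {f : Q.F // ∃ i : Γ.star X, SameDirection (Q.ρ f).first (germ γ X i)}

instance (Q : GStructure.{a, b, c} p S) {Γ : Graph.{d, e}} (γ : Γ.Realization → S) (X : Γ.Cell) :
    TopologicalSpace (MarkedFrame Q γ X) :=
  instTopologicalSpaceSubtype

/-- The set of structured frames that the surface puts on the germs leaving a `0`-cell: `π₀` of the
space of marked frames. Since the group of upper triangular matrices with positive diagonal is
contractible, this is the set of points over the given directions in the covering of the (oriented)
circle of directions defined by the `𝔾`-structure. -/
abbrev FrameClass (Q : GStructure.{a, b, c} p S) {Γ : Graph.{d, e}} (γ : Γ.Realization → S)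
    (X : Γ.Cell) : Type c := ZerothHomotopy (MarkedFrame Q γ X)

/-- The class of a marked frame. -/
def frameClass {Q : GStructure.{a, b, c} p S} {Γ : Graph.{d, e}} {γ : Γ.Realization → S}
    {X : Γ.Cell} (f : MarkedFrame Q γ X) : FrameClass Q γ X := Quotient.mk _ f

/-- `f'` is obtained from `f` by turning, in the sense from the first vector of `f` to the second
one, until the first vector meets one of the germs again. -/
def IsNext {Q : GStructure.{a, b, c} p S} {Γ : Graph.{d, e}} {γ : Γ.Realization → S}
    {X : Γ.Cell} (f f' : MarkedFrame Q γ X) : Prop :=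
  ∃ θ : ℝ, 0 < θ ∧ θ ≤ 2 * Real.pi ∧ ∃ r : unitInterval → 𝔾, Continuous r ∧ r 0 = 1 ∧
    (∀ t, p (r t) = rotation (θ * t)) ∧ f'.1 = Q.act f.1 (r 1) ∧
    ∀ t, 0 < t → t < 1 → ∀ i, ¬ SameDirection (Q.ρ (Q.act f.1 (r t))).first (germ γ X i)

/-- `f'` is the parallel transport of `f` along the half-edge `h`: the first vector follows the
velocity of `h`, and then, at the midpoint of the edge, it is moved to the direction of `τ h`
without crossing the direction of `h`. -/
def IsTransport {Q : GStructure.{a, b, c} p S} {Γ : Graph.{d, e}} {γ : Γ.Realization → S}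
    (h : Γ.H) (f : MarkedFrame Q γ (.vert (Γ.src h)))
    (f' : MarkedFrame Q γ (.edge (Γ.edgeOf h))) : Prop :=
  ∃ k k' : unitInterval → Q.F, Continuous k ∧ Continuous k' ∧
    k 0 = f.1 ∧ (∀ t, SameDirection (Q.ρ (k t)).first (velocity γ h t)) ∧
    k' 0 = k 1 ∧ (∀ t, (Q.ρ (k' t)).pt = γ (Γ.point (.edge (Γ.edgeOf h))) ∧
      ¬ SameDirection (Q.ρ (k' t)).first (midpointGerm γ h)) ∧ k' 1 = f'.1

/-- The `ΔG`-structure `L` is the one induced by the surface, where `β` identifies the structured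
frames of `L` with the classes of marked frames. -/
structure IsInduced [IsTopologicalGroup 𝔾] (Q : GStructure.{a, b, c} p S) {Γ : Graph.{d, e}}
    (γ : Γ.Realization → S) (L : GraphStructure.{a, c, d, e} p Γ)
    (β : ∀ X : Γ.Cell, (L.lift.obj X).Frame ≃ FrameClass Q γ X) : Prop where
  /-- the half-edge numbered `0` by a frame is the one along which the first vector points -/
  label_zero : ∀ X o (f : MarkedFrame Q γ X), β X o = frameClass f →
    SameDirection (Q.ρ f.1).first (germ γ X (cast (L.carrier_eq X) ((L.lift.obj X).label o 0)))
  /-- elements of `p⁻¹(O(1))` act through the action on `F` -/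
  reflect : ∀ X o (f f' : MarkedFrame Q γ X) ε x (hx : p x = reflection ε),
    β X o = frameClass f → f'.1 = Q.act f.1 x →
      β X ((L.lift.obj X).act o (DeltaG.reflect _ ε x hx)) = frameClass f'
  /-- the automorphism `l ↦ l + 1` acts by turning to the next half-edge -/
  rotate : ∀ X o (f f' : MarkedFrame Q γ X), β X o = frameClass f → IsNext f f' →
    β X ((L.lift.obj X).act o (DeltaG.rotate p _)) = frameClass f'
  /-- in frames that correspond under parallel transport along `h`, the morphism of `h` is the
  morphism `0 ↦ 0`, `i ↦ 1` (`i > 0`) of `Δ` -/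
  transport : ∀ h o o' (f : MarkedFrame Q γ (.vert (Γ.src h)))
    (f' : MarkedFrame Q γ (.edge (Γ.edgeOf h))),
    β _ o = frameClass f → β _ o' = frameClass f' → IsTransport h f f' →
      StructuredSet.comps (L.lift.map (Γ.inc h)) o' o = DeltaG.collapse p _ _

/-- An isomorphism of `ΔG`-structures on `Γ` that lies over the identity of the incidence diagram
and matches the frames identified with the same classes of marked frames. -/
structure IsCanonicalIso [IsTopologicalGroup 𝔾] {Q : GStructure.{a, b, c} p S} {Γ : Graph.{d, e}}
    {γ : Γ.Realization → S} {L L' : GraphStructure.{a, c, d, e} p Γ}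
    (β : ∀ X : Γ.Cell, (L.lift.obj X).Frame ≃ FrameClass Q γ X)
    (β' : ∀ X : Γ.Cell, (L'.lift.obj X).Frame ≃ FrameClass Q γ X)
    (η : L.lift ≅ L'.lift) : Prop where
  forget_eq : Functor.whiskerRight η.hom (StructuredSet.forget p) =
    eqToHom (L.lift_forget.trans L'.lift_forget.symm)
  frames : ∀ X o o', β X o = β' X o' →
    ∃ hn : (L.lift.obj X).len = (L'.lift.obj X).len,
      StructuredSet.comps (η.hom.app X) o' o = eqToHom (congrArg DeltaG.mk hn)

end Surface

end

end PlanarGraph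

open PlanarGraph

namespace PlanarGraph

noncomputable section

universe a b c d e

/-! Everything rests on a polar decomposition in `𝔾`. A matrix whose first column has angle `α` is a
product `rotation α * upper x * reflection ε`, where the triangular factor ranges over a
contractible space. Lifting the rotations and the triangular matrices through the covering `p` gives
`g = rot α * tri x * y` with `y` in `G₀ = p⁻¹(O(1))`. The factor `tri x` is irrelevant for `π₀`, and
the rest is unique up to replacing `(α + 2πj, y)` by `(α, rot (2πj) * y)`
(`PolarLift.polar_unique`). This is exactly the identification that defines the morphisms of `ΔG`.

At a cell, fix a point of `F` and list the angles of the germs as a strictly increasing sequence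
`angle : ℤ → ℝ` with `angle (l + n + 1) = angle l + 2π` (`CellFrame`). A marked frame has
coordinates `(k, y)`: its first vector has the angle numbered `k`, and `y` is its discrete factor.
Only finitely many directions are allowed, so these coordinates are invariants of the path
component, up to the identification (`HasPolar.of_frameClass_eq`). Every automorphism of `[n]` has a
representative `(l ↦ k + ε l, y)` (`DeltaG.exists_eq_affine`). Hence the classes of marked frames
correspond to `Aut [n]` (`CellFrame.frameMap_bijective`), with `G₀` and the turns acting by right
translation. A turn moves `k` to `k + ε` because `y * rot θ = rot (ε θ) * y`.

Along a half-edge, transport exists because the velocity lifts to `F` (`exists_lift`), and it is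
unique up to `G₀`, because at the midpoint the circle of directions without that of `h` is an
interval (`IsTransport.unique`). The map `0 ↦ 0`, `i ↦ 1` commutes with `G₀` when the target is
`[1]` (`DeltaG.reflect_comp_collapse`), so prescribing it in one transported pair prescribes it in
all of them.

For uniqueness, turns and `G₀` generate `Aut [n]`, so matching frames with the same class is
equivariant and yields isomorphisms cell by cell. They are natural because both structures have the
same component in a transported pair, and unique because one component determines a morphism of
structured sets. -/

/-! ### Directions in the plane -/

/-- The complex number `w` points in the direction of angle `α`. -/
def Dir (w : ℂ) (α : ℝ) : Prop := ∃ r : ℝ, 0 < r ∧ w = r * Complex.exp (α * Complex.I)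

/-- The first column of a matrix, as a complex number. -/
def firstCol (A : GL (Fin 2) ℝ) : ℂ :=
  ⟨(A : Matrix (Fin 2) (Fin 2) ℝ) 0 0, (A : Matrix (Fin 2) (Fin 2) ℝ) 1 0⟩

theorem Dir.ne_zero {w : ℂ} {α : ℝ} (h : Dir w α) : w ≠ 0 := by
  obtain ⟨r, hr, rfl⟩ := h
  exact mul_ne_zero (by exact_mod_cast hr.ne') (Complex.exp_ne_zero _)

theorem dir_arg {w : ℂ} (h : w ≠ 0) : Dir w w.arg :=
  ⟨‖w‖, norm_pos_iff.mpr h, (Complex.norm_mul_exp_arg_mul_I w).symm⟩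

theorem Dir.add {w : ℂ} {α : ℝ} (h : Dir w α) (j : ℤ) : Dir w (α + 2 * Real.pi * j) := by
  obtain ⟨r, hr, rfl⟩ := h
  refine ⟨r, hr, ?_⟩
  congr 1
  rw [Complex.exp_eq_exp_iff_exists_int]
  exact ⟨-j, by push_cast; ring⟩

/-- Comparing norms removes the positive factors, and equal exponentials have exponents that differ
by a multiple of `2πi`. -/
theorem Dir.exists_int {w : ℂ} {α α' : ℝ} (h : Dir w α) (h' : Dir w α') :
    ∃ j : ℤ, α' = α + 2 * Real.pi * j := by
  obtain ⟨r, hr, rfl⟩ := h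
  obtain ⟨r', hr', h⟩ := h'
  have hn := congrArg norm h
  simp only [norm_mul, Complex.norm_exp_ofReal_mul_I, mul_one, Complex.norm_real,
    Real.norm_of_nonneg hr.le, Real.norm_of_nonneg hr'.le] at hn
  subst hn
  have h2 := mul_left_cancel₀ (by exact_mod_cast hr.ne') h
  rw [eq_comm, Complex.exp_eq_exp_iff_exists_int] at h2
  obtain ⟨j, hj⟩ := h2
  refine ⟨j, ?_⟩
  have h3 : ((α' : ℂ) - (α + 2 * Real.pi * j)) * Complex.I = 0 := by linear_combination hj
  have h4 := (mul_eq_zero.mp h3).resolve_right Complex.I_ne_zero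
  have h5 : ((α' - (α + 2 * Real.pi * j) : ℝ) : ℂ) = 0 := by push_cast; exact h4
  linarith [Complex.ofReal_eq_zero.mp h5]

theorem Dir.scale {w : ℂ} {α : ℝ} (h : Dir w α) {s : ℝ} (hs : 0 < s) : Dir (s * w) α := by
  obtain ⟨r, hr, rfl⟩ := h
  exact ⟨s * r, mul_pos hs hr, by push_cast; ring⟩

theorem Dir.exists_scale {w w' : ℂ} {α : ℝ} (h : Dir w α) (h' : Dir w' α) :
    ∃ r : ℝ, 0 < r ∧ w = r * w' := by
  obtain ⟨r, hr, rfl⟩ := h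
  obtain ⟨r', hr', rfl⟩ := h'
  refine ⟨r / r', div_pos hr hr', ?_⟩
  have : (r' : ℂ) ≠ 0 := by exact_mod_cast hr'.ne'
  push_cast
  field_simp

theorem dir_iff {w : ℂ} {α : ℝ} : Dir w α ↔
    ∃ r : ℝ, 0 < r ∧ w.re = r * Real.cos α ∧ w.im = r * Real.sin α := by
  unfold Dir
  simp only [Complex.ext_iff, Complex.re_ofReal_mul, Complex.im_ofReal_mul,
    Complex.exp_ofReal_mul_I_re, Complex.exp_ofReal_mul_I_im]

/-- Turning by `-α`. -/
theorem dir_iff_rotated {w : ℂ} {α : ℝ} : Dir w α ↔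
    0 < Real.cos α * w.re + Real.sin α * w.im ∧ Real.cos α * w.im - Real.sin α * w.re = 0 := by
  rw [dir_iff]
  have hsq := Real.sin_sq_add_cos_sq α
  constructor
  · rintro ⟨r, hr, h1, h2⟩
    rw [h1, h2]
    refine ⟨?_, by ring⟩
    have : Real.cos α * (r * Real.cos α) + Real.sin α * (r * Real.sin α) = r := by
      linear_combination r * hsq
    rwa [this]
  · rintro ⟨h1, h2⟩
    refine ⟨_, h1, ?_, ?_⟩
    · linear_combination (-w.re) * hsq - Real.sin α * h2
    · linear_combination (-w.im) * hsq + Real.cos α * h2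

/-! ### Lifts of rotations and of triangular matrices -/

/-- The upper triangular matrices with positive diagonal. -/
def upper (x : ℝ × ℝ × ℝ) : GL (Fin 2) ℝ where
  val := !![Real.exp x.1, x.2.1; 0, Real.exp x.2.2]
  inv := !![Real.exp (-x.1), -x.2.1 * Real.exp (-x.1) * Real.exp (-x.2.2); 0, Real.exp (-x.2.2)]
  val_inv := by
    have h1 : Real.exp x.1 * Real.exp (-x.1) = 1 := by rw [← Real.exp_add]; simp
    have h2 : Real.exp x.2.2 * Real.exp (-x.2.2) = 1 := by rw [← Real.exp_add]; simp
    ext i j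
    fin_cases i <;> fin_cases j <;> simp [Matrix.mul_apply, Fin.sum_univ_two, h1, h2]
    linear_combination (-x.2.1 * Real.exp (-x.2.2)) * h1
  inv_val := by
    have h1 : Real.exp x.1 * Real.exp (-x.1) = 1 := by rw [← Real.exp_add]; simp
    have h2 : Real.exp x.2.2 * Real.exp (-x.2.2) = 1 := by rw [← Real.exp_add]; simp
    ext i j
    fin_cases i <;> fin_cases j <;> simp [Matrix.mul_apply, Fin.sum_univ_two]
    · linear_combination h1
    · linear_combination (-x.2.1 * Real.exp (-x.1)) * h2
    · linear_combination h2

theorem upper_zero : upper 0 = 1 := by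
  ext i j; fin_cases i <;> fin_cases j <;> simp [upper]

theorem continuous_rotation : Continuous rotation := by
  rw [Units.continuous_iff]
  constructor <;> refine continuous_matrix fun i j => ?_ <;> fin_cases i <;> fin_cases j <;>
    simp [rotation] <;> fun_prop

theorem continuous_upper : Continuous upper := by
  rw [Units.continuous_iff]
  constructor <;> refine continuous_matrix fun i j => ?_ <;> fin_cases i <;> fin_cases j <;>
    simp [upper] <;> fun_prop

theorem continuous_firstCol : Continuous firstCol := by
  have h : firstCol = fun A : GL (Fin 2) ℝ =>
      (((A : Matrix (Fin 2) (Fin 2) ℝ) 0 0 : ℝ) : ℂ) +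
        ((A : Matrix (Fin 2) (Fin 2) ℝ) 1 0 : ℝ) * Complex.I := by
    funext A
    apply Complex.ext <;> simp [firstCol]
  rw [h]
  have h0 : Continuous fun A : GL (Fin 2) ℝ => (A : Matrix (Fin 2) (Fin 2) ℝ) :=
    Units.continuous_val
  have h1 := h0.matrix_elem 0 0
  have h2 := h0.matrix_elem 1 0
  fun_prop

theorem firstCol_ne_zero (A : GL (Fin 2) ℝ) : firstCol A ≠ 0 := by
  intro h
  have h1 : (A : Matrix (Fin 2) (Fin 2) ℝ).det ≠ 0 :=
    ((Matrix.isUnit_iff_isUnit_det _).mp A.isUnit).ne_zero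
  rw [Matrix.det_fin_two] at h1
  simp only [firstCol, Complex.ext_iff, Complex.zero_re, Complex.zero_im] at h
  exact h1 (by rw [h.1, h.2]; ring)

theorem firstCol_mul (A B : GL (Fin 2) ℝ) : firstCol (A * B) =
    ⟨(A : Matrix (Fin 2) (Fin 2) ℝ) 0 0 * (firstCol B).re +
      (A : Matrix (Fin 2) (Fin 2) ℝ) 0 1 * (firstCol B).im,
     (A : Matrix (Fin 2) (Fin 2) ℝ) 1 0 * (firstCol B).re +
      (A : Matrix (Fin 2) (Fin 2) ℝ) 1 1 * (firstCol B).im⟩ := by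
  simp [firstCol, Matrix.mul_apply, Fin.sum_univ_two]

theorem firstCol_rotation_mul (α : ℝ) (A : GL (Fin 2) ℝ) :
    firstCol (rotation α * A) = Complex.exp (α * Complex.I) * firstCol A := by
  rw [firstCol_mul]
  apply Complex.ext <;>
    simp [rotation, Complex.exp_ofReal_mul_I_re, Complex.exp_ofReal_mul_I_im]
  · ring
  · ring

theorem firstCol_mul_reflection (A : GL (Fin 2) ℝ) (ε : ℤˣ) :
    firstCol (A * reflection ε) = firstCol A := by
  rw [firstCol_mul]
  simp [firstCol, reflection]

theorem firstCol_mul_upper (A : GL (Fin 2) ℝ) (x : ℝ × ℝ × ℝ) :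
    firstCol (A * upper x) = Real.exp x.1 * firstCol A := by
  rw [firstCol_mul]
  simp only [firstCol, upper]
  apply Complex.ext <;> simp [mul_comm, -Complex.ofReal_exp]

theorem firstCol_one : firstCol 1 = 1 := by
  apply Complex.ext <;> simp [firstCol]

theorem firstCol_rotation (α : ℝ) : firstCol (rotation α) = Complex.exp (α * Complex.I) := by
  have := firstCol_rotation_mul α 1
  rwa [mul_one, firstCol_one, mul_one] at this

theorem dir_firstCol (α : ℝ) (x : ℝ × ℝ × ℝ) (ε : ℤˣ) :
    Dir (firstCol (rotation α * upper x * reflection ε)) α := by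
  rw [firstCol_mul_reflection, firstCol_mul_upper, firstCol_rotation]
  exact ⟨_, Real.exp_pos _, rfl⟩

/-- The entries of `rotation (-α) * A`. -/
def turned (α : ℝ) (A : GL (Fin 2) ℝ) : Matrix (Fin 2) (Fin 2) ℝ :=
  ((rotation (-α) * A : GL (Fin 2) ℝ) : Matrix (Fin 2) (Fin 2) ℝ)

theorem rotation_neg_mul (α : ℝ) : rotation (-α) * rotation α = 1 := by
  rw [← rotation_add, neg_add_cancel, rotation_zero]

theorem rotation_mul_neg (α : ℝ) : rotation α * rotation (-α) = 1 := by
  rw [← rotation_add, add_neg_cancel, rotation_zero]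

/-- Turning by `-α` puts the first column on the positive real axis. The matrix is then triangular,
and its determinant keeps the last diagonal entry from vanishing. -/
theorem Dir.turned {α : ℝ} {A : GL (Fin 2) ℝ} (h : Dir (firstCol A) α) :
    0 < turned α A 0 0 ∧ turned α A 1 0 = 0 ∧ turned α A 1 1 ≠ 0 := by
  have h1 := dir_iff_rotated.mp h
  simp only [firstCol] at h1
  have h00 : PlanarGraph.turned α A 0 0 = Real.cos α * (A : Matrix (Fin 2) (Fin 2) ℝ) 0 0 +
      Real.sin α * (A : Matrix (Fin 2) (Fin 2) ℝ) 1 0 := by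
    simp [PlanarGraph.turned, rotation, Matrix.mul_apply, Fin.sum_univ_two]
  have h10 : PlanarGraph.turned α A 1 0 = Real.cos α * (A : Matrix (Fin 2) (Fin 2) ℝ) 1 0 -
      Real.sin α * (A : Matrix (Fin 2) (Fin 2) ℝ) 0 0 := by
    simp [PlanarGraph.turned, rotation, Matrix.mul_apply, Fin.sum_univ_two]
    ring
  refine ⟨h00 ▸ h1.1, h10 ▸ h1.2, fun h11 => ?_⟩
  have hd : (PlanarGraph.turned α A).det ≠ 0 :=
    ((Matrix.isUnit_iff_isUnit_det _).mp (rotation (-α) * A).isUnit).ne_zero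
  rw [Matrix.det_fin_two, h11, h10, h1.2] at hd
  simp at hd

theorem sign_mul_self (ε : ℤˣ) : ((ε : ℤ) : ℝ) * ((ε : ℤ) : ℝ) = 1 := by
  rcases Int.units_eq_one_or ε with rfl | rfl <;> simp

/-- The logarithmic coordinates of the triangular factor of `A`. -/
def triCoords (α : ℝ) (ε : ℤˣ) (A : GL (Fin 2) ℝ) : ℝ × ℝ × ℝ :=
  (Real.log (turned α A 0 0), ((ε : ℤ) : ℝ) * turned α A 0 1,
    Real.log (((ε : ℤ) : ℝ) * turned α A 1 1))

/-- Right multiplication by `reflection ε` multiplies the second column by `ε`. With `ε` the sign of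
the lower right entry, undoing it leaves a triangular matrix with positive diagonal, whose
coordinates are read off. -/
theorem eq_rotation_mul_upper {α : ℝ} {ε : ℤˣ} {A : GL (Fin 2) ℝ} (h : Dir (firstCol A) α)
    (hε : 0 < ((ε : ℤ) : ℝ) * turned α A 1 1) :
    A = rotation α * upper (triCoords α ε A) * reflection ε := by
  obtain ⟨h00, h10, -⟩ := h.turned
  have key : rotation (-α) * A = upper (triCoords α ε A) * reflection ε := by
    apply Units.ext
    change turned α A = _
    have hsq : ((ε : ℤ) : ℝ) * ((ε : ℤ) : ℝ) = 1 := sign_mul_self ε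
    ext i j
    fin_cases i <;> fin_cases j <;>
      simp [upper, reflection, triCoords, Matrix.mul_apply, Fin.sum_univ_two, Real.exp_log h00,
        Real.exp_log hε, h10]
    · linear_combination (-turned α A 0 1) * hsq
    · linear_combination (-turned α A 1 1) * hsq
  rw [mul_assoc, ← key, ← mul_assoc, rotation_mul_neg, one_mul]

theorem exists_eq_rotation_mul_upper {α : ℝ} {A : GL (Fin 2) ℝ} (h : Dir (firstCol A) α) :
    ∃ x ε, A = rotation α * upper x * reflection ε := by
  obtain ⟨-, -, h11⟩ := h.turned
  obtain ⟨ε, hε⟩ : ∃ ε : ℤˣ, 0 < ((ε : ℤ) : ℝ) * turned α A 1 1 := by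
    rcases lt_or_gt_of_ne h11 with h | h
    · exact ⟨-1, by simpa using h⟩
    · exact ⟨1, by simpa using h⟩
  exact ⟨_, ε, eq_rotation_mul_upper h hε⟩

theorem turned_eq (α : ℝ) (x : ℝ × ℝ × ℝ) (ε : ℤˣ) :
    turned α (rotation α * upper x * reflection ε) =
      !![Real.exp x.1, ((ε : ℤ) : ℝ) * x.2.1; 0, ((ε : ℤ) : ℝ) * Real.exp x.2.2] := by
  rw [turned, mul_assoc, ← mul_assoc, rotation_neg_mul, one_mul]
  ext i j
  fin_cases i <;> fin_cases j <;>
    simp [upper, reflection, Matrix.mul_apply, Fin.sum_univ_two, mul_comm]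

/-- The sign of the lower right entry recovers `ε`; the triangular coordinates are then visible in
the entries. -/
theorem upper_mul_reflection_injective {x x' : ℝ × ℝ × ℝ} {ε ε' : ℤˣ}
    (h : upper x * reflection ε = upper x' * reflection ε') : x = x' ∧ ε = ε' := by
  have h1 := congrArg Units.val h
  have h00 := congrFun (congrFun h1 0) 0
  have h01 := congrFun (congrFun h1 0) 1
  have h11 := congrFun (congrFun h1 1) 1
  simp [upper, reflection, Matrix.mul_apply, Fin.sum_univ_two] at h00 h01 h11
  have hp := Real.exp_pos x.2.2
  have hp' := Real.exp_pos x'.2.2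
  have hε : ε = ε' := by
    rcases Int.units_eq_one_or ε with rfl | rfl <;> rcases Int.units_eq_one_or ε' with rfl | rfl
    · rfl
    · simp at h11; linarith
    · simp at h11; linarith
    · rfl
  subst hε
  refine ⟨?_, rfl⟩
  rcases Int.units_eq_one_or ε with rfl | rfl <;> simp at h01 h11 <;>
    exact Prod.ext h00 (Prod.ext h01 h11)

/-! ### The action of triangular matrices on directions. -/

theorem Dir.mul_exp {w : ℂ} {α : ℝ} (h : Dir w α) (β : ℝ) :
    Dir (Complex.exp (β * Complex.I) * w) (β + α) := by
  obtain ⟨r, hr, rfl⟩ := h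
  refine ⟨r, hr, ?_⟩
  push_cast
  rw [add_mul, Complex.exp_add]
  ring

/-- The angle of the image of the direction `ψ` under a triangular matrix, close to `ψ`. -/
def turnAngle (x : ℝ × ℝ × ℝ) (ψ : ℝ) : ℝ :=
  ψ + (Complex.exp (((-ψ : ℝ) : ℂ) * Complex.I) * firstCol (upper x * rotation ψ)).arg

theorem firstCol_upper_mul_rotation (x : ℝ × ℝ × ℝ) (ψ : ℝ) :
    firstCol (upper x * rotation ψ) =
      ⟨Real.exp x.1 * Real.cos ψ + x.2.1 * Real.sin ψ, Real.exp x.2.2 * Real.sin ψ⟩ := by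
  rw [firstCol_mul, firstCol_rotation]
  simp [upper, Complex.exp_ofReal_mul_I_re, Complex.exp_ofReal_mul_I_im]

/-- A triangular matrix with positive diagonal has no negative eigenvalue, so it never reverses a
direction. Explicitly, where the imaginary part vanishes the real part is one of the two eigenvalues
`exp x.1` and `exp x.2.2`. -/
theorem turn_mem_slitPlane (x : ℝ × ℝ × ℝ) (ψ : ℝ) :
    Complex.exp (((-ψ : ℝ) : ℂ) * Complex.I) * firstCol (upper x * rotation ψ) ∈
      Complex.slitPlane := by
  have hs := Real.sin_sq_add_cos_sq ψ
  have hre : (Complex.exp (((-ψ : ℝ) : ℂ) * Complex.I) * firstCol (upper x * rotation ψ)).re =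
      Real.exp x.1 * Real.cos ψ ^ 2 + x.2.1 * Real.sin ψ * Real.cos ψ +
        Real.exp x.2.2 * Real.sin ψ ^ 2 := by
    rw [firstCol_upper_mul_rotation, Complex.mul_re, Complex.exp_ofReal_mul_I_re,
      Complex.exp_ofReal_mul_I_im, Real.cos_neg, Real.sin_neg]
    ring
  have him : (Complex.exp (((-ψ : ℝ) : ℂ) * Complex.I) * firstCol (upper x * rotation ψ)).im =
      Real.sin ψ * ((Real.exp x.2.2 - Real.exp x.1) * Real.cos ψ - x.2.1 * Real.sin ψ) := by
    rw [firstCol_upper_mul_rotation, Complex.mul_im, Complex.exp_ofReal_mul_I_re,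
      Complex.exp_ofReal_mul_I_im, Real.cos_neg, Real.sin_neg]
    ring
  rw [Complex.mem_slitPlane_iff, or_iff_not_imp_right, not_not, hre, him]
  intro h
  rcases mul_eq_zero.mp h with h0 | h0
  · have hc : Real.cos ψ ^ 2 = 1 := by rw [h0] at hs; linarith
    rw [h0, hc]
    have := Real.exp_pos x.1
    simpa using this
  · have : Real.exp x.1 * Real.cos ψ ^ 2 + x.2.1 * Real.sin ψ * Real.cos ψ +
        Real.exp x.2.2 * Real.sin ψ ^ 2 = Real.exp x.2.2 := by
      linear_combination Real.exp x.2.2 * hs - Real.cos ψ * h0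
    rw [this]
    exact Real.exp_pos _

theorem continuous_turnAngle (x : ℝ × ℝ × ℝ) : Continuous (turnAngle x) := by
  refine continuous_id.add (continuous_iff_continuousAt.mpr fun ψ => ?_)
  refine (Complex.continuousAt_arg (turn_mem_slitPlane x ψ)).comp_of_eq
    (Continuous.continuousAt ?_) rfl
  have h := continuous_firstCol.comp
    (continuous_const.mul continuous_rotation : Continuous fun ψ => upper x * rotation ψ)
  refine Continuous.mul ?_ h
  fun_prop

theorem turnAngle_zero (x : ℝ × ℝ × ℝ) : turnAngle x 0 = 0 := by
  have : firstCol (upper x * rotation 0) = (Real.exp x.1 : ℝ) := by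
    rw [firstCol_upper_mul_rotation]
    apply Complex.ext <;> simp [-Complex.ofReal_exp]
  rw [turnAngle, this]
  simp only [neg_zero, Complex.ofReal_zero, zero_mul, Complex.exp_zero, one_mul, zero_add]
  exact Complex.arg_ofReal_of_nonneg (Real.exp_pos _).le

theorem dir_turnAngle (x : ℝ × ℝ × ℝ) (ψ : ℝ) :
    Dir (firstCol (upper x * rotation ψ)) (turnAngle x ψ) := by
  have h := (dir_arg (Complex.slitPlane_ne_zero (turn_mem_slitPlane x ψ))).mul_exp ψ
  rw [← mul_assoc, ← Complex.exp_add] at h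
  simpa [turnAngle] using h

/-- The new angle stays within `π` of `ψ`, which settles `ψ ≥ π`. For `0 < ψ < π` the upper half
plane is preserved, which excludes the angles in `(-π, 0]`. -/
theorem turnAngle_pos (x : ℝ × ℝ × ℝ) {ψ : ℝ} (h0 : 0 < ψ) :
    0 < turnAngle x ψ := by
  have ha := Complex.neg_pi_lt_arg
    (Complex.exp (((-ψ : ℝ) : ℂ) * Complex.I) * firstCol (upper x * rotation ψ))
  have hA : ψ - Real.pi < turnAngle x ψ := by rw [turnAngle]; linarith
  rcases le_or_gt Real.pi ψ with h | h
  · linarith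
  · obtain ⟨r, hr, -, him⟩ := dir_iff.mp (dir_turnAngle x ψ)
    by_contra hle
    have h2 := Real.sin_nonpos_of_nonpos_of_neg_pi_le (not_lt.mp hle) (by linarith)
    have h3 := Real.sin_pos_of_pos_of_lt_pi h0 h
    rw [firstCol_upper_mul_rotation] at him
    have h4 := mul_pos (Real.exp_pos x.2.2) h3
    have h5 := mul_nonpos_of_nonneg_of_nonpos hr.le h2
    simp only at him
    linarith

theorem turnAngle_neg (x : ℝ × ℝ × ℝ) {ψ : ℝ} (h0 : ψ < 0) :
    turnAngle x ψ < 0 := by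
  have ha := Complex.arg_le_pi
    (Complex.exp (((-ψ : ℝ) : ℂ) * Complex.I) * firstCol (upper x * rotation ψ))
  -- The principal argument may equal `π` in general; the slit plane makes the bound strict, which
  -- is needed at `ψ = -π`.
  have ha' := lt_of_le_of_ne ha (Complex.mem_slitPlane_iff_arg.mp (turn_mem_slitPlane x ψ)).1
  have hA : turnAngle x ψ < ψ + Real.pi := by rw [turnAngle]; linarith
  rcases le_or_gt ψ (-Real.pi) with h | h
  · linarith
  · obtain ⟨r, hr, -, him⟩ := dir_iff.mp (dir_turnAngle x ψ)
    by_contra hle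
    have h2 := Real.sin_nonneg_of_nonneg_of_le_pi (not_lt.mp hle) (by linarith)
    have h3 := Real.sin_neg_of_neg_of_neg_pi_lt h0 h
    rw [firstCol_upper_mul_rotation] at him
    have h4 := mul_neg_of_pos_of_neg (Real.exp_pos x.2.2) h3
    have h5 := mul_nonneg hr.le h2
    simp only at him
    linarith

/-! ### The polar decomposition in the covering group. -/

section Lift

variable {𝔾 : Type a} [Group 𝔾] [TopologicalSpace 𝔾]

/-- Lifts to `𝔾` of the group of rotations and of the space of upper triangular matrices. -/
structure PolarLift (p : 𝔾 →* GL (Fin 2) ℝ) where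
  isCoveringMap : IsCoveringMap p
  /-- the lift of the rotations -/
  rot : ℝ → 𝔾
  continuous_rot : Continuous rot
  rot_zero : rot 0 = 1
  map_rot : ∀ θ, p (rot θ) = rotation θ
  /-- the lift of the triangular matrices -/
  tri : ℝ × ℝ × ℝ → 𝔾
  continuous_tri : Continuous tri
  tri_zero : tri 0 = 1
  map_tri : ∀ x, p (tri x) = upper x

/-- With exponentials on the diagonal the parameter spaces are `ℝ` and `ℝ³`. They are simply
connected, so both families of matrices lift through the covering. -/
theorem exists_polarLift (p : 𝔾 →* GL (Fin 2) ℝ) (hp : IsCoveringMap p) :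
    Nonempty (PolarLift p) := by
  obtain ⟨R, ⟨hR0, hR⟩, -⟩ := hp.existsUnique_continuousMap_lifts ⟨rotation, continuous_rotation⟩
    (0 : ℝ) 1 (by simp [rotation_zero])
  obtain ⟨U, ⟨hU0, hU⟩, -⟩ := hp.existsUnique_continuousMap_lifts ⟨upper, continuous_upper⟩
    (0 : ℝ × ℝ × ℝ) 1 (by simp [upper_zero])
  exact ⟨⟨hp, R, R.continuous, hR0, congrFun hR, U, U.continuous, hU0, congrFun hU⟩⟩

namespace PolarLift

variable {p : 𝔾 →* GL (Fin 2) ℝ}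

/-- This is how identities are proved in `𝔾`: over a connected parameter space it suffices to check
them after `p` and at one point. -/
theorem lift_unique (P : PolarLift p) {T : Type*} [TopologicalSpace T] [PreconnectedSpace T]
    {g g' : T → 𝔾}
    (hg : Continuous g) (hg' : Continuous g') (h : ∀ t, p (g t) = p (g' t)) (t₀ : T)
    (h₀ : g t₀ = g' t₀) (t : T) : g t = g' t :=
  congrFun (P.isCoveringMap.eq_of_comp_eq hg hg' (funext h) t₀ h₀) t

variable (P : PolarLift p)

theorem map_polar {y : 𝔾} {ε : ℤˣ} (hy : p y = reflection ε) (α : ℝ) (x : ℝ × ℝ × ℝ) :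
    p (P.rot α * P.tri x * y) = rotation α * upper x * reflection ε := by
  rw [map_mul, map_mul, P.map_rot, P.map_tri, hy]

theorem dir_polar {y : 𝔾} {ε : ℤˣ} (hy : p y = reflection ε) (α : ℝ) (x : ℝ × ℝ × ℝ) :
    Dir (firstCol (p (P.rot α * P.tri x * y))) α := by
  rw [P.map_polar hy]
  exact dir_firstCol _ _ _

/-- Polar decomposition in `𝔾`. -/
theorem exists_polar {g : 𝔾} {α : ℝ} (h : Dir (firstCol (p g)) α) :
    ∃ x ε y, p y = reflection ε ∧ g = P.rot α * P.tri x * y := by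
  obtain ⟨x, ε, hx⟩ := exists_eq_rotation_mul_upper h
  refine ⟨x, ε, (P.rot α * P.tri x)⁻¹ * g, ?_, by group⟩
  rw [map_mul, map_inv, map_mul, P.map_rot, P.map_tri, hx]
  group

/-- Turning a frame in the sense from its first to its second vector: the angle of the first vector
has a continuous determination, which moves in the sense given by the orientation of the frame. -/
theorem exists_angle_mul_rot {α : ℝ} {x : ℝ × ℝ × ℝ} {y : 𝔾} {ε : ℤˣ} (hy : p y = reflection ε) :
    ∃ A : ℝ → ℝ, Continuous A ∧ A 0 = α ∧
      (∀ φ, 0 < φ → 0 < ((ε : ℤ) : ℝ) * (A φ - α)) ∧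
      ∀ φ, Dir (firstCol (p (P.rot α * P.tri x * y * P.rot φ))) (A φ) := by
  -- Moving the turn past `y` replaces `φ` by `ε φ`; the triangular factor then distorts this angle
  -- to `turnAngle`, without changing its sign.
  refine ⟨fun φ => α + turnAngle x (((ε : ℤ) : ℝ) * φ), ?_, ?_, ?_, ?_⟩
  · have := continuous_turnAngle x
    fun_prop
  · simp [turnAngle_zero]
  · intro φ h1
    rw [add_sub_cancel_left]
    rcases Int.units_eq_one_or ε with rfl | rfl
    · simpa using turnAngle_pos x h1
    · simpa using turnAngle_neg x (neg_lt_zero.mpr h1)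
  · intro φ
    rw [map_mul, P.map_polar hy, P.map_rot, mul_assoc, reflection_mul_rotation, ← mul_assoc,
      firstCol_mul_reflection, mul_assoc, firstCol_rotation_mul]
    exact (dir_turnAngle x _).mul_exp α

variable [IsTopologicalGroup 𝔾]

theorem rot_add (x y : ℝ) : P.rot (x + y) = P.rot x * P.rot y := by
  have hc := P.continuous_rot
  refine P.lift_unique (g := fun y => P.rot (x + y)) (g' := fun y => P.rot x * P.rot y)
    (by fun_prop) (by fun_prop) (fun t => ?_) 0 (by simp [P.rot_zero]) y
  simp [P.map_rot, rotation_add]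

theorem mul_rot {y : 𝔾} {ε : ℤˣ} (hy : p y = reflection ε) (θ : ℝ) :
    y * P.rot θ = P.rot (((ε : ℤ) : ℝ) * θ) * y := by
  have hc := P.continuous_rot
  refine P.lift_unique (g := fun θ => y * P.rot θ)
    (g' := fun θ => P.rot (((ε : ℤ) : ℝ) * θ) * y)
    (by fun_prop) (by fun_prop) (fun t => ?_) 0 (by simp [P.rot_zero]) θ
  simp [P.map_rot, hy, reflection_mul_rotation]

theorem rotation_two_pi_mul (j : ℤ) : rotation (2 * Real.pi * j) = 1 := by
  have h1 : Real.cos (2 * Real.pi * j) = 1 := by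
    rw [mul_comm]; exact Real.cos_int_mul_two_pi j
  have h2 : Real.sin (2 * Real.pi * j) = 0 := by
    rw [mul_comm, ← zero_add ((j : ℝ) * _), Real.sin_add_int_mul_two_pi, Real.sin_zero]
  ext i k
  fin_cases i <;> fin_cases k <;> simp [rotation, h1, h2]

/-- Full turns lie over the identity matrix, so both products are lifts of `upper` with the same
value at `0`. -/
theorem commute_rot_tri (j : ℤ) (x : ℝ × ℝ × ℝ) :
    P.rot (2 * Real.pi * j) * P.tri x = P.tri x * P.rot (2 * Real.pi * j) := by
  have hc := P.continuous_tri
  refine P.lift_unique (g := fun x => P.rot (2 * Real.pi * j) * P.tri x)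
    (g' := fun x => P.tri x * P.rot (2 * Real.pi * j))
    (by fun_prop) (by fun_prop) (fun t => ?_) 0 (by simp [P.tri_zero]) x
  simp [P.map_rot, rotation_two_pi_mul]

/-- Uniqueness of the polar decomposition. -/
theorem polar_unique {α α' : ℝ} {x x' : ℝ × ℝ × ℝ} {y y' : 𝔾} {ε ε' : ℤˣ}
    (hy : p y = reflection ε) (hy' : p y' = reflection ε')
    (h : P.rot α * P.tri x * y = P.rot α' * P.tri x' * y') :
    ∃ j : ℤ, α' = α + 2 * Real.pi * j ∧ y = P.rot (2 * Real.pi * j) * y' := by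
  have h1 := P.dir_polar hy α x
  have h2 := P.dir_polar hy' α' x'
  rw [← h] at h2
  obtain ⟨j, rfl⟩ := h1.exists_int h2
  refine ⟨j, rfl, ?_⟩
  -- After cancelling `rot α`, the image under `p` no longer sees the full turns, so the triangular
  -- factors agree. The full turns commute past that factor and end up next to `y'`.
  rw [P.rot_add, mul_assoc, mul_assoc, mul_assoc, mul_right_inj] at h
  have h3 := congrArg p h
  simp only [map_mul, P.map_rot, rotation_two_pi_mul, one_mul, P.map_tri, hy, hy'] at h3
  obtain ⟨rfl, -⟩ := upper_mul_reflection_injective h3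
  rw [← mul_assoc, P.commute_rot_tri, mul_assoc, mul_right_inj] at h
  exact h

/-- The discrete factor of the polar decomposition is constant along continuous families with a
continuous choice of angles. -/
theorem polar_continuation {T : Type*} [TopologicalSpace T] [PreconnectedSpace T] {g : T → 𝔾}
    {α : T → ℝ} (hg : Continuous g) (hα : Continuous α) (h : ∀ t, Dir (firstCol (p (g t))) (α t))
    {y : 𝔾} {ε : ℤˣ} (hy : p y = reflection ε) {t₀ : T} {x₀ : ℝ × ℝ × ℝ}
    (h₀ : g t₀ = P.rot (α t₀) * P.tri x₀ * y) (t : T) :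
    ∃ x, g t = P.rot (α t) * P.tri x * y := by
  have hcm : Continuous fun t => turned (α t) (p (g t)) := by
    refine Units.continuous_val.comp (Continuous.mul (continuous_rotation.comp hα.neg) ?_)
    exact P.isCoveringMap.continuous.comp hg
  have hc : ∀ i j, Continuous fun t => turned (α t) (p (g t)) i j := fun i j =>
    hcm.matrix_elem i j
  have ht₀ : turned (α t₀) (p (g t₀)) = !![Real.exp x₀.1, ((ε : ℤ) : ℝ) * x₀.2.1;
      0, ((ε : ℤ) : ℝ) * Real.exp x₀.2.2] := by
    rw [h₀, P.map_polar hy, turned_eq]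
  have hsq : ((ε : ℤ) : ℝ) * ((ε : ℤ) : ℝ) = 1 := sign_mul_self ε
  -- The lower right entry is continuous and never zero, so on a connected space it keeps the sign
  -- it has at `t₀`.
  have hpos : ∀ t, 0 < ((ε : ℤ) : ℝ) * turned (α t) (p (g t)) 1 1 := by
    intro t
    by_contra hle
    have h1 : 0 < ((ε : ℤ) : ℝ) * turned (α t₀) (p (g t₀)) 1 1 := by
      rw [ht₀]
      simp only [Matrix.of_apply, Matrix.cons_val', Matrix.cons_val_one, Matrix.cons_val_fin_one]
      rw [← mul_assoc, hsq, one_mul]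
      exact Real.exp_pos _
    obtain ⟨s, hs⟩ := mem_range_of_exists_le_of_exists_ge
      (f := fun t => ((ε : ℤ) : ℝ) * turned (α t) (p (g t)) 1 1)
      (continuous_const.mul (hc 1 1)) ⟨t, not_lt.mp hle⟩ ⟨t₀, h1.le⟩
    have hε : ((ε : ℤ) : ℝ) ≠ 0 := by intro h0; rw [h0] at hsq; simp at hsq
    exact (h s).turned.2.2 ((mul_eq_zero.mp hs).resolve_left hε)
  have hcx : Continuous fun t => triCoords (α t) ε (p (g t)) := by
    refine Continuous.prodMk ?_ (Continuous.prodMk ?_ ?_)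
    · exact (hc 0 0).log fun t => (h t).turned.1.ne'
    · exact continuous_const.mul (hc 0 1)
    · exact (continuous_const.mul (hc 1 1)).log fun t => (hpos t).ne'
  refine ⟨triCoords (α t) ε (p (g t)), ?_⟩
  -- Both families lift the same matrices, and they agree at `t₀`.
  refine P.lift_unique (g' := fun t => P.rot (α t) * P.tri (triCoords (α t) ε (p (g t))) * y) hg
    ?_ (fun t => ?_) t₀ ?_ t
  · exact ((P.continuous_rot.comp hα).mul (P.continuous_tri.comp hcx)).mul continuous_const
  · rw [P.map_polar hy]
    exact eq_rotation_mul_upper (h t) (hpos t)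
  · have h2 := eq_rotation_mul_upper (h t₀) (hpos t₀)
    have h3 : p (g t₀) = rotation (α t₀) * upper x₀ * reflection ε := by rw [h₀, P.map_polar hy]
    have h4 := h2.symm.trans h3
    rw [mul_assoc, mul_assoc, mul_right_inj] at h4
    rw [(upper_mul_reflection_injective h4).1]
    exact h₀

end PolarLift

end Lift

/-! ### Automorphisms in the crossed simplicial group -/

section Automorphisms

variable {𝔾 : Type a} [Group 𝔾] {p : 𝔾 →* GL (Fin 2) ℝ}

theorem int_sign_mul_self (ε : ℤˣ) : (ε : ℤ) * (ε : ℤ) = 1 := by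
  rcases Int.units_eq_one_or ε with rfl | rfl <;> simp

/-- The representative `(l ↦ k + ε l, y)`. -/
def PreHom.affine (n : ℕ) (k : ℤ) (ε : ℤˣ) (y : 𝔾) (hy : p y = reflection ε) : PreHom p n n where
  sign := ε
  toFun l := k + ε * l
  monotone := by
    intro s t h
    simp only [mul_add, ← mul_assoc, int_sign_mul_self]
    linarith
  periodic l := by ring
  elt := y
  map_elt := hy

theorem map_inv_eq_reflection {y : 𝔾} {ε : ℤˣ} (hy : p y = reflection ε) :
    p y⁻¹ = reflection ε := by
  rw [map_inv, hy, ← map_inv, Int.units_inv_eq_self]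

theorem map_mul_eq_reflection {y y' : 𝔾} {ε ε' : ℤˣ} (hy : p y = reflection ε)
    (hy' : p y' = reflection ε') : p (y * y') = reflection (ε * ε') := by
  rw [map_mul, hy, hy', map_mul]

theorem map_one_eq_reflection (p : 𝔾 →* GL (Fin 2) ℝ) : p 1 = reflection 1 := by
  rw [map_one, map_one]

variable [TopologicalSpace 𝔾] [IsTopologicalGroup 𝔾]

namespace DeltaG

/-- The automorphism of `[n]` with representative `(l ↦ k + ε l, y)`. -/
def affine (n : ℕ) (k : ℤ) (ε : ℤˣ) (y : 𝔾) (hy : p y = reflection ε) :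
    (⟨n⟩ : DeltaG p) ≅ ⟨n⟩ where
  hom := homMk (PreHom.affine n k ε y hy)
  inv := homMk (PreHom.affine n (-(ε * k)) ε y⁻¹ (map_inv_eq_reflection hy))
  hom_inv_id := congrArg (Quotient.mk _) (by
    refine PreHom.ext (Int.units_mul_self ε) (funext fun l => ?_) (inv_mul_cancel y)
    change -(ε * k) + ε * (k + ε * l) = l
    linear_combination l * int_sign_mul_self ε)
  inv_hom_id := congrArg (Quotient.mk _) (by
    refine PreHom.ext (Int.units_mul_self ε) (funext fun l => ?_) (mul_inv_cancel y)
    change k + ε * (-(ε * k) + ε * l) = l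
    linear_combination (l - k) * int_sign_mul_self ε)

theorem affine_congr {n : ℕ} {k k' : ℤ} {ε ε' : ℤˣ} {y y' : 𝔾} {hy : p y = reflection ε}
    {hy' : p y' = reflection ε'} (hk : k = k') (hε : ε = ε') (h : y = y') :
    affine n k ε y hy = affine n k' ε' y' hy' := by
  subst hk hε h; rfl

theorem affine_trans (n : ℕ) {k k' : ℤ} {ε ε' : ℤˣ} {y y' : 𝔾} (hy : p y = reflection ε)
    (hy' : p y' = reflection ε') :
    affine n k' ε' y' hy' ≪≫ affine n k ε y hy =
      affine n (k + ε * k') (ε * ε') (y * y') (map_mul_eq_reflection hy hy') := by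
  ext
  refine congrArg (Quotient.mk _) (PreHom.ext rfl (funext fun l => ?_) rfl)
  change k + ε * (k' + ε' * l) = k + ε * k' + ((ε * ε' : ℤˣ) : ℤ) * l
  push_cast
  ring

theorem rotate_eq_affine (n : ℕ) : rotate p n = affine n 1 1 1 (map_one_eq_reflection p) := by
  ext
  refine congrArg (Quotient.mk _) (PreHom.ext rfl (funext fun l => ?_) rfl)
  change l + 1 = 1 + ((1 : ℤˣ) : ℤ) * l
  simp [add_comm]

theorem reflect_eq_affine (n : ℕ) {ε : ℤˣ} {x : 𝔾} (hx : p x = reflection ε) :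
    reflect n ε x hx = affine n 0 ε x hx := by
  ext
  refine congrArg (Quotient.mk _) (PreHom.ext rfl (funext fun l => ?_) rfl)
  change ε * l = 0 + ε * l
  simp

theorem vertexMap_affine (n : ℕ) (k : ℤ) {ε : ℤˣ} {y : 𝔾} (hy : p y = reflection ε)
    (i : Fin (n + 1)) : vertexMap (affine n k ε y hy).hom i = vertex n (k + ε * (i : ℕ)) := rfl

/-- A representative of an invertible morphism is a bijection of `ℤ` that preserves or reverses the
order. It therefore sends neighbours to neighbours, which makes it affine of slope `±1`. -/
theorem exists_eq_affine {n : ℕ} (u : (⟨n⟩ : DeltaG p) ≅ ⟨n⟩) :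
    ∃ k ε y, ∃ hy : p y = reflection ε, u = affine n k ε y hy := by
  obtain ⟨v, hv⟩ := Quotient.exists_rep u.hom
  obtain ⟨w, hw⟩ := Quotient.exists_rep u.inv
  have h1 := u.hom_inv_id
  have h2 := u.inv_hom_id
  rw [← hv, ← hw] at h1 h2
  -- The composites of the representatives are identities only up to full turns; this still gives
  -- injectivity and surjectivity.
  obtain ⟨i, hi, -⟩ := Quotient.exact h1
  obtain ⟨j, hj, -⟩ := Quotient.exact h2
  change ∀ l, l = w.toFun (v.toFun l) + i * (n + 1) at hi
  change ∀ l, l = v.toFun (w.toFun l) + j * (n + 1) at hj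
  have hinj : Function.Injective v.toFun := by
    intro s t hst
    rw [hi s, hi t, hst]
  have hsurj : Function.Surjective v.toFun := by
    intro s
    refine ⟨w.toFun (s + j * (n + 1)), ?_⟩
    have := hj (s + j * (n + 1))
    linarith
  have hmono : StrictMono fun l => (v.sign : ℤ) * v.toFun l := by
    refine v.monotone.strictMono_of_injective fun s t hst => hinj ?_
    have h3 := congrArg ((v.sign : ℤ) * ·) hst
    simpa [← mul_assoc, int_sign_mul_self] using h3
  -- The integer `m` with value `v l + ε` lies beyond `l`. Hence the value at `l + 1` lies strictly
  -- beyond `v l` but not beyond `v l + ε`, in the sense of `ε`.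
  have hstep : ∀ l, v.toFun (l + 1) = v.toFun l + v.sign := by
    intro l
    obtain ⟨m, hm⟩ := hsurj (v.toFun l + v.sign)
    have h3 : l < m := by
      apply hmono.lt_iff_lt.mp
      change (v.sign : ℤ) * v.toFun l < v.sign * v.toFun m
      rw [hm, mul_add, int_sign_mul_self]
      omega
    have h4 : (v.sign : ℤ) * v.toFun (l + 1) ≤ v.sign * v.toFun m := hmono.monotone h3
    have h5 : (v.sign : ℤ) * v.toFun l < v.sign * v.toFun (l + 1) := hmono (by omega)
    rw [hm, mul_add, int_sign_mul_self] at h4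
    have h6 : (v.sign : ℤ) * v.toFun (l + 1) = v.sign * v.toFun l + 1 := by omega
    have h7 := congrArg ((v.sign : ℤ) * ·) h6
    simpa [← mul_assoc, mul_add, int_sign_mul_self] using h7
  refine ⟨v.toFun 0, v.sign, v.elt, v.map_elt, ?_⟩
  ext
  rw [← hv]
  refine congrArg (Quotient.mk _) (PreHom.ext rfl (funext fun l => ?_) rfl)
  change v.toFun l = v.toFun 0 + v.sign * l
  induction l using Int.induction_on with
  | zero => simp
  | succ i ih => rw [hstep, ih]; ring
  | pred i ih =>
    have h3 := hstep (-(i : ℤ) - 1)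
    rw [sub_add_cancel, ih] at h3
    linear_combination -h3

/-- By uniqueness of lifts, the path demanded by `Rel` can only be `rot` along `j` full turns,
translated by `u'.elt`. The relation becomes an equation in `𝔾`. -/
theorem preHom_rel_iff (P : PolarLift p) {m n : ℕ} {u u' : PreHom p m n} :
    PreHom.Rel u u' ↔ ∃ j : ℤ, (∀ l, u'.toFun l = u.toFun l + j * (n + 1)) ∧
      u.elt = P.rot (2 * Real.pi * j) * u'.elt := by
  have hc := P.continuous_rot
  constructor
  · rintro ⟨j, hj, c, hcc, h0, h1, hp⟩
    refine ⟨j, hj, ?_⟩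
    have h2 := P.lift_unique (g := c) (g' := fun t => P.rot (2 * Real.pi * j * t) * u'.elt) hcc
      (by fun_prop) (fun t => by rw [hp, map_mul, P.map_rot]) 0 (by simp [h0, P.rot_zero]) 1
    rw [← h1, h2]
    simp
  · rintro ⟨j, hj, h⟩
    refine ⟨j, hj, fun t => P.rot (2 * Real.pi * j * t) * u'.elt, by fun_prop,
      by simp [P.rot_zero], by simp [h], fun t => by rw [map_mul, P.map_rot]⟩

/-- Two structures on the same cell have equal lengths only propositionally, so the components of
the canonical isomorphisms are `eqToHom`. This makes them independent of the choice of matched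
frames. -/
theorem affine_hom_comp_eqToHom {n n' : ℕ} (hn : n = n') (k : ℤ) {ε : ℤˣ} {y : 𝔾}
    (hy : p y = reflection ε) (h : (⟨n⟩ : DeltaG p) = ⟨n'⟩) :
    (affine n k ε y hy).hom ≫ eqToHom h ≫ (affine n' k ε y hy).inv = eqToHom h := by
  subst hn
  simp

theorem collapse_comp_eqToHom {m m' n n' : ℕ} (hm : m = m') (hn : n = n')
    (h : (⟨m⟩ : DeltaG p) = ⟨m'⟩) (h' : (⟨n⟩ : DeltaG p) = ⟨n'⟩) :
    collapse p m n ≫ eqToHom h' = eqToHom h ≫ collapse p m' n' := by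
  subst hm hn
  simp

theorem vertexMap_eqToHom {n n' : ℕ} (hn : n = n') (h : (⟨n⟩ : DeltaG p) = ⟨n'⟩)
    (i : Fin (n + 1)) : vertexMap (eqToHom h) i = Fin.cast (by rw [hn]) i := by
  subst hn
  exact vertexMap_id _ i

theorem vertexMap_collapse (m n : ℕ) (i : Fin (m + 1)) :
    vertexMap (collapse p m n) i = if i = 0 then 0 else Fin.last n := by
  change vertex n (((if vertex m (i : ℕ) = 0 then 0 else Fin.last n : Fin (n + 1)) : ℕ) +
    ((i : ℕ) : ℤ) / (m + 1) * (n + 1)) = _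
  rw [vertex_add_mul, vertex_coe, vertex_coe]

theorem vertex_eq_zero_iff (n : ℕ) (l : ℤ) : vertex n l = 0 ↔ l % (n + 1) = 0 := by
  have h1 := Int.emod_nonneg l (show ((n : ℤ) + 1) ≠ 0 by omega)
  rw [Fin.ext_iff]
  simp only [vertex, Fin.val_zero]
  omega

/-- The morphisms `0 ↦ 0`, `i ↦ 1` (`i > 0`) commute with the action of `p⁻¹(O(1))`. -/
theorem reflect_comp_collapse (m : ℕ) {n : ℕ} (hn : n = 1) {ε : ℤˣ} {x : 𝔾}
    (hx : p x = reflection ε) :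
    (reflect m ε x hx).hom ≫ collapse p m n ≫ (reflect n ε x hx).inv = collapse p m n := by
  subst hn
  refine congrArg (Quotient.mk _) (PreHom.ext ?_ (funext fun l => ?_) ?_)
  · change ε * 1 * ε = 1
    rw [mul_one, Int.units_mul_self]
  · change ε * ((((if vertex m (ε * l) = 0 then 0 else Fin.last 1 : Fin (1 + 1)) : ℕ) : ℤ) +
      ε * l / (m + 1) * (1 + 1)) =
        (((if vertex m l = 0 then 0 else Fin.last 1 : Fin (1 + 1)) : ℕ) : ℤ) + l / (m + 1) * (1 + 1)
    simp only [vertex_eq_zero_iff]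
    have hm : (0 : ℤ) < m + 1 := by omega
    rcases Int.units_eq_one_or ε with rfl | rfl
    · simp
    -- The claim is that the periodic map of the collapse is odd. Multiples of `m + 1` are clear;
    -- for other `l` with quotient `q`, the quotient of `-l` is `-q - 1`, and `-(1 + 2 (-q - 1)) = 1
    -- + 2 q`. This uses that the target is `[1]`.
    · simp only [Units.val_neg, Units.val_one, neg_mul, one_mul]
      have h0 := Int.emod_nonneg l hm.ne'
      have h1 := Int.emod_lt_of_pos l hm
      have h2 := Int.emod_add_mul_ediv l (m + 1)
      by_cases hl : l % (m + 1) = 0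
      · have h3 : -l = 0 + (-(l / (m + 1))) * (m + 1) := by linear_combination h2 - hl
        have h4 : (-l) % (m + 1) = 0 := by rw [h3, Int.add_mul_emod_self_right]; simp
        have h5 : (-l) / (m + 1) = -(l / (m + 1)) := by
          rw [h3, Int.add_mul_ediv_right _ _ hm.ne']; simp
        rw [if_pos h4, if_pos hl, h5]
        simp
      · have h3 : -l = (m + 1 - l % (m + 1)) + (-(l / (m + 1)) - 1) * (m + 1) := by
          linear_combination h2
        have h4 : (-l) % (m + 1) ≠ 0 := by
          rw [h3, Int.add_mul_emod_self_right, Int.emod_eq_of_lt (by omega) (by omega)]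
          omega
        have h5 : (-l) / (m + 1) = -(l / (m + 1)) - 1 := by
          rw [h3, Int.add_mul_ediv_right _ _ hm.ne', Int.ediv_eq_zero_of_lt (by omega) (by omega)]
          simp
        rw [if_neg h4, if_neg hl, h5]
        simp
        ring
  · change x⁻¹ * 1 * x = 1
    simp

end DeltaG

/-! ### Morphisms of structured sets -/

namespace StructuredSet

theorem diff_act (X : StructuredSet.{a, b, c} p) (o o' : X.Frame) (x : X.std ≅ X.std) :
    X.diff o (X.act o' x) = x ≪≫ X.diff o o' :=
  (X.eq_diff (by rw [X.act_trans, X.act_diff])).symm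

theorem diff_self (X : StructuredSet.{a, b, c} p) (o : X.Frame) : X.diff o o = Iso.refl _ :=
  (X.eq_diff (X.act_refl o)).symm

/-- The morphism with a given component. -/
def homOfComp {X' X : StructuredSet.{a, b, c} p} (f : X.Frame) (f' : X'.Frame)
    (u : X'.std ⟶ X.std) : X' ⟶ X :=
  ({ app := fun g g' => (X'.diff f' g').hom ≫ u ≫ (X.diff f g).inv
     app_act := by
      intro g g' x x'
      rw [diff_act, diff_act]
      simp } : Hom X' X)

theorem comps_homOfComp {X' X : StructuredSet.{a, b, c} p} (f : X.Frame) (f' : X'.Frame)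
    (u : X'.std ⟶ X.std) : comps (homOfComp f f' u) f f' = u := by
  change (X'.diff f' f').hom ≫ u ≫ (X.diff f f).inv = u
  simp [diff_self]

theorem comps_act {X' X : StructuredSet.{a, b, c} p} (ψ : X' ⟶ X) (f : X.Frame) (f' : X'.Frame)
    (x : X.std ≅ X.std) (x' : X'.std ≅ X'.std) :
    comps ψ (X.act f x) (X'.act f' x') = x'.hom ≫ comps ψ f f' ≫ x.inv := Hom.app_act ψ f f' x x'

/-- The automorphism groups act transitively on frames, and families are equivariant, so one
component determines the whole family. -/
theorem hom_ext_comp {X' X : StructuredSet.{a, b, c} p} {ψ φ : X' ⟶ X} (f : X.Frame)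
    (f' : X'.Frame) (h : comps ψ f f' = comps φ f f') : ψ = φ := by
  refine Hom.ext (funext fun g => funext fun g' => ?_)
  rw [← X.act_diff f g, ← X'.act_diff f' g']
  change comps ψ _ _ = comps φ _ _
  rw [comps_act, comps_act, h]

/-- The isomorphism that matches two given frames. -/
def isoOfFrames {X' X : StructuredSet.{a, b, c} p} (h : X'.std = X.std) (f : X.Frame)
    (f' : X'.Frame) : X' ≅ X where
  hom := homOfComp f f' (eqToHom h)
  inv := homOfComp f' f (eqToHom h.symm)
  hom_inv_id := hom_ext_comp f' f' (by
    rw [comps_comp _ _ _ f, comps_homOfComp, comps_homOfComp, comps_id, diff_self]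
    simp)
  inv_hom_id := hom_ext_comp f f (by
    rw [comps_comp _ _ _ f', comps_homOfComp, comps_homOfComp, comps_id, diff_self]
    simp)

theorem under_id (X : StructuredSet.{a, b, c} p) (f f' : X.Frame) (i : X.carrier) :
    under (𝟙 X) f f' i = i := by
  rw [under_indep _ _ f _ f, under, comps_id, diff_self, Iso.refl_hom, DeltaG.vertexMap_id,
    Equiv.apply_symm_apply]

theorem under_homOfComp {X' X : StructuredSet.{a, b, c} p} (f : X.Frame) (f' : X'.Frame)
    (u : X'.std ⟶ X.std) (g : X.Frame) (g' : X'.Frame) (i : X'.carrier) :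
    under (homOfComp f f' u) g g' i = X.label f (DeltaG.vertexMap u ((X'.label f').symm i)) := by
  rw [under_indep _ _ f _ f', under, comps_homOfComp]

theorem under_collapse_zero {X' X : StructuredSet.{a, b, c} p} (f : X.Frame) (f' : X'.Frame)
    (g : X.Frame) (g' : X'.Frame) {i : X'.carrier} (hi : i = X'.label f' 0) :
    under (homOfComp f f' (DeltaG.collapse p _ _)) g g' i = X.label f 0 := by
  rw [under_homOfComp, DeltaG.vertexMap_collapse, if_pos ((Equiv.symm_apply_eq _).mpr hi)]

theorem under_collapse_of_ne {X' X : StructuredSet.{a, b, c} p} (f : X.Frame) (f' : X'.Frame)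
    (g : X.Frame) (g' : X'.Frame) {i : X'.carrier} (hi : i ≠ X'.label f' 0) :
    under (homOfComp f f' (DeltaG.collapse p _ _)) g g' i = X.label f (Fin.last _) := by
  rw [under_homOfComp, DeltaG.vertexMap_collapse,
    if_neg fun h => hi ((Equiv.symm_apply_eq _).mp h)]

/-- This makes the morphism of a half-edge independent of the transported pair used to define it,
since such pairs differ by an element of `p⁻¹(O(1))`. -/
theorem comps_collapse_of_reflect {X' X : StructuredSet.{a, b, c} p} (hX : X.len = 1)
    {f g : X.Frame} {f' g' : X'.Frame} {ε : ℤˣ} {x : 𝔾} (hx : p x = reflection ε)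
    (h : X.act f (DeltaG.reflect _ ε x hx) = g) (h' : X'.act f' (DeltaG.reflect _ ε x hx) = g') :
    comps (homOfComp f f' (DeltaG.collapse p _ _)) g g' = DeltaG.collapse p _ _ := by
  rw [← h, ← h', comps_act, comps_homOfComp]
  exact DeltaG.reflect_comp_collapse _ hX hx

end StructuredSet

end Automorphisms

/-! ### Directions of tangent vectors -/

section Surface

variable {S : Type b} [TopologicalSpace S] [ChartedSpace (EuclideanHalfSpace 2) S]

theorem SameDirection.proj_eq {u w : TangentBundle (𝓡∂ 2) S} (h : SameDirection u w) :
    u.proj = w.proj := by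
  obtain ⟨r, -, rfl⟩ := h
  rfl

theorem SameDirection.symm {u w : TangentBundle (𝓡∂ 2) S} (h : SameDirection u w) :
    SameDirection w u := by
  obtain ⟨r, hr, rfl⟩ := h
  refine ⟨r⁻¹, inv_pos.mpr hr, ?_⟩
  simp only [smul_smul, inv_mul_cancel₀ hr.ne', one_smul]

theorem SameDirection.trans {u v w : TangentBundle (𝓡∂ 2) S} (h : SameDirection u v)
    (h' : SameDirection v w) : SameDirection u w := by
  obtain ⟨r, hr, rfl⟩ := h
  obtain ⟨s, hs, rfl⟩ := h'
  exact ⟨r * s, mul_pos hr hs, by simp only [smul_smul]⟩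

theorem sameDirection_mk_iff {x : S} {v w : TangentSpace (𝓡∂ 2) x} :
    SameDirection (⟨x, v⟩ : TangentBundle (𝓡∂ 2) S) ⟨x, w⟩ ↔ ∃ r : ℝ, 0 < r ∧ v = r • w := by
  simp [SameDirection]

namespace Frame

/-- The tangent vector with given coordinates in a frame. -/
def comb (x : Frame S) : ℂ →ₗ[ℝ] TangentSpace (𝓡∂ 2) x.pt where
  toFun z := z.re • x.vec 0 + z.im • x.vec 1
  map_add' z w := by simp only [Complex.add_re, Complex.add_im, add_smul]; abel
  map_smul' r z := by simp [mul_smul]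

theorem comb_apply (x : Frame S) (z : ℂ) : x.comb z = z.re • x.vec 0 + z.im • x.vec 1 := rfl

theorem comb_injective (x : Frame S) : Function.Injective x.comb := by
  rw [← LinearMap.ker_eq_bot, LinearMap.ker_eq_bot']
  intro z hz
  have h := Fintype.linearIndependent_iff.mp x.linearIndependent ![z.re, z.im] (by
    simpa [Fin.sum_univ_two, comb_apply] using hz)
  exact Complex.ext (h 0) (h 1)

theorem comb_surjective (x : Frame S) : Function.Surjective x.comb := by
  have h1 : Module.finrank ℝ (TangentSpace (𝓡∂ 2) x.pt) = 2 :=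
    finrank_euclideanSpace_fin (𝕜 := ℝ) (n := 2)
  have : FiniteDimensional ℝ (TangentSpace (𝓡∂ 2) x.pt) :=
    Module.finite_of_finrank_pos (by omega)
  exact (LinearMap.injective_iff_surjective_of_finrank_eq_finrank
    (by rw [Complex.finrank_real_complex, h1])).mp x.comb_injective

theorem first_act (x : Frame S) (A : GL (Fin 2) ℝ) :
    (x.act A).first = ⟨x.pt, x.comb (firstCol A)⟩ := by
  simp only [first, act, comb_apply, firstCol, Fin.sum_univ_two]

theorem first_eq (x : Frame S) : x.first = ⟨x.pt, x.comb 1⟩ := by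
  simp [first, comb_apply]

/-- Coordinates in a frame are linear and injective, so positive multiples correspond. From here on,
directions in a tangent space are handled as angles. -/
theorem sameDirection_comb_iff (x : Frame S) {z w : ℂ} {α : ℝ} (hw : Dir w α) :
    SameDirection (⟨x.pt, x.comb z⟩ : TangentBundle (𝓡∂ 2) S) ⟨x.pt, x.comb w⟩ ↔ Dir z α := by
  rw [sameDirection_mk_iff]
  have h : ∀ r : ℝ, x.comb z = r • x.comb w ↔ z = r * w := by
    intro r
    rw [← map_smul, x.comb_injective.eq_iff, Complex.real_smul]
  simp only [h]
  constructor
  · rintro ⟨r, hr, rfl⟩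
    exact hw.scale hr
  · intro hz
    exact hz.exists_scale hw

/-- Every nonzero tangent vector has an angle in a given frame. -/
theorem exists_comb_eq (x : Frame S) {u : TangentBundle (𝓡∂ 2) S} (hu : u.proj = x.pt)
    (h0 : u.snd ≠ 0) : ∃ z : ℂ, z ≠ 0 ∧ u = ⟨x.pt, x.comb z⟩ := by
  obtain ⟨y, v⟩ := u
  obtain rfl : y = x.pt := hu
  obtain ⟨z, rfl⟩ := x.comb_surjective v
  exact ⟨z, fun hz => h0 (by simp [hz]), rfl⟩

end Frame

/-! ### Germs -/

theorem Graph.edgeOf_eq {Γ : Graph.{d, e}} {x : Γ.Edge} {h : Γ.H} (hx : h ∈ x.1) :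
    Γ.edgeOf h = x := by
  obtain ⟨_, h', rfl⟩ := x
  apply Subtype.ext
  simp only [Graph.edgeOf]
  rcases Sym2.mem_iff.mp hx with rfl | rfl
  · rfl
  · rw [Γ.τ_τ, Sym2.eq_swap]

theorem halfEdgePath_zero {S : Type b} {Γ : Graph.{d, e}} (γ : Γ.Realization → S) (h : Γ.H) :
    halfEdgePath γ h 0 = γ (Γ.point (.vert (Γ.src h))) := by
  rw [halfEdgePath, Set.projIcc_left]
  exact congrArg γ (Quot.sound (Graph.Glue.start h))

theorem halfEdgePath_one {S : Type b} {Γ : Graph.{d, e}} (γ : Γ.Realization → S) (h : Γ.H) :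
    halfEdgePath γ h 1 = γ (Γ.point (.edge (Γ.edgeOf h))) := by
  rw [halfEdgePath, Set.projIcc_right]
  exact congrArg γ (Quot.sound (Graph.Glue.finish h))

theorem germ_proj {Γ : Graph.{d, e}} (γ : Γ.Realization → S) (X : Γ.Cell) (i : Γ.star X) :
    (germ γ X i).proj = γ (Γ.point X) := by
  cases X with
  | vert v =>
    obtain ⟨h, rfl⟩ := i
    exact halfEdgePath_zero γ h
  | edge x =>
    obtain ⟨h, hx⟩ := i
    obtain rfl := Graph.edgeOf_eq hx
    exact halfEdgePath_one γ h

theorem germ_ne_zero {Γ : Graph.{d, e}} {γ : Γ.Realization → S} (hγ : IsEmbedded γ) (X : Γ.Cell)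
    (i : Γ.star X) : (germ γ X i).snd ≠ 0 := by
  cases X with
  | vert v => exact hγ.regular i.1 0 (by simp)
  | edge x => exact neg_ne_zero.mpr (hγ.regular i.1 1 (by simp))

/-! ### Principal bundles -/

variable [IsManifold (𝓡∂ 2) ∞ S]

theorem isManifold_one : IsManifold (𝓡∂ 2) 1 S := .of_le (n := ∞) (by exact_mod_cast le_top)

theorem Frame.continuous_first_second :
    letI : IsManifold (𝓡∂ 2) 1 S := isManifold_one
    Continuous fun x : Frame S => (x.first, x.second) :=
  continuous_induced_dom

theorem Frame.continuous_pt : Continuous (Frame.pt : Frame S → S) := by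
  have : IsManifold (𝓡∂ 2) 1 S := isManifold_one
  exact (FiberBundle.continuous_proj (EuclideanSpace ℝ (Fin 2))
    (TangentSpace (𝓡∂ 2) : S → Type _)).comp
    (continuous_fst.comp Frame.continuous_first_second)

namespace GStructure

variable {𝔾 : Type a} [Group 𝔾] [TopologicalSpace 𝔾] {p : 𝔾 →* GL (Fin 2) ℝ}
  (Q : GStructure.{a, b, c} p S)

theorem pt_act (f : Q.F) (x : 𝔾) : (Q.ρ (Q.act f x)).pt = (Q.ρ f).pt := by
  rw [Q.ρ_act]; rfl

theorem exists_pt_eq (y : S) : ∃ f, (Q.ρ f).pt = y := by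
  obtain ⟨U, -, hy, φ, h, -⟩ := Q.locally_trivial y
  exact ⟨_, h ⟨y, hy⟩ 1⟩

/-- The trivialization is split into a local section `σ` and the continuous `𝔾`-coordinate `d`
relative to it. This is the form that yields freeness, transitivity on fibres and continuity of
differences. -/
theorem exists_triv (y : S) : ∃ U : Set S, IsOpen U ∧ y ∈ U ∧
    ∃ (σ : U → Q.F) (d : {f : Q.F // (Q.ρ f).pt ∈ U} → 𝔾), Continuous σ ∧ Continuous d ∧
      (∀ z, (Q.ρ (σ z)).pt = z) ∧ (∀ f, f.1 = Q.act (σ ⟨_, f.2⟩) (d f)) ∧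
      ∀ z x (hz : (Q.ρ (Q.act (σ z) x)).pt ∈ U), d ⟨_, hz⟩ = x := by
  obtain ⟨U, hU, hy, φ, h1, h2⟩ := Q.locally_trivial y
  have h3 : ∀ z x, (φ (z, x)).1 = Q.act (φ (z, 1)).1 x := fun z x => by rw [← h2, one_mul]
  refine ⟨U, hU, hy, fun z => (φ (z, 1)).1, fun f => (φ.symm f).2, by fun_prop, by fun_prop,
    fun z => h1 z 1, fun f => ?_, fun z x hz => ?_⟩
  · have h4 : (φ.symm f).1 = ⟨(Q.ρ f.1).pt, f.2⟩ := by
      apply Subtype.ext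
      rw [← h1 (φ.symm f).1 (φ.symm f).2]
      simp
    rw [← h4, ← h3]
    simp
  · have : (⟨_, hz⟩ : {f : Q.F // (Q.ρ f).pt ∈ U}) = φ (z, x) := Subtype.ext (h3 z x).symm
    rw [this]
    simp

theorem act_inv_mul {f s : Q.F} {x : 𝔾} (h : f = Q.act s x) (y : 𝔾) :
    Q.act f (x⁻¹ * y) = Q.act s y := by
  rw [h, ← Q.act_mul, mul_inv_cancel_left]

theorem exists_act_eq {f f' : Q.F} (h : (Q.ρ f').pt = (Q.ρ f).pt) : ∃ x, f' = Q.act f x := by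
  obtain ⟨U, -, hy, σ, d, -, -, -, h1, -⟩ := Q.exists_triv (Q.ρ f).pt
  have hy' : (Q.ρ f').pt ∈ U := h ▸ hy
  have e1 := h1 ⟨f, hy⟩
  have e2 := h1 ⟨f', hy'⟩
  simp only [h] at e2
  refine ⟨(d ⟨f, hy⟩)⁻¹ * d ⟨f', hy'⟩, ?_⟩
  exact e2.trans (Q.act_inv_mul e1 _).symm

theorem act_injective (f : Q.F) : Function.Injective (Q.act f) := by
  intro x x' h
  obtain ⟨U, -, hy, σ, d, -, -, -, h1, h2⟩ := Q.exists_triv (Q.ρ f).pt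
  have e1 := h1 ⟨f, hy⟩
  simp only at e1
  rw [e1, ← Q.act_mul, ← Q.act_mul] at h
  have hz : (Q.ρ (Q.act (σ ⟨_, hy⟩) (d ⟨f, hy⟩ * x))).pt ∈ U := by
    rw [Q.act_mul, Q.pt_act, ← e1]; exact hy
  have hz' : (Q.ρ (Q.act (σ ⟨_, hy⟩) (d ⟨f, hy⟩ * x'))).pt ∈ U := by
    rw [Q.act_mul, Q.pt_act, ← e1]; exact hy
  have e3 := h2 ⟨_, hy⟩ _ hz
  have e4 := h2 ⟨_, hy⟩ _ hz'
  simp only [h] at e3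
  exact mul_left_cancel (e3.symm.trans e4)

/-- Two families of points of `F` over the same points differ by a continuous family in `𝔾`. -/
theorem exists_continuous_act_eq [IsTopologicalGroup 𝔾] {T : Type*} [TopologicalSpace T]
    {k k' : T → Q.F} (hk : Continuous k) (hk' : Continuous k')
    (h : ∀ t, (Q.ρ (k' t)).pt = (Q.ρ (k t)).pt) :
    ∃ g : T → 𝔾, Continuous g ∧ ∀ t, k' t = Q.act (k t) (g t) := by
  choose g hg using fun t => Q.exists_act_eq (h t)
  refine ⟨g, continuous_iff_continuousAt.mpr fun t₀ => ?_, hg⟩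
  obtain ⟨U, hU, hy, σ, d, -, hd, -, h1, -⟩ := Q.exists_triv (Q.ρ (k t₀)).pt
  have hc : Continuous fun t => (Q.ρ (k t)).pt := Frame.continuous_pt.comp (Q.continuous_ρ.comp hk)
  have hV : IsOpen {t | (Q.ρ (k t)).pt ∈ U} := hU.preimage hc
  refine ContinuousOn.continuousAt (s := {t | (Q.ρ (k t)).pt ∈ U}) ?_ (hV.mem_nhds hy)
  rw [continuousOn_iff_continuous_domRestrict]
  -- Since the action is free, the difference of the two families over `U` is the quotient of their
  -- coordinates relative to the section.
  have e : ({t | (Q.ρ (k t)).pt ∈ U}.domRestrict g) = fun t =>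
      (d ⟨k t.1, t.2⟩)⁻¹ * d ⟨k' t.1, by rw [h]; exact t.2⟩ := by
    funext t
    have e1 := h1 ⟨k t.1, t.2⟩
    have e2 := h1 ⟨k' t.1, by rw [h]; exact t.2⟩
    simp only [h] at e1 e2
    apply Q.act_injective (k t.1)
    change Q.act (k t.1) (g t.1) = _
    rw [← hg]
    exact e2.trans (Q.act_inv_mul e1 _).symm
  rw [e]
  refine Continuous.mul (Continuous.inv (hd.comp ?_)) (hd.comp ?_)
  · exact Continuous.subtype_mk (hk.comp continuous_subtype_val) _
  · exact Continuous.subtype_mk (hk'.comp continuous_subtype_val) _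

theorem first_act (f : Q.F) (x : 𝔾) :
    (Q.ρ (Q.act f x)).first = ⟨(Q.ρ f).pt, (Q.ρ f).comb (firstCol (p x))⟩ := by
  rw [Q.ρ_act, Frame.first_act]

end GStructure

end Surface

/-! ### Cyclically ordered directions -/

theorem vertex_eq_vertex_iff {n : ℕ} {l l' : ℤ} :
    DeltaG.vertex n l = DeltaG.vertex n l' ↔ ∃ j : ℤ, l' = l + j * (n + 1) := by
  constructor
  · intro h
    have hn : (n : ℤ) + 1 ≠ 0 := by omega
    have h1 := Int.emod_nonneg l hn
    have h2 := Int.emod_nonneg l' hn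
    have h3 : l % (n + 1) = l' % (n + 1) := by
      have := congrArg Fin.val h
      simp only [DeltaG.vertex] at this
      omega
    refine ⟨l' / (n + 1) - l / (n + 1), ?_⟩
    have e1 := Int.emod_add_mul_ediv l (n + 1)
    have e2 := Int.emod_add_mul_ediv l' (n + 1)
    linear_combination e1 - e2 - h3
  · rintro ⟨j, rfl⟩
    rw [DeltaG.vertex_add_mul]

/-- The periodic extension of an increasing sequence of angles. -/
def periodicAngle {n : ℕ} (s : Fin (n + 1) → ℝ) (l : ℤ) : ℝ :=
  s (DeltaG.vertex n l) + 2 * Real.pi * ((l / (n + 1) : ℤ) : ℝ)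

theorem periodicAngle_add {n : ℕ} (s : Fin (n + 1) → ℝ) (l : ℤ) :
    periodicAngle s (l + (n + 1)) = periodicAngle s l + 2 * Real.pi := by
  have h := DeltaG.vertex_add_mul n l 1
  rw [one_mul] at h
  have h2 : (l + (n + 1)) / ((n : ℤ) + 1) = l / (n + 1) + 1 :=
    Int.add_ediv_of_dvd_right (dvd_refl _) |>.trans (by rw [Int.ediv_self (by omega)])
  rw [periodicAngle, h, h2, periodicAngle]
  push_cast
  ring

/-- All the angles lie in the half-open interval `(-π, π]`, so a shift by `2π` carries each of them
past all the others. -/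
theorem strictMono_periodicAngle {n : ℕ} {s : Fin (n + 1) → ℝ} (hs : StrictMono s)
    (h1 : ∀ i, -Real.pi < s i) (h2 : ∀ i, s i ≤ Real.pi) : StrictMono (periodicAngle s) := by
  intro x y h
  have hn : (0 : ℤ) < n + 1 := by omega
  have hpi := Real.pi_pos
  rw [periodicAngle, periodicAngle]
  rcases (Int.ediv_le_ediv hn h.le).eq_or_lt with hq | hq
  · have hv : DeltaG.vertex n x < DeltaG.vertex n y := by
      have e1 := Int.emod_add_mul_ediv x (n + 1)
      have e2 := Int.emod_add_mul_ediv y (n + 1)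
      rw [hq] at e1
      have h3 : x % (n + 1) < y % (n + 1) := by linarith
      have h4 := Int.emod_nonneg x hn.ne'
      rw [Fin.lt_def]
      simp only [DeltaG.vertex]
      omega
    rw [hq]
    linarith [hs hv]
  · have h3 : ((x / (n + 1) : ℤ) : ℝ) + 1 ≤ ((y / (n + 1) : ℤ) : ℝ) := by exact_mod_cast hq
    have h4 := mul_le_mul_of_nonneg_left h3 (by positivity : 0 ≤ 2 * Real.pi)
    linarith [h1 (DeltaG.vertex n y), h2 (DeltaG.vertex n x)]

/-! ### Marked frames at a vertex or at the midpoint of an edge. -/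

section Cells

variable {S : Type b} [TopologicalSpace S] [ChartedSpace (EuclideanHalfSpace 2) S]
  [IsManifold (𝓡∂ 2) ∞ S] {𝔾 : Type a} [Group 𝔾] [TopologicalSpace 𝔾] {p : 𝔾 →* GL (Fin 2) ℝ}

/-- A point of `F` over the image of a `0`-cell, and the increasing sequence of the angles of the
germs leaving that cell in its frame. -/
structure CellFrame (Q : GStructure.{a, b, c} p S) {Γ : Graph.{d, e}} (γ : Γ.Realization → S)
    (X : Γ.Cell) where
  /-- the point of `F` -/
  base : Q.F
  base_pt : (Q.ρ base).pt = γ (Γ.point X)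
  /-- the number of germs, minus one -/
  len : ℕ
  /-- the numbering of the germs -/
  label : Fin (len + 1) ≃ Γ.star X
  /-- the angles -/
  angle : ℤ → ℝ
  strictMono_angle : StrictMono angle
  angle_add : ∀ l, angle (l + (len + 1)) = angle l + 2 * Real.pi
  sameDirection_iff : ∀ x i, SameDirection (Q.ρ (Q.act base x)).first (germ γ X i) ↔
    ∃ l, label (DeltaG.vertex len l) = i ∧ Dir (firstCol (p x)) (angle l)

/-- The germs are read in the frame of an arbitrary point of `F` over the cell. Distinct directions
have distinct principal arguments, which order the germs; periodic extension then lists all their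
angles. -/
theorem exists_cellFrame (Q : GStructure.{a, b, c} p S) {Γ : Graph.{d, e}}
    {γ : Γ.Realization → S} (hγ : IsEmbedded γ) (X : Γ.Cell) [Finite (Γ.star X)]
    [Nonempty (Γ.star X)] : Nonempty (CellFrame Q γ X) := by
  obtain ⟨f, hf⟩ := Q.exists_pt_eq (γ (Γ.point X))
  choose z hz0 hz using fun i => (Q.ρ f).exists_comb_eq (u := germ γ X i)
    ((germ_proj γ X i).trans hf.symm) (germ_ne_zero hγ X i)
  have hdir : ∀ i, Dir (z i) (z i).arg := fun i => dir_arg (hz0 i)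
  have hinj : Function.Injective fun i => (z i).arg := by
    intro i j hij
    apply hγ.distinct X
    rw [hz i, hz j, (Q.ρ f).sameDirection_comb_iff (hdir j)]
    have h := hdir i
    rwa [show (z i).arg = (z j).arg from hij] at h
  let _ : LinearOrder (Γ.star X) := LinearOrder.lift' _ hinj
  let _ : Fintype (Γ.star X) := Fintype.ofFinite _
  have hcard : Fintype.card (Γ.star X) = Fintype.card (Γ.star X) - 1 + 1 :=
    (Nat.sub_add_cancel Fintype.card_pos).symm
  let σ := monoEquivOfFin (Γ.star X) hcard
  have hmono : StrictMono fun i => (z (σ i)).arg := fun i j hij => σ.strictMono hij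
  refine ⟨{ base := f
            base_pt := hf
            len := Fintype.card (Γ.star X) - 1
            label := σ.toEquiv
            angle := periodicAngle fun i => (z (σ i)).arg
            strictMono_angle := strictMono_periodicAngle hmono
              (fun i => Complex.neg_pi_lt_arg _) fun i => Complex.arg_le_pi _
            angle_add := periodicAngle_add _
            sameDirection_iff := fun x i => ?_ }⟩
  rw [Q.first_act, hz i, (Q.ρ f).sameDirection_comb_iff (hdir i)]
  constructor
  · intro h
    refine ⟨((σ.symm i : Fin _) : ℕ), ?_, ?_⟩
    · rw [DeltaG.vertex_coe]
      exact σ.apply_symm_apply i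
    · rw [periodicAngle, DeltaG.vertex_coe, Int.ediv_eq_zero_of_lt (by omega)
        (by exact_mod_cast (σ.symm i).isLt)]
      simpa using h
  · rintro ⟨l, rfl, h⟩
    have h2 := h.add (-(l / ((Fintype.card (Γ.star X) - 1 : ℕ) + 1)))
    rw [periodicAngle] at h2
    push_cast at h2
    convert h2 using 1
    ring_nf
    rfl

theorem sameDirection_polar (Q : GStructure.{a, b, c} p S) (P : PolarLift p) {y : 𝔾} {ε : ℤˣ}
    (hy : p y = reflection ε) (f : Q.F) (α : ℝ) (x x' : ℝ × ℝ × ℝ) :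
    SameDirection (Q.ρ (Q.act f (P.rot α * P.tri x * y))).first
      (Q.ρ (Q.act f (P.rot α * P.tri x' * y))).first := by
  rw [Q.first_act, Q.first_act, Frame.sameDirection_comb_iff _ (P.dir_polar hy α x')]
  exact P.dir_polar hy α x

/-- Marked frames that differ by a triangular matrix are in the same class. -/
theorem frameClass_eq_of_polar [IsTopologicalGroup 𝔾] {Q : GStructure.{a, b, c} p S}
    {Γ : Graph.{d, e}} {γ : Γ.Realization → S} {X : Γ.Cell} (P : PolarLift p)
    {f f' : MarkedFrame Q γ X} {f₀ : Q.F} {α : ℝ} {x x' : ℝ × ℝ × ℝ} {y : 𝔾} {ε : ℤˣ}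
    (hy : p y = reflection ε) (h : f.1 = Q.act f₀ (P.rot α * P.tri x * y))
    (h' : f'.1 = Q.act f₀ (P.rot α * P.tri x' * y)) : frameClass f = frameClass f' := by
  have ht := P.continuous_tri
  -- The path is a straight segment in the triangular coordinates; it does not change the direction
  -- of the first vector.
  have hc : Continuous fun t : unitInterval =>
      Q.act f₀ (P.rot α * P.tri (x + (t : ℝ) • (x' - x)) * y) := by
    refine Q.continuous_act.comp (Continuous.prodMk continuous_const ?_)
    fun_prop
  have hm : ∀ t : unitInterval, ∃ i, SameDirection
      (Q.ρ (Q.act f₀ (P.rot α * P.tri (x + (t : ℝ) • (x' - x)) * y))).first (germ γ X i) := by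
    intro t
    obtain ⟨i, hi⟩ := f.2
    rw [h] at hi
    exact ⟨i, (sameDirection_polar Q P hy f₀ α _ x).trans hi⟩
  refine Quotient.sound ⟨⟨⟨fun t => ⟨_, hm t⟩, Continuous.subtype_mk hc _⟩, ?_, ?_⟩⟩
  · apply Subtype.ext
    rw [h]
    simp
  · apply Subtype.ext
    rw [h']
    simp

namespace CellFrame

variable {Q : GStructure.{a, b, c} p S} {Γ : Graph.{d, e}} {γ : Γ.Realization → S} {X : Γ.Cell}
  (D : CellFrame Q γ X)

theorem angle_add_mul (l j : ℤ) :
    D.angle (l + j * (D.len + 1)) = D.angle l + 2 * Real.pi * j := by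
  induction j using Int.induction_on with
  | zero => simp
  | succ i ih =>
    rw [show l + ((i : ℤ) + 1) * (D.len + 1) = l + i * (D.len + 1) + (D.len + 1) by ring,
      D.angle_add, ih]
    push_cast
    ring
  | pred i ih =>
    have h := D.angle_add (l + (-(i : ℤ) - 1) * (D.len + 1))
    rw [show l + (-(i : ℤ) - 1) * (D.len + 1) + (D.len + 1) = l + -(i : ℤ) * (D.len + 1) by ring,
      ih] at h
    push_cast at h ⊢
    linarith

/-- The germ with a given number. -/
def lab (l : ℤ) : Γ.star X := D.label (DeltaG.vertex D.len l)

theorem marked_iff (x : 𝔾) : (∃ i, SameDirection (Q.ρ (Q.act D.base x)).first (germ γ X i)) ↔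
    ∃ l, Dir (firstCol (p x)) (D.angle l) := by
  simp only [D.sameDirection_iff]
  constructor
  · rintro ⟨i, l, -, h⟩
    exact ⟨l, h⟩
  · rintro ⟨l, h⟩
    exact ⟨_, l, rfl, h⟩

theorem pt_eq (f : MarkedFrame Q γ X) : (Q.ρ f.1).pt = (Q.ρ D.base).pt := by
  obtain ⟨f, i, h⟩ := f
  rw [D.base_pt, ← germ_proj γ X i]
  exact h.proj_eq

/-- By periodicity one period of indices gives all the directions. Finiteness is what forces a
continuous family of marked frames to keep its direction. -/
theorem finite_directions :
    (Set.range fun l => Complex.exp (D.angle l * Complex.I)).Finite := by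
  refine (Set.finite_range fun i : Fin (D.len + 1) =>
    Complex.exp (D.angle ((i : ℕ) : ℤ) * Complex.I)).subset ?_
  rintro _ ⟨l, rfl⟩
  refine ⟨DeltaG.vertex D.len l, ?_⟩
  obtain ⟨j, hj⟩ := vertex_eq_vertex_iff.mp (DeltaG.vertex_coe D.len (DeltaG.vertex D.len l))
  simp only
  rw [Complex.exp_eq_exp_iff_exists_int]
  refine ⟨-j, ?_⟩
  have h := D.angle_add_mul ((DeltaG.vertex D.len l : ℕ) : ℤ) j
  rw [← hj] at h
  rw [h]
  push_cast
  ring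

variable (P : PolarLift p)

/-- The marked frame `f` has polar decomposition `(k, y)`, up to a triangular matrix. -/
def HasPolar (f : MarkedFrame Q γ X) (k : ℤ) (y : 𝔾) : Prop :=
  ∃ x, f.1 = Q.act D.base (P.rot (D.angle k) * P.tri x * y)

/-- The marked frame with a given polar decomposition. -/
def std (k : ℤ) {ε : ℤˣ} {y : 𝔾} (hy : p y = reflection ε) (x : ℝ × ℝ × ℝ) : MarkedFrame Q γ X :=
  ⟨Q.act D.base (P.rot (D.angle k) * P.tri x * y),
    (D.marked_iff _).mpr ⟨k, P.dir_polar hy _ _⟩⟩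

theorem hasPolar_std (k : ℤ) {ε : ℤˣ} {y : 𝔾} (hy : p y = reflection ε) (x : ℝ × ℝ × ℝ) :
    D.HasPolar P (D.std P k hy x) k y := ⟨x, rfl⟩

theorem exists_hasPolar (f : MarkedFrame Q γ X) :
    ∃ k ε y, p y = reflection ε ∧ D.HasPolar P f k y := by
  obtain ⟨x, hx⟩ := Q.exists_act_eq (D.pt_eq f)
  have h := f.2
  rw [hx] at h
  obtain ⟨k, hk⟩ := (D.marked_iff x).mp h
  obtain ⟨b, ε, y, hy, hb⟩ := P.exists_polar hk
  exact ⟨k, ε, y, hy, b, by rw [hx, hb]⟩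

theorem HasPolar.sameDirection {D : CellFrame Q γ X} {P : PolarLift p} {f : MarkedFrame Q γ X}
    {k : ℤ} {y : 𝔾} (h : D.HasPolar P f k y) {ε : ℤˣ} (hy : p y = reflection ε) :
    SameDirection (Q.ρ f.1).first (germ γ X (D.lab k)) := by
  obtain ⟨x, hx⟩ := h
  rw [hx, D.sameDirection_iff]
  exact ⟨k, rfl, P.dir_polar hy _ _⟩

variable [IsTopologicalGroup 𝔾]

/-- This is uniqueness of the polar decomposition, rewritten with indices: a shift of the angle by
`2πj` is a shift of the index by `j` periods. `HasPolar.shift` is the converse. -/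
theorem HasPolar.exists_int {D : CellFrame Q γ X} {P : PolarLift p} {f : MarkedFrame Q γ X}
    {k k' : ℤ} {y y' : 𝔾} {ε ε' : ℤˣ} (h : D.HasPolar P f k y) (h' : D.HasPolar P f k' y')
    (hy : p y = reflection ε) (hy' : p y' = reflection ε') :
    ∃ j : ℤ, k' = k + j * (D.len + 1) ∧ y = P.rot (2 * Real.pi * j) * y' := by
  obtain ⟨x, hx⟩ := h
  obtain ⟨x', hx'⟩ := h'
  obtain ⟨j, h1, h2⟩ := P.polar_unique hy hy' (Q.act_injective _ (hx.symm.trans hx'))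
  refine ⟨j, D.strictMono_angle.injective ?_, h2⟩
  rw [h1, D.angle_add_mul]

theorem HasPolar.shift {D : CellFrame Q γ X} {P : PolarLift p} {f : MarkedFrame Q γ X} {k j : ℤ}
    {y y' : 𝔾} (h : D.HasPolar P f k y) (hy : y = P.rot (2 * Real.pi * j) * y') :
    D.HasPolar P f (k + j * (D.len + 1)) y' := by
  obtain ⟨x, hx⟩ := h
  subst hy
  refine ⟨x, ?_⟩
  rw [hx, D.angle_add_mul, P.rot_add, ← mul_assoc, mul_assoc (P.rot _) (P.tri x),
    ← P.commute_rot_tri, ← mul_assoc]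

theorem HasPolar.frameClass_eq {D : CellFrame Q γ X} {P : PolarLift p} {f f' : MarkedFrame Q γ X}
    {k : ℤ} {y : 𝔾} {ε : ℤˣ} (hy : p y = reflection ε) (h : D.HasPolar P f k y)
    (h' : D.HasPolar P f' k y) : frameClass f = frameClass f' :=
  frameClass_eq_of_polar P hy h.choose_spec h'.choose_spec

/-- Along a path of marked frames the direction takes values in a finite set, so it is constant.
With a constant angle, the discrete factor of the polar decomposition is constant too. -/
theorem HasPolar.of_frameClass_eq {D : CellFrame Q γ X} {P : PolarLift p}
    {f f' : MarkedFrame Q γ X} {k : ℤ} {y : 𝔾} {ε : ℤˣ} (hy : p y = reflection ε)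
    (h : D.HasPolar P f k y) (hf : frameClass f = frameClass f') : D.HasPolar P f' k y := by
  obtain ⟨π⟩ : Joined f f' := Quotient.exact hf
  have hπ : Continuous fun t => (π t).1 := continuous_subtype_val.comp π.continuous
  obtain ⟨g, hg, hgk⟩ := Q.exists_continuous_act_eq (k := fun _ => D.base) continuous_const hπ
    (fun t => D.pt_eq (π t))
  have hdir : ∀ t, ∃ l, Dir (firstCol (p (g t))) (D.angle l) := by
    intro t
    rw [← D.marked_iff, ← hgk]
    exact (π t).2
  have hfc : Continuous fun t => firstCol (p (g t)) :=
    continuous_firstCol.comp (P.isCoveringMap.continuous.comp hg)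
  obtain ⟨x, hx⟩ := h
  have hg0 : g 0 = P.rot (D.angle k) * P.tri x * y := by
    apply Q.act_injective D.base
    rw [← hgk, ← hx]
    simp
  -- Normalizing the first column turns its direction into a continuous function with values in the
  -- finite set of unit vectors of the germs.
  let u : unitInterval → ℂ := fun t => (‖firstCol (p (g t))‖ : ℂ)⁻¹ * firstCol (p (g t))
  have hu : Continuous u := by
    refine Continuous.mul (Continuous.inv₀ (by fun_prop) fun t => ?_) hfc
    simpa using firstCol_ne_zero _
  have hu_dir : ∀ t α, Dir (firstCol (p (g t))) α ↔ u t = Complex.exp (α * Complex.I) := by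
    intro t α
    have h0 : (‖firstCol (p (g t))‖ : ℂ) ≠ 0 := by simpa using firstCol_ne_zero _
    constructor
    · rintro ⟨r, hr, h⟩
      have hn : ‖firstCol (p (g t))‖ = r := by
        rw [h, norm_mul, Complex.norm_exp_ofReal_mul_I, mul_one, Complex.norm_real,
          Real.norm_of_nonneg hr.le]
      change (‖firstCol (p (g t))‖ : ℂ)⁻¹ * firstCol (p (g t)) = _
      rw [hn] at h0 ⊢
      rw [h, inv_mul_cancel_left₀ h0]
    · intro h
      refine ⟨_, norm_pos_iff.mpr (firstCol_ne_zero (p (g t))), ?_⟩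
      rw [← h, mul_inv_cancel_left₀ h0]
  have hconst : ∀ t, u t = u 0 := fun t =>
    isPreconnected_univ.constant_of_mapsTo D.finite_directions.isDiscrete hu.continuousOn
      (T := Set.range fun l => Complex.exp (D.angle l * Complex.I)) (fun s _ => by
        obtain ⟨l, hl⟩ := hdir s
        exact ⟨l, ((hu_dir s _).mp hl).symm⟩) (Set.mem_univ _) (Set.mem_univ _)
  have hk : ∀ t, Dir (firstCol (p (g t))) (D.angle k) := by
    intro t
    rw [hu_dir, hconst, ← hu_dir, hg0]
    exact P.dir_polar hy _ _
  obtain ⟨x', hx'⟩ := P.polar_continuation (α := fun _ => D.angle k) hg continuous_const hk hy hg0 1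
  refine ⟨x', ?_⟩
  rw [← hx', ← hgk]
  simp

end CellFrame

end Cells

/-! ### The structured set of a cell -/

section StructuredCells

theorem reflection_injective : Function.Injective reflection := by
  intro ε ε' h
  exact (upper_mul_reflection_injective (x := 0) (x' := 0) (by rw [h])).2

variable {S : Type b} [TopologicalSpace S] [ChartedSpace (EuclideanHalfSpace 2) S]
  [IsManifold (𝓡∂ 2) ∞ S] {𝔾 : Type a} [Group 𝔾] [TopologicalSpace 𝔾] {p : 𝔾 →* GL (Fin 2) ℝ}

namespace CellFrame

variable {Q : GStructure.{a, b, c} p S} {Γ : Graph.{d, e}} {γ : Γ.Realization → S} {X : Γ.Cell}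

theorem angle_step_pos (D : CellFrame Q γ X) (k : ℤ) (ε : ℤˣ) :
    0 < ((ε : ℤ) : ℝ) * (D.angle (k + ε) - D.angle k) := by
  rcases Int.units_eq_one_or ε with rfl | rfl
  · have := D.strictMono_angle (show k < k + ((1 : ℤˣ) : ℤ) by simp)
    simpa using this
  · have := D.strictMono_angle (show k + ((-1 : ℤˣ) : ℤ) < k by simp)
    simpa using this

/-- A step is part of a period. Equality occurs for a single germ, which is met again after a full
turn. -/
theorem angle_step_le (D : CellFrame Q γ X) (k : ℤ) (ε : ℤˣ) :
    ((ε : ℤ) : ℝ) * (D.angle (k + ε) - D.angle k) ≤ 2 * Real.pi := by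
  rcases Int.units_eq_one_or ε with rfl | rfl
  · have := D.strictMono_angle.monotone (show k + ((1 : ℤˣ) : ℤ) ≤ k + (D.len + 1) by simp)
    rw [D.angle_add] at this
    simp only [Units.val_one, Int.cast_one, one_mul] at this ⊢
    linarith
  · have := D.strictMono_angle.monotone
      (show k ≤ k + ((-1 : ℤˣ) : ℤ) + (D.len + 1) by
        simp only [Units.val_neg, Units.val_one]; omega)
    rw [D.angle_add] at this
    simp only [Units.val_neg, Units.val_one, Int.cast_neg, Int.cast_one] at this ⊢
    linarith

/-- Among the angles on the side `ε` of the angle `k`, the one numbered `k + ε` is the first. -/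
theorem eq_or_step_lt (D : CellFrame Q γ X) {k l : ℤ} {ε : ℤˣ}
    (h : 0 < ((ε : ℤ) : ℝ) * (D.angle l - D.angle k)) : l = k + ε ∨
      ((ε : ℤ) : ℝ) * (D.angle (k + ε) - D.angle k) <
        ((ε : ℤ) : ℝ) * (D.angle l - D.angle k) := by
  rcases Int.units_eq_one_or ε with rfl | rfl
  · simp only [Units.val_one, Int.cast_one, one_mul] at h ⊢
    have h1 : k < l := D.strictMono_angle.lt_iff_lt.mp (by linarith)
    rcases (show l = k + 1 ∨ k + 1 < l by omega) with h2 | h2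
    · exact Or.inl h2
    · exact Or.inr (by linarith [D.strictMono_angle h2])
  · simp only [Units.val_neg, Units.val_one, Int.cast_neg, Int.cast_one] at h ⊢
    have h1 : l < k := D.strictMono_angle.lt_iff_lt.mp (by linarith)
    rcases (show l = k + -1 ∨ l < k + -1 by omega) with h2 | h2
    · exact Or.inl h2
    · exact Or.inr (by linarith [D.strictMono_angle h2])

theorem HasPolar.act {D : CellFrame Q γ X} {P : PolarLift p} {f f' : MarkedFrame Q γ X}
    {k : ℤ} {y x : 𝔾} (h : D.HasPolar P f k y) (hf : f'.1 = Q.act f.1 x) :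
    D.HasPolar P f' k (y * x) := by
  obtain ⟨b, hb⟩ := h
  exact ⟨b, by rw [hf, hb, ← Q.act_mul, mul_assoc _ y]⟩

variable [IsTopologicalGroup 𝔾]

/-- By unique lifting the turn is `rot`, and the angle of the first vector moves continuously to the
side `ε` of the angle numbered `k`. It stops at a germ and meets none before, so it stops at the
neighbour `k + ε`; the discrete factor does not change on the way. -/
theorem HasPolar.of_isNext {D : CellFrame Q γ X} {P : PolarLift p} {f f' : MarkedFrame Q γ X}
    {k : ℤ} {y : 𝔾} {ε : ℤˣ} (hy : p y = reflection ε) (h : D.HasPolar P f k y)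
    (hn : IsNext f f') : D.HasPolar P f' (k + ε) y := by
  obtain ⟨x, hx⟩ := h
  obtain ⟨θ, hθ, -, r, hr, hr0, hpr, hf', hno⟩ := hn
  have hcr := P.continuous_rot
  have hrt : ∀ t, r t = P.rot (θ * t) := P.lift_unique hr (by fun_prop)
    (fun t => by rw [hpr, P.map_rot]) 0 (by simp [hr0, P.rot_zero])
  obtain ⟨A, hA, hA0, hApos, hAdir⟩ := P.exists_angle_mul_rot (α := D.angle k) (x := x) hy
  have hact : ∀ t : unitInterval, Q.act f.1 (r t) =
      Q.act D.base (P.rot (D.angle k) * P.tri x * y * P.rot (θ * t)) := by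
    intro t
    rw [hx, ← Q.act_mul, hrt]
  have hsq := sign_mul_self ε
  have hno' : ∀ φ, 0 < φ → φ < θ → ∀ l, A φ ≠ D.angle l := by
    intro φ h1 h2 l hl
    have ht : φ / θ ∈ Set.Icc (0 : ℝ) 1 := ⟨by positivity, (div_le_one hθ).mpr h2.le⟩
    have hd := hAdir φ
    rw [hl] at hd
    obtain ⟨i, hi⟩ := (D.marked_iff _).mpr ⟨l, hd⟩
    refine hno ⟨φ / θ, ht⟩ ?_ ?_ i ?_
    · rw [← Subtype.coe_lt_coe]
      change (0 : ℝ) < φ / θ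
      positivity
    · rw [← Subtype.coe_lt_coe]
      exact (div_lt_one hθ).mpr h2
    · rw [hact]
      change SameDirection (Q.ρ (Q.act D.base (_ * P.rot (θ * (φ / θ))))).first _
      rwa [mul_div_cancel₀ _ hθ.ne']
  obtain ⟨l, hl⟩ : ∃ l, A θ = D.angle l := by
    have h1 := f'.2
    rw [hf', hact, D.marked_iff] at h1
    obtain ⟨l, hl⟩ := h1
    have h2 := hAdir θ
    simp only [Set.Icc.coe_one, mul_one] at hl
    obtain ⟨j, hj⟩ := hl.exists_int h2
    exact ⟨_, hj.trans (D.angle_add_mul l j).symm⟩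
  have hpos := hApos θ hθ
  rw [hl] at hpos
  have hlk : l = k + ε := by
    refine (D.eq_or_step_lt hpos).resolve_right fun hlt => ?_
    -- If the turn ended beyond the angle numbered `k + ε`, it would have met that germ before its
    -- end.
    obtain ⟨φ, ⟨h1, h2⟩, h3⟩ := intermediate_value_Ioo hθ.le
      (f := fun φ => ((ε : ℤ) : ℝ) * (A φ - D.angle k)) (by fun_prop)
      ⟨by simpa [hA0] using D.angle_step_pos k ε, by simpa only [hl] using hlt⟩
    refine hno' φ h1 h2 (k + ε) ?_
    have h4 := congrArg (((ε : ℤ) : ℝ) * ·) h3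
    simp only [← mul_assoc, hsq, one_mul] at h4
    linarith
  obtain ⟨x', hx'⟩ := P.polar_continuation (T := unitInterval)
    (g := fun t => P.rot (D.angle k) * P.tri x * y * P.rot (θ * t)) (α := fun t => A (θ * t))
    (by fun_prop) (by fun_prop) (fun t => hAdir _) hy (t₀ := 0) (x₀ := x)
    (by simp [hA0, P.rot_zero]) 1
  refine ⟨x', ?_⟩
  rw [hf', hact, hx']
  simp [hl, hlk]

/-- With trivial triangular factor, turning changes the angle linearly, so the length of the turn is
the gap between neighbouring angles. This supplies the frames on which the rotation axiom of an
induced structure can be used. -/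
theorem isNext_std (D : CellFrame Q γ X) (P : PolarLift p) (k : ℤ) {y : 𝔾} {ε : ℤˣ}
    (hy : p y = reflection ε) : IsNext (D.std P k hy 0) (D.std P (k + ε) hy 0) := by
  have hcr := P.continuous_rot
  have hsq := sign_mul_self ε
  have hact : ∀ φ, Q.act (D.std P k hy 0).1 (P.rot φ) =
      Q.act D.base (P.rot (D.angle k + ((ε : ℤ) : ℝ) * φ) * P.tri 0 * y) := by
    intro φ
    rw [std, ← Q.act_mul, mul_assoc _ y, P.mul_rot hy, P.rot_add, P.tri_zero]
    simp only [mul_one, mul_assoc]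
  refine ⟨((ε : ℤ) : ℝ) * (D.angle (k + ε) - D.angle k), D.angle_step_pos k ε,
    D.angle_step_le k ε, fun t => P.rot (((ε : ℤ) : ℝ) * (D.angle (k + ε) - D.angle k) * t),
    by fun_prop, by simp [P.rot_zero], fun t => P.map_rot _, ?_, fun t h0 h1 i hi => ?_⟩
  · rw [hact]
    simp only [Set.Icc.coe_one, mul_one, ← mul_assoc, hsq, one_mul, add_sub_cancel]
    rfl
  · rw [hact] at hi
    obtain ⟨l, hl⟩ := (D.marked_iff _).mp ⟨i, hi⟩
    obtain ⟨j, hj⟩ := hl.exists_int (P.dir_polar hy _ _)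
    rw [← D.angle_add_mul] at hj
    set l' := l + j * (D.len + 1)
    have ht0 : (0 : ℝ) < t := h0
    have ht1 : (t : ℝ) < 1 := h1
    have hst := D.angle_step_pos k ε
    have h2 : ((ε : ℤ) : ℝ) * (D.angle l' - D.angle k) =
        ((ε : ℤ) : ℝ) * (D.angle (k + ε) - D.angle k) * t := by
      rw [← hj]
      linear_combination (((ε : ℤ) : ℝ) * (D.angle (k + ε) - D.angle k) * t) * hsq
    have h3 := mul_pos hst ht0
    have h4 := mul_lt_mul_of_pos_left ht1 hst
    rw [mul_one] at h4
    rw [← h2] at h3 h4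
    rcases D.eq_or_step_lt h3 with h5 | h5
    · rw [h5] at h4
      exact lt_irrefl _ h4
    · exact lt_asymm h4 h5

variable (D : CellFrame Q γ X) (P : PolarLift p)

/-- The class of marked frames that an automorphism of `[n]` makes from the base point. -/
def frameMap (u : (⟨D.len⟩ : DeltaG p) ≅ ⟨D.len⟩) : FrameClass Q γ X :=
  Quotient.liftOn u.hom (fun w => frameClass (D.std P (w.toFun 0) w.map_elt 0)) (by
    intro w w' h
    obtain ⟨j, hj, he⟩ := (DeltaG.preHom_rel_iff P).mp h
    have h1 : D.HasPolar P (D.std P (w.toFun 0) w.map_elt 0) (w.toFun 0) w.elt :=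
      D.hasPolar_std P _ _ _
    have h2 := h1.shift he
    rw [show w.toFun 0 + j * (D.len + 1) = w'.toFun 0 from (hj 0).symm] at h2
    exact h2.frameClass_eq w'.map_elt (D.hasPolar_std P _ _ _))

theorem frameMap_affine {f : MarkedFrame Q γ X} {k : ℤ} {y : 𝔾} {ε : ℤˣ}
    (hy : p y = reflection ε) (h : D.HasPolar P f k y) :
    D.frameMap P (DeltaG.affine D.len k ε y hy) = frameClass f := by
  change frameClass (D.std P (k + ε * 0) hy 0) = _
  rw [mul_zero, add_zero]
  exact (D.hasPolar_std P k hy 0).frameClass_eq hy h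

/-- Injectivity holds because the ambiguity of the coordinates `(k, y)` of a class is the relation
that defines morphisms of `ΔG`; surjectivity is the existence of the polar decomposition. -/
theorem frameMap_bijective : Function.Bijective (D.frameMap P) := by
  constructor
  · intro u u' h
    obtain ⟨k, ε, y, hy, rfl⟩ := DeltaG.exists_eq_affine u
    obtain ⟨k', ε', y', hy', rfl⟩ := DeltaG.exists_eq_affine u'
    rw [D.frameMap_affine P hy (D.hasPolar_std P k hy 0),
      D.frameMap_affine P hy' (D.hasPolar_std P k' hy' 0)] at h
    obtain ⟨j, hj, he⟩ := ((D.hasPolar_std P k hy 0).of_frameClass_eq hy h).exists_int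
      (D.hasPolar_std P k' hy' 0) hy hy'
    -- Full turns lie in the kernel of `p`, so the parity is not affected by the ambiguity.
    have hε : ε = ε' := reflection_injective (by
      rw [← hy, ← hy', he, map_mul, P.map_rot, PolarLift.rotation_two_pi_mul, one_mul])
    subst hε
    ext
    refine Quotient.sound ((DeltaG.preHom_rel_iff P).mpr ⟨j, fun l => ?_, he⟩)
    change k' + ε * l = k + ε * l + j * (D.len + 1)
    rw [hj]
    ring
  · intro o
    obtain ⟨f, rfl⟩ := Quotient.exists_rep o
    obtain ⟨k, ε, y, hy, h⟩ := D.exists_hasPolar P f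
    exact ⟨_, D.frameMap_affine P hy h⟩

/-- The torsor of classes of marked frames, trivialized. -/
def frameEquiv : ((⟨D.len⟩ : DeltaG p) ≅ ⟨D.len⟩) ≃ FrameClass Q γ X :=
  Equiv.ofBijective _ (D.frameMap_bijective P)

theorem frameEquiv_symm {f : MarkedFrame Q γ X} {k : ℤ} {y : 𝔾} {ε : ℤˣ}
    (hy : p y = reflection ε) (h : D.HasPolar P f k y) :
    (D.frameEquiv P).symm (frameClass f) = DeltaG.affine D.len k ε y hy := by
  rw [Equiv.symm_apply_eq]
  exact (D.frameMap_affine P hy h).symm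

/-- The structured set of the germs leaving a cell. -/
def structuredSet : StructuredSet.{a, d, c} p where
  carrier := Γ.star X
  len := D.len
  Frame := FrameClass Q γ X
  frame_nonempty := ⟨D.frameEquiv P (Iso.refl _)⟩
  -- In the convention that the product `x y` is `x ∘ y`, this is right translation by `u`.
  act o u := D.frameEquiv P (u ≪≫ (D.frameEquiv P).symm o)
  act_refl o := by simp
  act_trans o u v := by simp
  existsUnique_act o o' := by
    refine ⟨(D.frameEquiv P).symm o' ≪≫ ((D.frameEquiv P).symm o).symm, ?_, fun u hu => ?_⟩
    · simp
    · rw [← hu]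
      simp
  label o :=
    { toFun := fun i => D.label (DeltaG.vertexMap ((D.frameEquiv P).symm o).hom i)
      invFun := fun i => DeltaG.vertexMap ((D.frameEquiv P).symm o).inv (D.label.symm i)
      left_inv := fun i => by
        beta_reduce
        rw [Equiv.symm_apply_apply, ← DeltaG.vertexMap_comp, Iso.hom_inv_id, DeltaG.vertexMap_id]
      right_inv := fun i => by
        beta_reduce
        rw [← DeltaG.vertexMap_comp, Iso.inv_hom_id, DeltaG.vertexMap_id,
          Equiv.apply_symm_apply] }
  label_act o u i := by
    simp only [Equiv.symm_apply_apply, Equiv.coe_fn_mk, Iso.trans_hom]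
    rw [DeltaG.vertexMap_comp]

theorem structuredSet_act {f f' : MarkedFrame Q γ X} {k k' : ℤ} {y y' : 𝔾} {ε ε' : ℤˣ}
    (hy : p y = reflection ε) (hy' : p y' = reflection ε') (h : D.HasPolar P f k y)
    (h' : D.HasPolar P f' (k + ε * k') (y * y')) :
    (D.structuredSet P).act (frameClass f) (DeltaG.affine D.len k' ε' y' hy') = frameClass f' := by
  change D.frameEquiv P (_ ≪≫ (D.frameEquiv P).symm (frameClass f)) = _
  rw [D.frameEquiv_symm P hy h, DeltaG.affine_trans]
  exact D.frameMap_affine P _ h'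

theorem structuredSet_label {f : MarkedFrame Q γ X} {k : ℤ} {y : 𝔾} {ε : ℤˣ}
    (hy : p y = reflection ε) (h : D.HasPolar P f k y) (i : Fin (D.len + 1)) :
    (D.structuredSet P).label (frameClass f) i = D.lab (k + ε * (i : ℕ)) := by
  change D.label (DeltaG.vertexMap ((D.frameEquiv P).symm (frameClass f)).hom i) = _
  rw [D.frameEquiv_symm P hy h, DeltaG.vertexMap_affine]
  rfl

end CellFrame

end StructuredCells

/-! ### Uniqueness of transport -/

theorem Dir.arg_eq {w : ℂ} {α : ℝ} (h : Dir w α) (h1 : -Real.pi < α) (h2 : α ≤ Real.pi) :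
    w.arg = α := by
  obtain ⟨j, hj⟩ := h.exists_int (dir_arg h.ne_zero)
  have h3 := Complex.neg_pi_lt_arg w
  have h4 := Complex.arg_le_pi w
  have hpi := Real.pi_pos
  have h5 : (j : ℝ) < 1 := by nlinarith
  have h6 : (-1 : ℝ) < j := by nlinarith
  have h7 : j < 1 := by exact_mod_cast h5
  have h8 : -1 < j := by exact_mod_cast h6
  have h9 : j = 0 := by omega
  rw [hj, h9]
  simp

theorem mem_slitPlane_of_not_dir {w : ℂ} (h0 : w ≠ 0) (h : ¬ Dir w Real.pi) :
    w ∈ Complex.slitPlane := by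
  rw [Complex.mem_slitPlane_iff_arg]
  refine ⟨fun h1 => h ?_, h0⟩
  rw [← h1]
  exact dir_arg h0

theorem dir_one : Dir 1 0 := ⟨1, one_pos, by simp⟩

theorem dir_neg_one : Dir (-1) Real.pi := ⟨1, one_pos, by simp⟩

section Transport

variable {S : Type b} [TopologicalSpace S] [ChartedSpace (EuclideanHalfSpace 2) S]

theorem Graph.eq_or_eq_of_mem_edgeOf {Γ : Graph.{d, e}} {h h' : Γ.H}
    (hh : h' ∈ (Γ.edgeOf h).1) : h' = h ∨ h' = Γ.τ h := Sym2.mem_iff.mp hh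

theorem SameDirection.neg {u w : TangentBundle (𝓡∂ 2) S} (h : SameDirection u w) :
    SameDirection (⟨u.proj, -u.snd⟩ : TangentBundle (𝓡∂ 2) S) ⟨w.proj, -w.snd⟩ := by
  obtain ⟨r, hr, rfl⟩ := h
  exact sameDirection_mk_iff.mpr ⟨r, hr, by rw [smul_neg]⟩

variable [IsManifold (𝓡∂ 2) ∞ S] {𝔾 : Type a} [Group 𝔾] [TopologicalSpace 𝔾]
  {p : 𝔾 →* GL (Fin 2) ℝ} {Q : GStructure.{a, b, c} p S} {Γ : Graph.{d, e}}
  {γ : Γ.Realization → S}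

/-- A frame along the velocity at the midpoint sees the germ of the half-edge at the angle `π`. -/
theorem sameDirection_midpointGerm_iff {h : Γ.H} {f : Q.F}
    (hf : SameDirection (Q.ρ f).first (velocity γ h 1)) (x : 𝔾) :
    SameDirection (Q.ρ (Q.act f x)).first (midpointGerm γ h) ↔
      Dir (firstCol (p x)) Real.pi := by
  have h1 : SameDirection (⟨(Q.ρ f).pt, (Q.ρ f).comb (-1)⟩ : TangentBundle (𝓡∂ 2) S)
      (midpointGerm γ h) := by
    rw [Frame.first_eq] at hf
    have := hf.neg
    rwa [← map_neg] at this
  rw [← (Q.ρ f).sameDirection_comb_iff dir_neg_one, Q.first_act]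
  exact ⟨fun h2 => h2.trans h1.symm, fun h2 => h2.trans h1⟩

theorem dir_zero_of_sameDirection {f : Q.F} {x : 𝔾} {u : TangentBundle (𝓡∂ 2) S}
    (h : SameDirection (Q.ρ f).first u) (h' : SameDirection (Q.ρ (Q.act f x)).first u) :
    Dir (firstCol (p x)) 0 := by
  rw [← (Q.ρ f).sameDirection_comb_iff dir_one, ← Q.first_act, ← Frame.first_eq]
  exact h'.trans h.symm

/-- Transport along `h` ends at a frame along `τ h`. -/
theorem sameDirection_germ_tau {h : Γ.H} (f : MarkedFrame Q γ (.edge (Γ.edgeOf h)))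
    (hf : ¬ SameDirection (Q.ρ f.1).first (midpointGerm γ h)) :
    SameDirection (Q.ρ f.1).first (midpointGerm γ (Γ.τ h)) := by
  obtain ⟨f, ⟨h', hh'⟩, hi⟩ := f
  rcases Graph.eq_or_eq_of_mem_edgeOf hh' with rfl | rfl
  · exact absurd hi hf
  · exact hi

theorem IsTransport.sameDirection_fst {h : Γ.H} {f : MarkedFrame Q γ (.vert (Γ.src h))}
    {f' : MarkedFrame Q γ (.edge (Γ.edgeOf h))} (ht : IsTransport h f f') :
    SameDirection (Q.ρ f.1).first (velocity γ h 0) := by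
  obtain ⟨k, k', -, -, h0, hk, -⟩ := ht
  rw [← h0]
  exact hk 0

theorem IsTransport.sameDirection_snd {h : Γ.H} {f : MarkedFrame Q γ (.vert (Γ.src h))}
    {f' : MarkedFrame Q γ (.edge (Γ.edgeOf h))} (ht : IsTransport h f f') :
    SameDirection (Q.ρ f'.1).first (midpointGerm γ (Γ.τ h)) := by
  obtain ⟨k, k', -, -, -, -, -, hk', h1⟩ := ht
  refine sameDirection_germ_tau f' ?_
  rw [← h1]
  exact (hk' 1).2

/-- Seen from a frame along the velocity, the germ of `h` has the angle `π`. Avoiding it keeps the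
first column in the slit plane, where the principal argument is a continuous choice of angle. -/
theorem continuous_arg_firstCol (P : PolarLift p) {g : unitInterval → 𝔾} (hg : Continuous g)
    (h : ∀ t, ¬ Dir (firstCol (p (g t))) Real.pi) :
    Continuous fun t => (firstCol (p (g t))).arg := by
  refine continuous_iff_continuousAt.mpr fun t => ?_
  refine (Complex.continuousAt_arg (mem_slitPlane_of_not_dir (firstCol_ne_zero _) (h t))).comp_of_eq
    (Continuous.continuousAt ?_) rfl
  exact continuous_firstCol.comp (P.isCoveringMap.continuous.comp hg)

variable [IsTopologicalGroup 𝔾]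

/-- Transport along a half-edge is unique up to the action of `p⁻¹(O(1))`. -/
theorem IsTransport.unique (P : PolarLift p) {h : Γ.H}
    {f₁ f₂ : MarkedFrame Q γ (.vert (Γ.src h))} {f₁' f₂' : MarkedFrame Q γ (.edge (Γ.edgeOf h))}
    (ht₁ : IsTransport h f₁ f₁') (ht₂ : IsTransport h f₂ f₂') :
    ∃ ε x, p x = reflection ε ∧
      (∀ f : MarkedFrame Q γ (.vert (Γ.src h)), f.1 = Q.act f₁.1 x →
        frameClass f = frameClass f₂) ∧
      ∀ f' : MarkedFrame Q γ (.edge (Γ.edgeOf h)), f'.1 = Q.act f₁'.1 x →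
        frameClass f' = frameClass f₂' := by
  have hs₁ := ht₁.sameDirection_snd
  have hs₂ := ht₂.sameDirection_snd
  obtain ⟨k₁, k₁', hk₁, hk₁', h₁0, hd₁, h₁1, hd₁', h₁e⟩ := ht₁
  obtain ⟨k₂, k₂', hk₂, hk₂', h₂0, hd₂, h₂1, hd₂', h₂e⟩ := ht₂
  -- On the half-edge the two lifts differ by elements of angle `0`. Their discrete factor is
  -- constant, and it is the required element `y`.
  obtain ⟨g, hg, hgk⟩ := Q.exists_continuous_act_eq hk₁ hk₂
    (fun t => (hd₂ t).proj_eq.trans (hd₁ t).proj_eq.symm)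
  have hg0 : ∀ t, Dir (firstCol (p (g t))) 0 := fun t =>
    dir_zero_of_sameDirection (hd₁ t) (by rw [← hgk]; exact hd₂ t)
  obtain ⟨x₀, ε, y, hy, hx₀⟩ := P.exists_polar (hg0 0)
  obtain ⟨x₁, hx₁⟩ := P.polar_continuation hg (continuous_const (y := (0 : ℝ))) hg0 hy hx₀ 1
  have hmid : SameDirection (Q.ρ (k₁ 1)).first (velocity γ h 1) := hd₁ 1
  have hpt : γ (Γ.point (.edge (Γ.edgeOf h))) = (Q.ρ (k₁ 1)).pt := by
    rw [← halfEdgePath_one γ h]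
    exact hmid.proj_eq.symm
  -- At the midpoint both motions are measured from the same point `k₁ 1`: one starts at `1`, the
  -- other at an element with discrete factor `y`.
  obtain ⟨g₁, hg₁, hgk₁⟩ := Q.exists_continuous_act_eq (k := fun _ => k₁ 1) continuous_const hk₁'
    (fun t => (hd₁' t).1.trans hpt)
  obtain ⟨g₂, hg₂, hgk₂⟩ := Q.exists_continuous_act_eq (k := fun _ => k₁ 1) continuous_const hk₂'
    (fun t => (hd₂' t).1.trans hpt)
  have hn₁ : ∀ t, ¬ Dir (firstCol (p (g₁ t))) Real.pi := fun t => by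
    rw [← sameDirection_midpointGerm_iff hmid, ← hgk₁]
    exact (hd₁' t).2
  have hn₂ : ∀ t, ¬ Dir (firstCol (p (g₂ t))) Real.pi := fun t => by
    rw [← sameDirection_midpointGerm_iff hmid, ← hgk₂]
    exact (hd₂' t).2
  have hg₁0 : g₁ 0 = 1 := by
    apply Q.act_injective (k₁ 1)
    rw [← hgk₁, h₁1, Q.act_one]
  have hg₂0 : g₂ 0 = P.rot 0 * P.tri x₁ * y := by
    apply Q.act_injective (k₁ 1)
    rw [← hgk₂, h₂1, hgk, hx₁]
  have hpi := Real.pi_pos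
  have harg₂ : (firstCol (p (g₂ 0))).arg = 0 := by
    refine Dir.arg_eq ?_ (by linarith) hpi.le
    rw [hg₂0]
    exact P.dir_polar hy _ _
  obtain ⟨b₁, hb₁⟩ := P.polar_continuation hg₁ (continuous_arg_firstCol P hg₁ hn₁)
    (fun t => dir_arg (firstCol_ne_zero _)) (map_one_eq_reflection p) (t₀ := 0) (x₀ := 0)
    (by simp [hg₁0, firstCol_one, P.rot_zero, P.tri_zero]) 1
  obtain ⟨b₂, hb₂⟩ := P.polar_continuation hg₂ (continuous_arg_firstCol P hg₂ hn₂)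
    (fun t => dir_arg (firstCol_ne_zero _)) hy (t₀ := 0) (x₀ := x₁) (by rw [harg₂, hg₂0]) 1
  -- Both motions end along `τ h`, so the principal arguments agree, and not only up to full turns.
  have harg : (firstCol (p (g₁ 1))).arg = (firstCol (p (g₂ 1))).arg := by
    rw [← h₁e, hgk₁, Q.first_act] at hs₁
    rw [← h₂e, hgk₂, Q.first_act] at hs₂
    have h1 := hs₁.trans hs₂.symm
    rw [Frame.sameDirection_comb_iff _ (dir_arg (firstCol_ne_zero (p (g₂ 1))))] at h1
    exact h1.arg_eq (Complex.neg_pi_lt_arg _) (Complex.arg_le_pi _)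
  refine ⟨ε, y, hy, fun f hf => ?_, fun f' hf' => ?_⟩
  · refine frameClass_eq_of_polar P (f₀ := f₁.1) (α := 0) (x := 0) (x' := x₀) hy ?_ ?_
    · rw [hf, P.rot_zero, P.tri_zero, one_mul, one_mul]
    · rw [← h₂0, hgk, hx₀, h₁0]
  · refine frameClass_eq_of_polar P (f₀ := k₁ 1) (α := (firstCol (p (g₂ 1))).arg) (x := b₁)
      (x' := b₂) hy ?_ ?_
    · rw [hf', ← h₁e, hgk₁, ← Q.act_mul, ← harg]
      rw [mul_one] at hb₁
      rw [← hb₁]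
    · rw [← h₂e, hgk₂, ← hb₂]

end Transport

/-! ### Existence of transport -/

section TransportExistence

variable {S : Type b} [TopologicalSpace S] [ChartedSpace (EuclideanHalfSpace 2) S]

/-- A vanishing determinant gives two linear relations with coefficients among the entries;
independence makes `u` zero, which contradicts independence. -/
theorem det_ne_zero_of_linearIndependent {u w : EuclideanSpace ℝ (Fin 2)}
    (h : LinearIndependent ℝ ![u, w]) : u 0 * w 1 - u 1 * w 0 ≠ 0 := by
  intro h0
  rw [LinearIndependent.pair_iff] at h
  have h1 := h (w 1) (-(u 1)) (by
    ext i; fin_cases i <;> simp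
    · linarith
    · ring)
  have h2 := h (w 0) (-(u 0)) (by
    ext i; fin_cases i <;> simp
    · ring
    · linarith)
  have h3 := h 1 0 (by
    ext i; fin_cases i <;> simp
    · linarith [h2.2]
    · linarith [h1.2])
  exact one_ne_zero h3.1

variable [IsManifold (𝓡∂ 2) ∞ S]

/-- The coordinates of a continuous family of tangent vectors in a continuous family of frames are
continuous. -/
theorem continuous_coords {T : Type*} [TopologicalSpace T] {E : T → Frame S}
    {v : T → TangentBundle (𝓡∂ 2) S} {z : T → ℂ} (hE : Continuous E)
    (hv : letI : IsManifold (𝓡∂ 2) 1 S := isManifold_one; Continuous v)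
    (h : ∀ t, v t = ⟨(E t).pt, (E t).comb (z t)⟩) : Continuous z := by
  have : IsManifold (𝓡∂ 2) 1 S := isManifold_one
  refine continuous_iff_continuousAt.mpr fun t₀ => ?_
  let e := trivializationAt (EuclideanSpace ℝ (Fin 2)) (TangentSpace (𝓡∂ 2)) (E t₀).pt
  have hfs : Continuous fun t => ((E t).first, (E t).second) :=
    Frame.continuous_first_second.comp hE
  have hf : Continuous fun t => (E t).first := continuous_fst.comp hfs
  have hs : Continuous fun t => (E t).second := continuous_snd.comp hfs
  have hpt : Continuous fun t => (E t).pt := Frame.continuous_pt.comp hE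
  have hbase : ∀ᶠ t in 𝓝 t₀, (E t).pt ∈ e.baseSet :=
    hpt.continuousAt.eventually (e.open_baseSet.mem_nhds
      (FiberBundle.mem_baseSet_trivializationAt' _))
  have hcont : ∀ {u : T → TangentBundle (𝓡∂ 2) S}, Continuous u →
      (∀ t, (u t).proj = (E t).pt) → ContinuousAt (fun t => (e (u t)).2) t₀ := by
    intro u hu hp
    have hmem : u t₀ ∈ e.source := by
      rw [e.mem_source, hp]
      exact FiberBundle.mem_baseSet_trivializationAt' _
    exact continuous_snd.continuousAt.comp
      ((e.continuousOn.continuousAt (e.open_source.mem_nhds hmem)).comp hu.continuousAt)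
  have ha := hcont hf fun t => rfl
  have hb := hcont hs fun t => rfl
  have hw := hcont hv fun t => by rw [h]
  have hcoord : ∀ {u : T → EuclideanSpace ℝ (Fin 2)} (i : Fin 2), ContinuousAt u t₀ →
      ContinuousAt (fun t => u t i) t₀ := by
    intro u i hu
    exact (EuclideanSpace.proj (𝕜 := ℝ) i).continuous.continuousAt.comp hu
  have hlin : ∀ᶠ t in 𝓝 t₀, (e (v t)).2 = (z t).re • (e (E t).first).2 +
      (z t).im • (e (E t).second).2 ∧
      LinearIndependent ℝ ![(e (E t).first).2, (e (E t).second).2] := by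
    filter_upwards [hbase] with t ht
    let L := e.continuousLinearEquivAt ℝ (E t).pt ht
    have hL : ∀ w : TangentSpace (𝓡∂ 2) (E t).pt, (e ⟨(E t).pt, w⟩).2 = L w := fun w => rfl
    constructor
    · rw [h t, hL, Frame.comb_apply, map_add, map_smul, map_smul]
      rfl
    · have h1 := (E t).linearIndependent.map' L.toLinearMap
        (LinearMap.ker_eq_bot.mpr L.injective)
      have h2 : ![(e (E t).first).2, (e (E t).second).2] = L ∘ (E t).vec := by
        funext i
        fin_cases i <;> rfl
      rw [h2]
      exact h1
  have hdet : (e (E t₀).first).2 0 * (e (E t₀).second).2 1 -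
      (e (E t₀).first).2 1 * (e (E t₀).second).2 0 ≠ 0 :=
    det_ne_zero_of_linearIndependent hlin.self_of_nhds.2
  -- In a trivialization of the tangent bundle the coordinates are given by Cramer's rule, with
  -- nonzero denominator.
  have hre : ContinuousAt (fun t => (z t).re) t₀ := by
    have hc : ContinuousAt (fun t => ((e (v t)).2 0 * (e (E t).second).2 1 -
        (e (v t)).2 1 * (e (E t).second).2 0) / ((e (E t).first).2 0 * (e (E t).second).2 1 -
      (e (E t).first).2 1 * (e (E t).second).2 0)) t₀ :=
      (((hcoord 0 hw).mul (hcoord 1 hb)).sub ((hcoord 1 hw).mul (hcoord 0 hb))).div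
        (((hcoord 0 ha).mul (hcoord 1 hb)).sub ((hcoord 1 ha).mul (hcoord 0 hb))) hdet
    refine hc.congr ?_
    filter_upwards [hlin] with t ht
    rw [div_eq_iff (det_ne_zero_of_linearIndependent ht.2), ht.1]
    simp only [PiLp.add_apply, PiLp.smul_apply, smul_eq_mul]
    ring
  have him : ContinuousAt (fun t => (z t).im) t₀ := by
    have hc : ContinuousAt (fun t => ((e (E t).first).2 0 * (e (v t)).2 1 -
        (e (E t).first).2 1 * (e (v t)).2 0) / ((e (E t).first).2 0 * (e (E t).second).2 1 -
      (e (E t).first).2 1 * (e (E t).second).2 0)) t₀ :=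
      (((hcoord 0 ha).mul (hcoord 1 hw)).sub ((hcoord 1 ha).mul (hcoord 0 hw))).div
        (((hcoord 0 ha).mul (hcoord 1 hb)).sub ((hcoord 1 ha).mul (hcoord 0 hb))) hdet
    refine hc.congr ?_
    filter_upwards [hlin] with t ht
    rw [div_eq_iff (det_ne_zero_of_linearIndependent ht.2), ht.1]
    simp only [PiLp.add_apply, PiLp.smul_apply, smul_eq_mul]
    ring
  have hz : z = fun t => ((z t).re : ℂ) + (z t).im * Complex.I := by
    funext t
    exact (Complex.re_add_im _).symm
  rw [hz]
  exact (Complex.continuous_ofReal.continuousAt.comp hre).add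
    ((Complex.continuous_ofReal.continuousAt.comp him).mul continuousAt_const)

/-- The velocity is the tangent map of the path within `[0, 1]`, applied to the unit vector field,
and the tangent map of a smooth path is continuous. -/
theorem continuous_velocity {Γ : Graph.{d, e}} {γ : Γ.Realization → S} (hγ : IsEmbedded γ)
    (h : Γ.H) : letI : IsManifold (𝓡∂ 2) 1 S := isManifold_one
    Continuous fun t : unitInterval => velocity γ h t := by
  have : IsManifold (𝓡∂ 2) 1 S := isManifold_one
  have h1 := (hγ.smooth h).continuousOn_tangentMapWithin (by exact_mod_cast le_top)
    (uniqueMDiffOn_iff_uniqueDiffOn.mpr (uniqueDiffOn_Icc (zero_lt_one (α := ℝ))))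
  have h2 : Continuous fun t : unitInterval =>
      ((tangentBundleModelSpaceHomeomorph 𝓘(ℝ, ℝ)).symm ((t : ℝ), (1 : ℝ)) :
        TangentBundle 𝓘(ℝ, ℝ) ℝ) := by
    refine (tangentBundleModelSpaceHomeomorph 𝓘(ℝ, ℝ)).symm.continuous.comp ?_
    exact Continuous.prodMk continuous_subtype_val continuous_const
  exact h1.comp_continuous h2 fun t => t.2

variable {𝔾 : Type a} [Group 𝔾] [TopologicalSpace 𝔾]
  {p : 𝔾 →* GL (Fin 2) ℝ} (Q : GStructure.{a, b, c} p S)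

/-- Locally, a nonvanishing family of tangent vectors lifts to `F`. -/
theorem exists_local_lift (P : PolarLift p) {T : Type*} [TopologicalSpace T]
    {v : T → TangentBundle (𝓡∂ 2) S}
    (hv : letI : IsManifold (𝓡∂ 2) 1 S := isManifold_one; Continuous v)
    (hv0 : ∀ t, (v t).snd ≠ 0) (t₀ : T) :
    ∃ k : T → Q.F, ∀ᶠ t in 𝓝 t₀, ContinuousAt k t ∧ SameDirection (Q.ρ (k t)).first (v t) := by
  classical
  have : IsManifold (𝓡∂ 2) 1 S := isManifold_one
  obtain ⟨U, hU, hy, σ, -, hσ, -, hσpt, -, -⟩ := Q.exists_triv (v t₀).proj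
  have hvp : Continuous fun t => (v t).proj :=
    (FiberBundle.continuous_proj (EuclideanSpace ℝ (Fin 2))
      (TangentSpace (𝓡∂ 2) : S → Type _)).comp hv
  have hV : IsOpen {t | (v t).proj ∈ U} := hU.preimage hvp
  let E : {t // (v t).proj ∈ U} → Q.F := fun t => σ ⟨_, t.2⟩
  have hE : Continuous E :=
    hσ.comp (Continuous.subtype_mk (hvp.comp continuous_subtype_val) _)
  choose z hz0 hz using fun t : {t // (v t).proj ∈ U} =>
    (Q.ρ (E t)).exists_comb_eq (u := v t.1)
      (hσpt ⟨(v t.1).proj, t.2⟩).symm (hv0 t.1)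
  have hzc : Continuous z := continuous_coords (Q.continuous_ρ.comp hE)
    (hv.comp continuous_subtype_val) hz
  -- Angles are measured from the one at `t₀`. This moves the branch cut away, so the angle is
  -- continuous near `t₀`.
  let θ₀ : ℝ := (z ⟨t₀, hy⟩).arg
  let u : {t // (v t).proj ∈ U} → ℂ := fun t => Complex.exp (((-θ₀ : ℝ) : ℂ) * Complex.I) * z t
  have huc : Continuous u := continuous_const.mul hzc
  have hu0 : u ⟨t₀, hy⟩ ∈ Complex.slitPlane := by
    have h1 := (dir_arg (hz0 ⟨t₀, hy⟩)).mul_exp (-θ₀)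
    rw [show -θ₀ + (z ⟨t₀, hy⟩).arg = 0 from neg_add_cancel _] at h1
    obtain ⟨r, hr, h2⟩ := h1
    change Complex.exp _ * _ ∈ _
    rw [h2]
    simpa using hr
  let A : {t // (v t).proj ∈ U} → ℝ := fun t => θ₀ + (u t).arg
  have hA : ∀ t, Dir (z t) (A t) := by
    intro t
    have h1 := (dir_arg (mul_ne_zero (Complex.exp_ne_zero (((-θ₀ : ℝ) : ℂ) * Complex.I))
      (hz0 t))).mul_exp θ₀
    rw [← mul_assoc, ← Complex.exp_add, ← add_mul, ← Complex.ofReal_add, add_neg_cancel,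
      Complex.ofReal_zero, zero_mul, Complex.exp_zero, one_mul] at h1
    exact h1
  let k' : {t // (v t).proj ∈ U} → Q.F := fun t => Q.act (E t) (P.rot (A t))
  have hk'd : ∀ t, SameDirection (Q.ρ (k' t)).first (v t.1) := by
    intro t
    rw [hz t, Q.first_act, Frame.sameDirection_comb_iff _ (hA t), P.map_rot, firstCol_rotation]
    exact ⟨1, one_pos, by simp⟩
  have hk'c : ∀ t, u t ∈ Complex.slitPlane → ContinuousAt k' t := by
    intro t ht
    refine Q.continuous_act.continuousAt.comp (ContinuousAt.prodMk hE.continuousAt ?_)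
    refine P.continuous_rot.continuousAt.comp (continuousAt_const.add ?_)
    exact (Complex.continuousAt_arg ht).comp huc.continuousAt
  refine ⟨fun t => if ht : (v t).proj ∈ U then k' ⟨t, ht⟩ else E ⟨t₀, hy⟩, ?_⟩
  have hev : ∀ᶠ t : {t // (v t).proj ∈ U} in 𝓝 ⟨t₀, hy⟩, u t ∈ Complex.slitPlane :=
    huc.continuousAt.eventually (Complex.isOpen_slitPlane.mem_nhds hu0)
  have hemb := hV.isOpenEmbedding_subtypeVal
  have hmap : Filter.map (Subtype.val : {t // (v t).proj ∈ U} → T) (𝓝 ⟨t₀, hy⟩) = 𝓝 t₀ :=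
    hemb.map_nhds_eq ⟨t₀, hy⟩
  rw [← hmap, Filter.eventually_map]
  filter_upwards [hev] with t ht
  constructor
  · refine hemb.continuousAt_iff.mp ?_
    have hres : ((fun t => if ht : (v t).proj ∈ U then k' ⟨t, ht⟩ else E ⟨t₀, hy⟩) ∘
        (Subtype.val : {t // (v t).proj ∈ U} → T)) = k' := funext fun s => dif_pos s.2
    have h2 := hk'c t ht
    rw [← hres] at h2
    exact h2
  · rw [dif_pos t.2]
    exact hk'd t

/-- A nonvanishing family of tangent vectors along the interval lifts to `F`. -/
theorem exists_lift (P : PolarLift p) {v : unitInterval → TangentBundle (𝓡∂ 2) S}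
    (hv : letI : IsManifold (𝓡∂ 2) 1 S := isManifold_one; Continuous v)
    (hv0 : ∀ t, (v t).snd ≠ 0) :
    ∃ k : unitInterval → Q.F, Continuous k ∧ ∀ t, SameDirection (Q.ρ (k t)).first (v t) := by
  choose k hk using exists_local_lift Q P hv hv0
  let V : unitInterval → Set unitInterval := fun t₀ =>
    interior {t | ContinuousAt (k t₀) t ∧ SameDirection (Q.ρ (k t₀ t)).first (v t)}
  have hVsub : ∀ t₀, V t₀ ⊆ {t | ContinuousAt (k t₀) t ∧
      SameDirection (Q.ρ (k t₀ t)).first (v t)} := fun t₀ => interior_subset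
  -- Compactness gives a subdivision with a local lift on each piece; the pieces are joined one
  -- after the other.
  obtain ⟨τ, hτ0, hτm, ⟨N, hN⟩, hτV⟩ := exists_monotone_Icc_subset_open_cover_unitInterval
    (c := V) (fun _ => isOpen_interior) (fun t _ => Set.mem_iUnion.mpr
      ⟨t, mem_interior_iff_mem_nhds.mpr (hk t)⟩)
  have key : ∀ n, ∃ K : unitInterval → Q.F, ContinuousOn K (Set.Icc 0 (τ n)) ∧
      ∀ t ∈ Set.Icc 0 (τ n), SameDirection (Q.ρ (K t)).first (v t) := by
    intro n
    induction n with
    | zero =>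
      rw [hτ0, Set.Icc_self]
      refine ⟨k 0, continuousOn_singleton _ _, ?_⟩
      rintro t rfl
      exact (hVsub 0 (mem_interior_iff_mem_nhds.mpr (hk 0))).2
    | succ n ih =>
      obtain ⟨K, hKc, hKd⟩ := ih
      obtain ⟨i, hi⟩ := hτV n
      have hle : τ n ≤ τ (n + 1) := hτm (Nat.le_succ n)
      have hn : τ n ∈ Set.Icc 0 (τ n) := ⟨unitInterval.nonneg', le_rfl⟩
      have hi_n := hVsub i (hi ⟨le_rfl, hle⟩)
      -- The next local lift is translated by a constant `y` to fit the lift built so far. Both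
      -- point along `v` at the junction, so `y` has angle `0` and the translate still points along
      -- `v`.
      obtain ⟨y, hy⟩ := Q.exists_act_eq (f := k i (τ n)) (f' := K (τ n))
        ((hKd _ hn).proj_eq.trans hi_n.2.proj_eq.symm)
      have hyd : Dir (firstCol (p y)) 0 :=
        dir_zero_of_sameDirection hi_n.2 (by rw [← hy]; exact hKd _ hn)
      have hunion : Set.Icc 0 (τ (n + 1)) = Set.Icc 0 (τ n) ∪ Set.Icc (τ n) (τ (n + 1)) :=
        (Set.Icc_union_Icc_eq_Icc unitInterval.nonneg' hle).symm
      have e1 : Set.EqOn (fun t => if t ≤ τ n then K t else Q.act (k i t) y) K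
          (Set.Icc 0 (τ n)) := fun t ht => if_pos ht.2
      have e2 : Set.EqOn (fun t => if t ≤ τ n then K t else Q.act (k i t) y)
          (fun t => Q.act (k i t) y) (Set.Icc (τ n) (τ (n + 1))) := by
        intro t ht
        rcases ht.1.eq_or_lt with h | h
        · subst h
          simp [hy]
        · exact if_neg (not_le.mpr h)
      refine ⟨fun t => if t ≤ τ n then K t else Q.act (k i t) y, ?_, ?_⟩
      · rw [hunion]
        refine ContinuousOn.union_of_isClosed (hKc.congr e1) (ContinuousOn.congr ?_ e2)
          isClosed_Icc isClosed_Icc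
        intro t ht
        exact (Q.continuous_act.continuousAt.comp
          ((hVsub i (hi ht)).1.prodMk continuousAt_const)).continuousWithinAt
      · rw [hunion]
        rintro t (ht | ht)
        · have := hKd t ht
          rwa [← e1 ht] at this
        · have h1 := e2 ht
          simp only at h1 ⊢
          rw [h1, Q.first_act]
          refine SameDirection.trans ?_ (hVsub i (hi ht)).2
          rw [Frame.first_eq, Frame.sameDirection_comb_iff _ dir_one]
          exact hyd
  obtain ⟨K, hKc, hKd⟩ := key N
  rw [hN N le_rfl] at hKc hKd
  have huniv : Set.Icc (0 : unitInterval) 1 = Set.univ :=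
    Set.eq_univ_of_forall fun t => ⟨unitInterval.nonneg', unitInterval.le_one'⟩
  rw [huniv] at hKc hKd
  exact ⟨K, continuousOn_univ.mp hKc, fun t => hKd t (Set.mem_univ t)⟩

/-- After the velocity is lifted, the frame at the midpoint is turned through the principal argument
of the germ of `τ h`. The two germs are distinct, so this argument is not `π`; the turn stays inside
`(-π, π)` and misses the germ of `h`. -/
theorem exists_isTransport (P : PolarLift p) {Γ : Graph.{d, e}} {γ : Γ.Realization → S}
    (hγ : IsEmbedded γ) (h : Γ.H) :
    ∃ (f : MarkedFrame Q γ (.vert (Γ.src h))) (f' : MarkedFrame Q γ (.edge (Γ.edgeOf h))),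
      IsTransport h f f' := by
  obtain ⟨k, hk, hkd⟩ := exists_lift Q P (continuous_velocity hγ h)
    (fun t => hγ.regular h t t.2)
  have hmid : SameDirection (Q.ρ (k 1)).first (velocity γ h 1) := hkd 1
  have hpt : (Q.ρ (k 1)).pt = γ (Γ.point (.edge (Γ.edgeOf h))) := by
    rw [← halfEdgePath_one γ h]
    exact hmid.proj_eq
  let i : Γ.star (.edge (Γ.edgeOf h)) := ⟨Γ.τ h, Sym2.mem_mk_right _ _⟩
  let i₀ : Γ.star (.edge (Γ.edgeOf h)) := ⟨h, Sym2.mem_mk_left _ _⟩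
  obtain ⟨z, hz0, hz⟩ := (Q.ρ (k 1)).exists_comb_eq (u := germ γ _ i)
    ((germ_proj γ _ i).trans hpt.symm) (germ_ne_zero hγ _ i)
  have hrot : ∀ α, Dir (firstCol (p (P.rot α))) α := fun α => by
    rw [P.map_rot, firstCol_rotation]
    exact ⟨1, one_pos, by simp⟩
  have h1 : SameDirection (Q.ρ (Q.act (k 1) (P.rot z.arg))).first (germ γ _ i) := by
    rw [hz, Q.first_act, Frame.sameDirection_comb_iff _ (dir_arg hz0)]
    exact hrot _
  have hne : z.arg ≠ Real.pi := by
    intro hpi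
    have h2 := (sameDirection_midpointGerm_iff hmid (P.rot z.arg)).mpr (hpi ▸ hrot z.arg)
    have h3 : i = i₀ := hγ.distinct _ _ _ (h1.symm.trans h2)
    exact Γ.τ_ne h (congrArg Subtype.val h3)
  have hlt : z.arg < Real.pi := lt_of_le_of_ne (Complex.arg_le_pi z) hne
  have hgt := Complex.neg_pi_lt_arg z
  have hcr := P.continuous_rot
  refine ⟨⟨k 0, ⟨h, rfl⟩, hkd 0⟩, ⟨_, i, h1⟩, k, fun t => Q.act (k 1) (P.rot (z.arg * t)), hk, ?_,
    rfl, hkd, by simp [P.rot_zero, Q.act_one], fun t => ⟨?_, ?_⟩, by simp⟩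
  · exact Q.continuous_act.comp (Continuous.prodMk continuous_const (by fun_prop))
  · rw [Q.pt_act, hpt]
  · rw [sameDirection_midpointGerm_iff hmid]
    intro hd
    have ht0 : (0 : ℝ) ≤ t := t.2.1
    have ht1 : (t : ℝ) ≤ 1 := t.2.2
    have hpi := Real.pi_pos
    have hb : |z.arg * t| < Real.pi := by
      rw [abs_mul, abs_of_nonneg ht0]
      exact lt_of_le_of_lt (mul_le_of_le_one_right (abs_nonneg _) ht1) (abs_lt.mpr ⟨hgt, hlt⟩)
    rw [abs_lt] at hb
    have e1 := (hrot (z.arg * t)).arg_eq hb.1 hb.2.le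
    have e2 := hd.arg_eq (by linarith) le_rfl
    linarith [hb.2]

end TransportExistence

/-! ### Structures induced by a surface -/

theorem eqToHom_type_apply {A B : Type d} (h : A = B) (x : A) :
    (eqToHom h : A ⟶ B) x = cast h x := by
  subst h
  rfl

section Induced

variable {S : Type b} [TopologicalSpace S] [ChartedSpace (EuclideanHalfSpace 2) S]
  [IsManifold (𝓡∂ 2) ∞ S] {𝔾 : Type a} [Group 𝔾] [TopologicalSpace 𝔾] [IsTopologicalGroup 𝔾]
  {p : 𝔾 →* GL (Fin 2) ℝ} {Q : GStructure.{a, b, c} p S} {Γ : Graph.{d, e}}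
  {γ : Γ.Realization → S}

/-- The frame `f x`, for `x` in `p⁻¹(O(1))`. -/
def MarkedFrame.act {X : Γ.Cell} (f : MarkedFrame Q γ X) {ε : ℤˣ} {x : 𝔾}
    (hx : p x = reflection ε) : MarkedFrame Q γ X :=
  ⟨Q.act f.1 x, by
    obtain ⟨i, hi⟩ := f.2
    refine ⟨i, SameDirection.trans ?_ hi⟩
    rw [Q.first_act, Frame.first_eq, Frame.sameDirection_comb_iff _ dir_one, hx,
      ← one_mul (reflection ε), firstCol_mul_reflection, firstCol_one]
    exact dir_one⟩

theorem GraphStructure.len_eq (L : GraphStructure.{a, c, d, e} p Γ) {X : Γ.Cell}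
    (D : CellFrame Q γ X) : (L.lift.obj X).len = D.len := by
  obtain ⟨o⟩ := (L.lift.obj X).frame_nonempty
  have h := Fintype.card_congr
    ((((L.lift.obj X).label o).trans (Equiv.cast (L.carrier_eq X))).trans D.label.symm)
  simpa using h

namespace IsInduced

variable {L : GraphStructure.{a, c, d, e} p Γ}
  {β : ∀ X : Γ.Cell, (L.lift.obj X).Frame ≃ FrameClass Q γ X}

/-- Translations are powers of `rotate`, whose action is prescribed whenever one marked frame is
next to another. The standard marked frames provide such pairs at every index. -/
theorem act_affine_one (hL : IsInduced Q γ L β) {X : Γ.Cell} (D : CellFrame Q γ X)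
    (P : PolarLift p) {o : (L.lift.obj X).Frame} {f : MarkedFrame Q γ X} {k : ℤ} {y : 𝔾} {ε : ℤˣ}
    (hy : p y = reflection ε) (ho : β X o = frameClass f) (hf : D.HasPolar P f k y) (m : ℤ) :
    β X ((L.lift.obj X).act o (DeltaG.affine _ m 1 1 (map_one_eq_reflection p))) =
      frameClass (D.std P (k + ε * m) hy 0) := by
  have hrot : ∀ {o' : (L.lift.obj X).Frame} {k' : ℤ} {y' : 𝔾} {ε' : ℤˣ}
      (hy' : p y' = reflection ε'), β X o' = frameClass (D.std P k' hy' 0) →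
      β X ((L.lift.obj X).act o' (DeltaG.rotate p _)) =
        frameClass (D.std P (k' + ε') hy' 0) := fun hy' ho' =>
    hL.rotate X _ _ _ ho' (D.isNext_std P _ hy')
  have hstep : ∀ m : ℤ, (L.lift.obj X).act o
      (DeltaG.affine _ (m + 1) 1 1 (map_one_eq_reflection p)) =
      (L.lift.obj X).act ((L.lift.obj X).act o
        (DeltaG.affine _ m 1 1 (map_one_eq_reflection p))) (DeltaG.rotate p _) := by
    intro m
    rw [← (L.lift.obj X).act_trans, DeltaG.rotate_eq_affine, DeltaG.affine_trans]
    congr 1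
    exact DeltaG.affine_congr (by simp) (by simp) (by simp)
  induction m using Int.induction_on with
  | zero =>
    have h1 : DeltaG.affine (L.lift.obj X).len 0 1 1 (map_one_eq_reflection p) = Iso.refl _ := by
      ext
      refine congrArg (Quotient.mk _) (PreHom.ext rfl (funext fun l => ?_) rfl)
      change 0 + ((1 : ℤˣ) : ℤ) * l = l
      simp
    rw [h1, (L.lift.obj X).act_refl, ho, mul_zero, add_zero]
    exact hf.frameClass_eq hy (D.hasPolar_std P k hy 0)
  | succ i ih =>
    rw [hstep, hrot hy ih, show k + ε * ((i : ℤ) + 1) = k + ε * i + ε by ring]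
  | pred i ih =>
    -- A backward step cannot be computed directly. The class of `o₁` gets unknown coordinates,
    -- which are found by turning forward and comparing with the known result.
    set o₁ := (L.lift.obj X).act o
      (DeltaG.affine _ (-(i : ℤ) - 1) 1 1 (map_one_eq_reflection p)) with ho₁
    obtain ⟨f₁, hf₁⟩ := Quotient.exists_rep (β X o₁)
    obtain ⟨k₁, ε₁, y₁, hy₁, hk₁⟩ := D.exists_hasPolar P f₁
    have e1 : β X o₁ = frameClass (D.std P k₁ hy₁ 0) :=
      hf₁.symm.trans (hk₁.frameClass_eq hy₁ (D.hasPolar_std P k₁ hy₁ 0))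
    have e2 := hrot hy₁ e1
    have e3 := hstep (-(i : ℤ) - 1)
    rw [sub_add_cancel, ← ho₁] at e3
    rw [← e3, ih] at e2
    obtain ⟨j, hj, hyj⟩ := ((D.hasPolar_std P _ hy₁ 0).of_frameClass_eq hy₁ e2.symm).exists_int
      (D.hasPolar_std P _ hy 0) hy₁ hy
    have hε : ε₁ = ε := reflection_injective (by
      rw [← hy, ← hy₁, hyj, map_mul, P.map_rot, PolarLift.rotation_two_pi_mul, one_mul])
    subst hε
    have e4 := (D.hasPolar_std P k₁ hy₁ 0).shift hyj
    rw [show k₁ + j * (D.len + 1) = k + ε₁ * (-(i : ℤ) - 1) by linear_combination -hj] at e4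
    rw [e1]
    exact e4.frameClass_eq hy (D.hasPolar_std P _ hy 0)

/-- The action of the automorphisms of `[n]` is determined by the surface. -/
theorem act_affine (hL : IsInduced Q γ L β) {X : Γ.Cell} (D : CellFrame Q γ X)
    (P : PolarLift p) {o : (L.lift.obj X).Frame} {f : MarkedFrame Q γ X} {k : ℤ} {y : 𝔾} {ε : ℤˣ}
    (hy : p y = reflection ε) (ho : β X o = frameClass f) (hf : D.HasPolar P f k y) (m : ℤ)
    {ε' : ℤˣ} {y' : 𝔾} (hy' : p y' = reflection ε') :
    β X ((L.lift.obj X).act o (DeltaG.affine _ m ε' y' hy')) =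
      frameClass (D.std P (k + ε * m) (map_mul_eq_reflection hy hy') 0) := by
  -- For the right action, the translation acts before the element of `p⁻¹(O(1))`; both actions are
  -- prescribed.
  have h1 : DeltaG.affine (L.lift.obj X).len m ε' y' hy' = DeltaG.reflect _ ε' y' hy' ≪≫
      DeltaG.affine _ m 1 1 (map_one_eq_reflection p) := by
    rw [DeltaG.reflect_eq_affine, DeltaG.affine_trans]
    exact DeltaG.affine_congr (by simp) (by simp) (by simp)
  have h2 := hL.act_affine_one D P hy ho hf m
  rw [h1, (L.lift.obj X).act_trans, hL.reflect X _ _ ((D.std P (k + ε * m) hy 0).act hy') ε' y' hy'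
    h2 rfl]
  exact ((D.hasPolar_std P _ hy 0).act rfl).frameClass_eq (map_mul_eq_reflection hy hy')
    (D.hasPolar_std P _ _ 0)

/-- The numbering of the half-edges by the structured frames is determined by the surface. -/
theorem label_eq (hL : IsInduced Q γ L β) (hγ : IsEmbedded γ) {X : Γ.Cell} (D : CellFrame Q γ X)
    (P : PolarLift p) {o : (L.lift.obj X).Frame} {f : MarkedFrame Q γ X} {k : ℤ} {y : 𝔾} {ε : ℤˣ}
    (hy : p y = reflection ε) (ho : β X o = frameClass f) (hf : D.HasPolar P f k y)
    (i : Fin ((L.lift.obj X).len + 1)) :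
    cast (L.carrier_eq X) ((L.lift.obj X).label o i) = D.lab (k + ε * (i : ℕ)) := by
  -- Turning `i` times brings the half-edge numbered `i` to the number `0`, where its direction is
  -- prescribed.
  have h1 := hL.act_affine_one D P hy ho hf (i : ℕ)
  have h2 := hL.label_zero X _ _ h1
  rw [(L.lift.obj X).label_act, DeltaG.vertexMap_affine] at h2
  have h3 : DeltaG.vertex (L.lift.obj X).len
      (((i : ℕ) : ℤ) + ((1 : ℤˣ) : ℤ) * ((0 : Fin ((L.lift.obj X).len + 1)) : ℕ)) = i := by
    simp [DeltaG.vertex_coe]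
  rw [h3] at h2
  exact hγ.distinct _ _ _ (h2.symm.trans ((D.hasPolar_std P _ hy 0).sameDirection hy))

variable {L' : GraphStructure.{a, c, d, e} p Γ}
  {β' : ∀ X : Γ.Cell, (L'.lift.obj X).Frame ≃ FrameClass Q γ X}

/-- Two structures induced by the same surface are isomorphic, cell by cell. -/
theorem exists_iso (hL : IsInduced Q γ L β) (hL' : IsInduced Q γ L' β')
    {X : Γ.Cell} (D : CellFrame Q γ X) (P : PolarLift p) :
    ∃ (hn : (L.lift.obj X).len = (L'.lift.obj X).len) (η : L.lift.obj X ≅ L'.lift.obj X),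
      ∀ o o', β X o = β' X o' →
        StructuredSet.comps η.hom o' o = eqToHom (congrArg DeltaG.mk hn) := by
  have hn : (L.lift.obj X).len = (L'.lift.obj X).len := (L.len_eq D).trans (L'.len_eq D).symm
  obtain ⟨o₀⟩ := (L.lift.obj X).frame_nonempty
  obtain ⟨f, hf⟩ := Quotient.exists_rep (β X o₀)
  obtain ⟨k, ε, y, hy, hk⟩ := D.exists_hasPolar P f
  have ho₀ : β X o₀ = frameClass f := hf.symm
  have ho₀' : β' X ((β' X).symm (β X o₀)) = frameClass f := by
    rw [Equiv.apply_symm_apply, ho₀]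
  refine ⟨hn, StructuredSet.isoOfFrames (congrArg DeltaG.mk hn) ((β' X).symm (β X o₀)) o₀,
    fun o o' h => ?_⟩
  -- One pair of frames is matched by construction. Any other matched pair arises from it by a
  -- common automorphism, because the surface determines the action in both structures.
  obtain ⟨m, ε', y', hy', hm⟩ := DeltaG.exists_eq_affine ((L.lift.obj X).diff o₀ o)
  have h1 : (L.lift.obj X).act o₀ (DeltaG.affine _ m ε' y' hy') = o := by
    rw [← hm, (L.lift.obj X).act_diff]
  have h2 : (L'.lift.obj X).act ((β' X).symm (β X o₀)) (DeltaG.affine _ m ε' y' hy') = o' := by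
    apply (β' X).injective
    rw [hL'.act_affine D P hy ho₀' hk m hy', ← h, ← h1, hL.act_affine D P hy ho₀ hk m hy']
  rw [← h1, ← h2, StructuredSet.comps_act]
  change _ ≫ StructuredSet.comps (StructuredSet.homOfComp _ _ _) _ _ ≫ _ = _
  rw [StructuredSet.comps_homOfComp]
  exact DeltaG.affine_hom_comp_eqToHom hn m hy' _

/-- An isomorphism that matches frames lies over the identity. -/
theorem under_eq_cast (hγ : IsEmbedded γ) (hL : IsInduced Q γ L β) (hL' : IsInduced Q γ L' β')
    {X : Γ.Cell} (D : CellFrame Q γ X) (P : PolarLift p)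
    (hn : (L.lift.obj X).len = (L'.lift.obj X).len) {η : L.lift.obj X ⟶ L'.lift.obj X}
    (hη : ∀ o o', β X o = β' X o' →
      StructuredSet.comps η o' o = eqToHom (congrArg DeltaG.mk hn))
    (q' : (L'.lift.obj X).Frame) (q : (L.lift.obj X).Frame) (i : (L.lift.obj X).carrier) :
    StructuredSet.under η q' q i = cast ((L.carrier_eq X).trans (L'.carrier_eq X).symm) i := by
  obtain ⟨o⟩ := (L.lift.obj X).frame_nonempty
  obtain ⟨f, hf⟩ := Quotient.exists_rep (β X o)
  obtain ⟨k, ε, y, hy, hk⟩ := D.exists_hasPolar P f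
  have ho : β X o = frameClass f := hf.symm
  have ho' : β' X ((β' X).symm (β X o)) = frameClass f := by rw [Equiv.apply_symm_apply, ho]
  rw [StructuredSet.under_indep _ _ ((β' X).symm (β X o)) _ o, StructuredSet.under,
    hη _ _ (ho.trans ho'.symm), DeltaG.vertexMap_eqToHom hn]
  obtain ⟨j, rfl⟩ := ((L.lift.obj X).label o).surjective i
  rw [Equiv.symm_apply_apply]
  have e1 := hL.label_eq hγ D P hy ho hk j
  have e2 := hL'.label_eq hγ D P hy ho' hk (Fin.cast (by rw [hn]) j)
  apply (cast_bijective (L'.carrier_eq X)).injective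
  rw [cast_cast, e1, e2]
  rfl

/-- Two structures induced by the same surface are canonically isomorphic. -/
theorem existsUnique_canonicalIso (hγ : IsEmbedded γ) (D : ∀ X, CellFrame Q γ X)
    (P : PolarLift p) (hL : IsInduced Q γ L β) (hL' : IsInduced Q γ L' β') :
    ∃! η : L.lift ≅ L'.lift, IsCanonicalIso β β' η := by
  choose hn η hη using fun X => exists_iso hL hL' (D X) P
  have hnat : ∀ {X Y : Γ.Cell} (u : Γ.CellHom X Y),
      L.lift.map (X := X) (Y := Y) u ≫ (η Y).hom =
        (η X).hom ≫ L'.lift.map (X := X) (Y := Y) u := by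
    intro X Y u
    cases u with
    | id =>
      change L.lift.map (𝟙 X) ≫ _ = _ ≫ L'.lift.map (𝟙 X)
      simp
    | inc h =>
      change L.lift.map (Γ.inc h) ≫ _ = _ ≫ L'.lift.map (Γ.inc h)
      -- Naturality can be tested in a single pair of frames; in a transported pair both structures
      -- have the same component.
      obtain ⟨f, f', hff⟩ := exists_isTransport Q P hγ h
      have ho := (β (.vert (Γ.src h))).apply_symm_apply (frameClass f)
      have ho' := (β (.edge (Γ.edgeOf h))).apply_symm_apply (frameClass f')
      have hq := (β' (.vert (Γ.src h))).apply_symm_apply (frameClass f)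
      have hq' := (β' (.edge (Γ.edgeOf h))).apply_symm_apply (frameClass f')
      refine StructuredSet.hom_ext_comp ((β' _).symm (frameClass f')) ((β _).symm (frameClass f)) ?_
      rw [StructuredSet.comps_comp _ _ _ ((β _).symm (frameClass f')),
        StructuredSet.comps_comp _ _ _ ((β' _).symm (frameClass f)),
        hη _ _ _ (ho'.trans hq'.symm), hη _ _ _ (ho.trans hq.symm),
        hL.transport h _ _ f f' ho ho' hff, hL'.transport h _ _ f f' hq hq' hff]
      exact DeltaG.collapse_comp_eqToHom (hn _) (hn _) _ _
  refine ⟨NatIso.ofComponents η hnat, ⟨?_, fun X o o' h => ⟨hn X, hη X o o' h⟩⟩, ?_⟩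
  · refine NatTrans.ext (funext fun X => ?_)
    rw [eqToHom_app]
    ext i
    refine Eq.trans ?_ (eqToHom_type_apply _ i).symm
    exact under_eq_cast hγ hL hL' (D X) P (hn X) (hη X) _ _ i
  -- On each cell, the frame condition fixes one component of any canonical isomorphism, hence all
  -- of it.
  · intro η' hη'
    ext X : 3
    obtain ⟨o⟩ := (L.lift.obj X).frame_nonempty
    have h : β X o = β' X ((β' X).symm (β X o)) := ((β' X).apply_symm_apply _).symm
    refine StructuredSet.hom_ext_comp ((β' X).symm (β X o)) o ?_
    obtain ⟨hn', h1⟩ := hη'.frames X _ _ h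
    rw [h1]
    exact (hη X _ _ h).symm

end IsInduced

end Induced

/-! ### The canonical structure -/

section Canonical

variable {Γ : Graph.{d, e}}

theorem Graph.finite_star (hfin : ∀ v, Finite {h : Γ.H // Γ.src h = v}) :
    ∀ X : Γ.Cell, Finite (Γ.star X)
  | .vert v => hfin v
  | .edge x => (Set.Finite.subset (Set.toFinite {x.2.choose, Γ.τ x.2.choose}) (by
      intro h hh
      have h1 : h ∈ x.1 := hh
      rw [x.2.choose_spec] at h1
      exact Sym2.mem_iff.mp h1) : {h : Γ.H | h ∈ x.1}.Finite)

theorem Graph.nonempty_star (hne : ∀ v, Nonempty {h : Γ.H // Γ.src h = v}) :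
    ∀ X : Γ.Cell, Nonempty (Γ.star X)
  | .vert v => hne v
  | .edge x => ⟨⟨x.2.choose, by
      have h1 := Sym2.mem_mk_left x.2.choose (Γ.τ x.2.choose)
      rwa [← x.2.choose_spec] at h1⟩⟩

theorem Graph.card_star_edge (h : Γ.H) : Nat.card (Γ.star (.edge (Γ.edgeOf h))) = 2 := by
  rw [← Set.ncard_pair (Γ.τ_ne h).symm]
  have hs : {h' : Γ.H | h' ∈ (Γ.edgeOf h).1} = {h, Γ.τ h} := Set.ext fun h' => Sym2.mem_iff
  rw [← hs]
  rfl

variable {S : Type b} [TopologicalSpace S] [ChartedSpace (EuclideanHalfSpace 2) S]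
  [IsManifold (𝓡∂ 2) ∞ S] {𝔾 : Type a} [Group 𝔾] [TopologicalSpace 𝔾]
  {p : 𝔾 →* GL (Fin 2) ℝ} {Q : GStructure.{a, b, c} p S} {γ : Γ.Realization → S}

namespace CellFrame

theorem len_edge {h : Γ.H} (D : CellFrame Q γ (.edge (Γ.edgeOf h))) : D.len = 1 := by
  have h1 := Nat.card_congr D.label
  rw [Graph.card_star_edge, Nat.card_fin] at h1
  omega

variable [IsTopologicalGroup 𝔾] {X : Γ.Cell} (D : CellFrame Q γ X) (P : PolarLift p)

theorem structuredSet_label_zero (f : MarkedFrame Q γ X) :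
    SameDirection (Q.ρ f.1).first (germ γ X ((D.structuredSet P).label (frameClass f) 0)) := by
  obtain ⟨k, ε, y, hy, hk⟩ := D.exists_hasPolar P f
  have h := D.structuredSet_label P hy hk 0
  rw [Fin.val_zero, Nat.cast_zero, mul_zero, add_zero] at h
  exact h ▸ hk.sameDirection hy

theorem structuredSet_reflect {f f' : MarkedFrame Q γ X} {ε : ℤˣ} {x : 𝔾}
    (hx : p x = reflection ε) (hf : f'.1 = Q.act f.1 x) :
    (D.structuredSet P).act (frameClass f) (DeltaG.reflect _ ε x hx) = frameClass f' := by
  obtain ⟨k, ε', y, hy, hk⟩ := D.exists_hasPolar P f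
  rw [DeltaG.reflect_eq_affine]
  refine D.structuredSet_act P hy hx hk ?_
  rw [mul_zero, add_zero]
  exact hk.act hf

theorem structuredSet_rotate {f f' : MarkedFrame Q γ X} (h : IsNext f f') :
    (D.structuredSet P).act (frameClass f) (DeltaG.rotate p _) = frameClass f' := by
  obtain ⟨k, ε, y, hy, hk⟩ := D.exists_hasPolar P f
  rw [DeltaG.rotate_eq_affine]
  refine D.structuredSet_act P hy _ hk ?_
  rw [mul_one, mul_one]
  exact hk.of_isNext hy h

end CellFrame

section Lift

variable [IsTopologicalGroup 𝔾] (D : ∀ X : Γ.Cell, CellFrame Q γ X) (P : PolarLift p)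
  (o : ∀ h : Γ.H, FrameClass Q γ (.vert (Γ.src h)))
  (o' : ∀ h : Γ.H, FrameClass Q γ (.edge (Γ.edgeOf h)))

/-- The lift of the incidence diagram on morphisms. -/
def liftMap : ∀ {X Y : Γ.Cell}, Γ.CellHom X Y →
    ((D X).structuredSet P ⟶ (D Y).structuredSet P)
  | _, _, .id _ => 𝟙 _
  | _, _, .inc h => StructuredSet.homOfComp (o' h) (o h) (DeltaG.collapse p _ _)

theorem liftMap_comp {X Y Z : Γ.Cell} (u : Γ.CellHom X Y) (v : Γ.CellHom Y Z) :
    liftMap D P o o' (u.comp v) = liftMap D P o o' u ≫ liftMap D P o o' v := by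
  cases u with
  | id => exact (Category.id_comp _).symm
  | inc h =>
    cases v
    exact (Category.comp_id _).symm

/-- The lift of the incidence diagram, when frames at the ends of the half-edges are given. -/
def liftFunctor : Γ.Cell ⥤ StructuredSet.{a, d, c} p where
  obj X := (D X).structuredSet P
  map u := liftMap D P o o' u
  map_id _ := rfl
  map_comp u v := liftMap_comp D P o o' u v

variable {f : ∀ h : Γ.H, MarkedFrame Q γ (.vert (Γ.src h))}
  {f' : ∀ h : Γ.H, MarkedFrame Q γ (.edge (Γ.edgeOf h))}

/-- Transport starts along `h` and ends along `τ h`, so these are the elements numbered `0`. The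
edge has just one other element, namely `h`, so the collapse induces the incidence map. -/
theorem under_liftMap (hγ : IsEmbedded γ) (ht : ∀ h, IsTransport h (f h) (f' h)) {X Y : Γ.Cell}
    (u : Γ.CellHom X Y) (q' : ((D Y).structuredSet P).Frame)
    (q : ((D X).structuredSet P).Frame) (i : Γ.star X) :
    StructuredSet.under (liftMap D P (fun h => frameClass (f h)) (fun h => frameClass (f' h)) u)
      q' q i = u.onStar i := by
  cases u with
  | id =>
    exact StructuredSet.under_id _ q' q i
  | inc h =>
    have h0 : ((D (.vert (Γ.src h))).structuredSet P).label (frameClass (f h)) 0 =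
        (⟨h, rfl⟩ : {h' : Γ.H // Γ.src h' = Γ.src h}) :=
      hγ.distinct _ _ _ (((D _).structuredSet_label_zero P (f h)).symm.trans
        (ht h).sameDirection_fst)
    have h0' : ((D (.edge (Γ.edgeOf h))).structuredSet P).label (frameClass (f' h)) 0 =
        (⟨Γ.τ h, Sym2.mem_mk_right _ _⟩ : {h' : Γ.H // h' ∈ (Γ.edgeOf h).1}) :=
      hγ.distinct _ _ _ (((D _).structuredSet_label_zero P (f' h)).symm.trans
        (ht h).sameDirection_snd)
    by_cases hi : i.1 = h
    · refine (StructuredSet.under_collapse_zero _ _ q' q ((Subtype.ext hi).trans h0.symm)).trans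
        (h0'.trans ?_)
      exact (if_pos hi).symm
    · refine (StructuredSet.under_collapse_of_ne _ _ q' q
        fun h1 => hi (congrArg Subtype.val (h1.trans h0))).trans ?_
      refine Eq.trans ?_ (if_neg hi).symm
      set z := ((D (.edge (Γ.edgeOf h))).structuredSet P).label (frameClass (f' h))
        (Fin.last _) with hz
      have hne : z ≠ (⟨Γ.τ h, Sym2.mem_mk_right _ _⟩ : {h' : Γ.H // h' ∈ (Γ.edgeOf h).1}) := by
        rw [hz, ← h0']
        intro h1
        have h2 := congrArg Fin.val ((Equiv.injective _) h1)
        have h3 := (D (.edge (Γ.edgeOf h))).len_edge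
        rw [Fin.val_last, Fin.val_zero] at h2
        change (D (.edge (Γ.edgeOf h))).len = 0 at h2
        omega
      exact Subtype.ext ((Graph.eq_or_eq_of_mem_edgeOf z.2).resolve_right
        fun h1 => hne (Subtype.ext h1))

/-- One transported pair per half-edge serves to define the morphism, whose component there is the
collapse. -/
theorem exists_isInduced (hγ : IsEmbedded γ) (D : ∀ X : Γ.Cell, CellFrame Q γ X)
    (P : PolarLift p) :
    ∃ (L : GraphStructure.{a, c, d, e} p Γ)
      (β : ∀ X : Γ.Cell, (L.lift.obj X).Frame ≃ FrameClass Q γ X), IsInduced Q γ L β := by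
  choose f f' ht using fun h => exists_isTransport Q P hγ h
  refine ⟨⟨liftFunctor D P (fun h => frameClass (f h)) (fun h => frameClass (f' h)), ?_⟩,
    fun X => Equiv.refl _, ?_⟩
  · refine CategoryTheory.Functor.ext (fun X => rfl) fun X Y u => ?_
    ext i
    exact under_liftMap D P hγ ht u _ _ i
  refine ⟨?_, ?_, ?_, ?_⟩
  · rintro X _ g rfl
    exact (D X).structuredSet_label_zero P g
  · rintro X _ g g' ε x hx rfl hg
    exact (D X).structuredSet_reflect P hx hg
  · rintro X _ g g' rfl hg
    exact (D X).structuredSet_rotate P hg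
  · rintro h _ _ g g' rfl rfl hg
    -- Any other transported pair arises from the chosen one by an element `x` of `p⁻¹(O(1))` acting
    -- at both ends, and the collapse commutes with `x`.
    obtain ⟨ε, x, hx, h1, h2⟩ := (ht h).unique P hg
    have e1 := (D (.vert (Γ.src h))).structuredSet_reflect P hx (f := f h) (f' := (f h).act hx) rfl
    have e2 := (D (.edge (Γ.edgeOf h))).structuredSet_reflect P hx (f := f' h)
      (f' := (f' h).act hx) rfl
    rw [h1 ((f h).act hx) rfl] at e1
    rw [h2 ((f' h).act hx) rfl] at e2
    exact StructuredSet.comps_collapse_of_reflect (D (.edge (Γ.edgeOf h))).len_edge hx e2 e1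

end Lift

end Canonical

end

end PlanarGraph

/-! ### Existence and uniqueness of the induced structure. -/

theorem mainTheorem5 {𝔾 : Type*} [Group 𝔾] [TopologicalSpace 𝔾] [IsTopologicalGroup 𝔾]
    (p : 𝔾 →* GL (Fin 2) ℝ) (hp : IsConnectiveCovering p)
    {S : Type*} [TopologicalSpace S] [T2Space S] [SecondCountableTopology S] [ConnectedSpace S]
    [ChartedSpace (EuclideanHalfSpace 2) S] [IsManifold (𝓡∂ 2) ∞ S] (Q : GStructure p S)
    (Γ : Graph) (hfin : ∀ v, Finite {h : Γ.H // Γ.src h = v})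
    (hne : ∀ v, Nonempty {h : Γ.H // Γ.src h = v})
    (γ : Γ.Realization → S) (hγ : IsEmbedded γ) :
    ∃ (L : GraphStructure p Γ) (β : ∀ X : Γ.Cell, (L.lift.obj X).Frame ≃ FrameClass Q γ X),
      IsInduced Q γ L β ∧
      ∀ (L' : GraphStructure p Γ)
        (β' : ∀ X : Γ.Cell, (L'.lift.obj X).Frame ≃ FrameClass Q γ X),
        IsInduced Q γ L' β' → ∃! η : L.lift ≅ L'.lift, IsCanonicalIso β β' η := by
  obtain ⟨P⟩ := exists_polarLift p hp.isCoveringMap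
  have hD : ∀ X : Γ.Cell, Nonempty (CellFrame Q γ X) := fun X =>
    haveI := Graph.finite_star hfin X
    haveI := Graph.nonempty_star hne X
    exists_cellFrame Q hγ X
  let D : ∀ X : Γ.Cell, CellFrame Q γ X := fun X => (hD X).some
  obtain ⟨L, β, hL⟩ := exists_isInduced hγ D P
  exact ⟨L, β, hL, fun L' β' hL' => hL.existsUnique_canonicalIso hγ D P hL'⟩
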